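/- A uni-trivalent graph is a finite graph all of whose vertices are univalent or trivalent and each of whose connected components contains at least one univalent vertex; it is vertex-oriented if a cyclic order of the edges is fixed at each trivalent vertex. A Chinese character diagram on $n$ strings consists of $n$ ordered oriented lines (strings) and a vertex-oriented uni-trivalent graph whose univalent vertices lie on the strings, up to homeomorphisms preserving each string, its orientation, and the orientations at the trivalent vertices. The diagram is g-connected if the graph is connected, and its degree is half the number of vertices of the graph. Let $\mathcal P_n$ be the $\mathbb Q$-vector space spanned by these diagrams modulo the STU relation $S=T-U$: if $T$ has two univalent vertices that are neighbours on a string, $U$ is obtained from $T$ by exchanging them, and $S$ by joining them to a trivalent vertex which is attached to the string by an edge at their place (with the string drawn from left to right and the graph above it, the trivalent vertex is oriented counterclockwise: edge to the string, edge of the vertex on the right in $T$, edge of the vertex on the left in $T$). For $1\le i\le n$ let $\Delta_i:\mathcal P_n\to\mathcal P_{n+1}$ be the linear map which replaces the $i$-th string by two strings and sums over all ways of attaching each univalent vertex of the $i$-th string to one of the two new strings. Let $\varepsilon_i:\mathcal P_n\to\mathcal P_{n-1}$ be the linear map which sends a diagram to $0$ if it has a univalent vertex on the $i$-th string, and otherwise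 removes that string. Put $$d(x)=1\otimes x-\Delta_1(x)+\Delta_2(x)-\dots+(-1)^n\Delta_n(x)+(-1)^{n+1}\,x\otimes 1,\qquad x\in\mathcal P_n,$$ where $1\otimes x$ (resp. $x\otimes 1$) is obtained from $x$ by adding an empty string on the left (resp. right). A diagram, regarded as an element of $\mathcal P_n$, is non-degenerate if all $\varepsilon_i$ vanish on it. Let $\mathcal Q^{\mathbb Z}_n\subset\mathcal P_n$ be the subgroup of integral linear combinations of g-connected non-degenerate Chinese character diagrams, and let $C^n_{sym}(\mathcal Q^{\mathbb Z})$ be the group of all $x\in\mathcal Q^{\mathbb Z}_n$ with $$x+(-1)^{n(n+1)/2}\sigma(x)=0,$$ where $\sigma$ reverses the order of the $n$ strings. With the differential $d$, which preserves the degree, these groups form a complex $C^*_{sym}(\mathcal Q^{\mathbb Z})$ graded by the degree of diagrams. Then for every integer $m\ge 1$, the degree $m$ part of the fourth cohomology group of the complex $(C^*_{sym}(\mathcal Q^{\mathbb Z}),d)$ is annihilated by $$2\,(m+1)!\,(m!)^2\,[(m-1)!]^2.$$ -/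

import Mathlib

open scoped Nat

namespace CobarComplex

noncomputable section

/-- A vertex-oriented uni-trivalent graph, given by its finite set of flags (half-edges).
The orbits of the fixed-point-free involution `edge` are the edges.  The orbits of `vert` are the
vertices: a fixed point is a univalent (external) vertex, a 3-cycle is a trivalent (internal)
vertex together with its cyclic order. -/
structure Graph : Type 1 where
  Flag : Type
  finite : Finite Flag
  edge : Equiv.Perm Flag
  edge_edge : ∀ h, edge (edge h) = h
  edge_ne : ∀ h, edge h ≠ h
  vert : Equiv.Perm Flag
  vert_vert_vert : ∀ h, vert (vert (vert h)) = h

/-- Two flags lie in the same connected component. -/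
def Graph.Linked (G : Graph) : G.Flag → G.Flag → Prop :=
  Relation.EqvGen fun h k => k = G.edge h ∨ k = G.vert h

def Graph.Connected (G : Graph) : Prop :=
  Nonempty G.Flag ∧ ∀ h k, G.Linked h k

/-- The number of vertices, univalent and trivalent. -/
def Graph.numVertices (G : Graph) : ℕ :=
  Nat.card (Quotient (Equiv.Perm.SameCycle.setoid G.vert))

/-- A Chinese character diagram on `n` ordered strings: every connected component of the dashed
graph has a univalent vertex, and the univalent vertices are placed on the strings;
`legs i` lists those on the `i`-th string, in the order in which the oriented string meets them. -/
structure Diagram (n : ℕ) : Type 1 where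
  graph : Graph
  anchored : ∀ h, ∃ k, graph.vert k = k ∧ graph.Linked h k
  legs : Fin n → List graph.Flag
  nodup_legs : (∑ i, (legs i : Multiset graph.Flag)).Nodup
  mem_legs : ∀ h, h ∈ ∑ i, (legs i : Multiset graph.Flag) ↔ graph.vert h = h

namespace Diagram

variable {n : ℕ}

/-- Equivalence of diagrams: a homeomorphism preserving each string, its orientation, and the
orientations at the internal vertices. -/
def Equivalent (D E : Diagram n) : Prop :=
  ∃ f : D.graph.Flag ≃ E.graph.Flag,
    (∀ h, f (D.graph.edge h) = E.graph.edge (f h)) ∧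
    (∀ h, f (D.graph.vert h) = E.graph.vert (f h)) ∧
    ∀ i, (D.legs i).map f = E.legs i

/-- The same dashed graph with its univalent vertices placed on other strings. -/
def rearrange {k : ℕ} (D : Diagram n) (legs' : Fin k → List D.graph.Flag)
    (h : ∑ i, (legs' i : Multiset D.graph.Flag) = ∑ i, (D.legs i : Multiset D.graph.Flag)) :
    Diagram k where
  graph := D.graph
  anchored := D.anchored
  legs := legs'
  nodup_legs := h ▸ D.nodup_legs
  mem_legs := h ▸ D.mem_legs

theorem sum_update {α : Type} (f : Fin n → List α) (i : Fin n) (l : List α) :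
    ∑ j, (Function.update f i l j : Multiset α)
      = (l : Multiset α) + ∑ j ∈ Finset.univ.erase i, (f j : Multiset α) := by
  rw [← Finset.add_sum_erase _ _ (Finset.mem_univ i)]
  congr 1
  · simp
  · refine Finset.sum_congr rfl fun j hj => ?_
    rw [Function.update_of_ne (Finset.ne_of_mem_erase hj)]

theorem sum_eq {α : Type} (f : Fin n → List α) (i : Fin n) :
    ∑ j, (f j : Multiset α)
      = (f i : Multiset α) + ∑ j ∈ Finset.univ.erase i, (f j : Multiset α) :=
  (Finset.add_sum_erase _ _ (Finset.mem_univ i)).symm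

theorem sum_insertNth {α : Type} (f : Fin n → List α) (p : Fin (n + 1)) (l : List α) :
    ∑ j, (Fin.insertNth (α := fun _ => List α) p l f j : Multiset α)
      = (l : Multiset α) + ∑ j, (f j : Multiset α) := by
  rw [Fin.sum_univ_succAbove _ p]; simp

/-- Exchange two neighbouring univalent vertices `x`, `y` on the `i`-th string. -/
def exchange (D : Diagram n) (i : Fin n) (l₁ l₂ : List D.graph.Flag) (x y : D.graph.Flag)
    (h : D.legs i = l₁ ++ x :: y :: l₂) : Diagram n :=
  D.rearrange (Function.update D.legs i (l₁ ++ y :: x :: l₂)) (by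
    rw [sum_update, sum_eq D.legs i, h]
    congr 1
    exact Multiset.coe_eq_coe.2 (List.Perm.append_left _ (List.Perm.swap _ _ _)))

end Diagram

open Classical in
/-- The permutation `v`, extended by a fixed point `inr false`, and with the fixed points `x`, `y`
of `v` and the new point `inr true` made into a cycle `inr true → y → x → inr true`. -/
def fuseVert {α : Type} (v : Equiv.Perm α) (x y : α) : Equiv.Perm (α ⊕ Bool) :=
  Equiv.swap (Sum.inr true) (Sum.inl y) * Equiv.swap (Sum.inl y) (Sum.inl x)
    * Equiv.sumCongr v (Equiv.refl Bool)

section fuseVert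

variable {α : Type} {v : Equiv.Perm α} {x y : α}

theorem fuseVert_false : fuseVert v x y (Sum.inr false) = Sum.inr false := by
  simp [fuseVert, Equiv.swap_apply_def]

theorem fuseVert_true : fuseVert v x y (Sum.inr true) = Sum.inl y := by
  simp [fuseVert, Equiv.swap_apply_def]

theorem fuseVert_left (hx : v x = x) : fuseVert v x y (Sum.inl x) = Sum.inr true := by
  simp [fuseVert, hx]

theorem fuseVert_right (hy : v y = y) (hxy : x ≠ y) :
    fuseVert v x y (Sum.inl y) = Sum.inl x := by
  simp [fuseVert, Equiv.swap_apply_def, hy, hxy]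

theorem fuseVert_of_ne (hx : v x = x) (hy : v y = y) {h : α} (h1 : h ≠ x) (h2 : h ≠ y) :
    fuseVert v x y (Sum.inl h) = Sum.inl (v h) := by
  have h3 : v h ≠ x := fun h' => h1 (v.injective (h'.trans hx.symm))
  have h4 : v h ≠ y := fun h' => h2 (v.injective (h'.trans hy.symm))
  simp [fuseVert, Equiv.swap_apply_def, h3, h4]

end fuseVert

/-- Join the univalent vertices `x ≠ y` of a graph into a trivalent vertex, whose third edge leads
to a new univalent vertex.  New flags: `inr true`, the third flag of the trivalent vertex, and
`inr false`, the new univalent vertex.  The cyclic order is `inr true → y → x → inr true`. -/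
def Graph.fuse (G : Graph) (x y : G.Flag) (hx : G.vert x = x) (hy : G.vert y = y) (hxy : x ≠ y) :
    Graph where
  Flag := G.Flag ⊕ Bool
  finite := by have := G.finite; infer_instance
  edge := Equiv.sumCongr G.edge Equiv.boolNot
  edge_edge := by rintro (h | h) <;> simp [G.edge_edge]
  edge_ne := by rintro (h | h) <;> simp [G.edge_ne]
  vert := fuseVert G.vert x y
  vert_vert_vert := by
    have key : ∀ h, h ≠ x → h ≠ y → G.vert h ≠ x ∧ G.vert h ≠ y := fun h h1 h2 =>
      ⟨fun h' => h1 (G.vert.injective (h'.trans hx.symm)),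
        fun h' => h2 (G.vert.injective (h'.trans hy.symm))⟩
    rintro (h | h)
    · by_cases h1 : h = x
      · subst h1
        rw [fuseVert_left hx, fuseVert_true, fuseVert_right hy hxy]
      · by_cases h2 : h = y
        · subst h2
          rw [fuseVert_right hy hxy, fuseVert_left hx, fuseVert_true]
        · obtain ⟨h3, h4⟩ := key h h1 h2
          obtain ⟨h5, h6⟩ := key _ h3 h4
          rw [fuseVert_of_ne hx hy h1 h2, fuseVert_of_ne hx hy h3 h4, fuseVert_of_ne hx hy h5 h6,
            G.vert_vert_vert]
    · cases h
      · simp [fuseVert_false]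
      · rw [fuseVert_true, fuseVert_right hy hxy, fuseVert_left hx]

theorem Graph.fuse_linked (G : Graph) (x y : G.Flag) (hx : G.vert x = x) (hy : G.vert y = y)
    (hxy : x ≠ y) {h k : G.Flag} (hl : G.Linked h k) :
    (G.fuse x y hx hy hxy).Linked (Sum.inl h) (Sum.inl k) := by
  induction hl with
  | refl => exact .refl _
  | symm _ _ _ ih => exact .symm _ _ ih
  | trans _ _ _ _ _ ih1 ih2 => exact .trans _ _ _ ih1 ih2
  | rel h k hk =>
    rcases hk with rfl | rfl
    · exact .rel _ _ (Or.inl rfl)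
    · by_cases h1 : h = x
      · rw [h1, hx]; exact .refl _
      · by_cases h2 : h = y
        · rw [h2, hy]; exact .refl _
        · exact .rel _ _ (Or.inr (fuseVert_of_ne hx hy h1 h2).symm)

namespace Diagram

variable {n : ℕ}

theorem vert_of_mem (D : Diagram n) {i : Fin n} {h : D.graph.Flag} (hh : h ∈ D.legs i) :
    D.graph.vert h = h :=
  (D.mem_legs h).1 (Multiset.mem_sum.2 ⟨i, Finset.mem_univ i, hh⟩)

theorem nodup (D : Diagram n) (i : Fin n) : (D.legs i).Nodup := by
  have h := D.nodup_legs
  rw [sum_eq D.legs i] at h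
  exact Multiset.coe_nodup.1 (Multiset.nodup_add.1 h).1

theorem ne_of_legs (D : Diagram n) {i : Fin n} {l₁ l₂ : List D.graph.Flag} {x y : D.graph.Flag}
    (h : D.legs i = l₁ ++ x :: y :: l₂) : x ≠ y := by
  have := D.nodup i
  rw [h, List.nodup_append] at this
  rintro rfl
  simp at this

theorem fuse_legs {α : Type} (f : Fin n → List α) (i : Fin n) (l₁ l₂ : List α) (x y : α)
    (h : f i = l₁ ++ x :: y :: l₂) : ∃ R : Multiset α,
      ∑ j, (f j : Multiset α) = x ::ₘ y ::ₘ R ∧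
      ∑ j, (Function.update (fun j => (f j).map Sum.inl) i
        (l₁.map Sum.inl ++ Sum.inr false :: l₂.map Sum.inl) j : Multiset (α ⊕ Bool))
        = Sum.inr false ::ₘ R.map Sum.inl := by
  refine ⟨(l₁ : Multiset α) + l₂ + ∑ j ∈ Finset.univ.erase i, (f j : Multiset α), ?_, ?_⟩
  · rw [sum_eq f i, h, ← Multiset.cons_add, ← Multiset.cons_add]
    congr 1
    simp only [Multiset.coe_add, Multiset.cons_coe, Multiset.coe_eq_coe]
    exact List.perm_middle.trans (List.Perm.cons _ List.perm_middle)
  · rw [sum_update, Multiset.map_add, ← Multiset.cons_add]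
    congr 1
    · simp only [Multiset.map_coe, Multiset.coe_add, Multiset.cons_coe, Multiset.coe_eq_coe,
        List.map_append]
      exact List.perm_middle
    · rw [← Multiset.coe_mapAddMonoidHom, map_sum]
      simp

/-- Join the neighbouring univalent vertices `x`, `y` (in this order) of the `i`-th string into a
trivalent vertex whose third edge ends on the string at their place. -/
def fuse (D : Diagram n) (i : Fin n) (l₁ l₂ : List D.graph.Flag) (x y : D.graph.Flag)
    (h : D.legs i = l₁ ++ x :: y :: l₂) : Diagram n where
  graph := D.graph.fuse x y (D.vert_of_mem (i := i) (by simp [h]))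
    (D.vert_of_mem (i := i) (by simp [h])) (D.ne_of_legs h)
  anchored := by
    have hx : D.graph.vert x = x := D.vert_of_mem (i := i) (by simp [h])
    have hy : D.graph.vert y = y := D.vert_of_mem (i := i) (by simp [h])
    have hxy := D.ne_of_legs h
    set G := D.graph.fuse x y hx hy hxy with hG
    have ht : G.Linked (Sum.inr true) (Sum.inr false) := .rel _ _ (Or.inl rfl)
    have hyt : G.Linked (Sum.inl y) (Sum.inr false) :=
      .trans _ _ _ (.symm _ _ (.rel _ _ (Or.inr fuseVert_true.symm))) ht
    have hxt : G.Linked (Sum.inl x) (Sum.inr false) :=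
      .trans _ _ _ (.rel _ _ (Or.inr (fuseVert_left hx).symm)) ht
    rintro (k | k)
    · obtain ⟨l, hl, hkl⟩ := D.anchored k
      have hkl' := D.graph.fuse_linked x y hx hy hxy hkl
      by_cases h1 : l = x
      · subst h1; exact ⟨Sum.inr false, fuseVert_false, .trans _ _ _ hkl' hxt⟩
      · by_cases h2 : l = y
        · subst h2; exact ⟨Sum.inr false, fuseVert_false, .trans _ _ _ hkl' hyt⟩
        · exact ⟨Sum.inl l, (fuseVert_of_ne hx hy h1 h2).trans (congrArg _ hl), hkl'⟩
    · cases k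
      · exact ⟨Sum.inr false, fuseVert_false, .refl _⟩
      · exact ⟨Sum.inr false, fuseVert_false, ht⟩
  legs := Function.update (fun j => (D.legs j).map Sum.inl) i
    (l₁.map Sum.inl ++ Sum.inr false :: l₂.map Sum.inl)
  nodup_legs := by
    obtain ⟨R, h1, h2⟩ := fuse_legs D.legs i l₁ l₂ x y h
    have h3 := D.nodup_legs
    rw [h1, Multiset.nodup_cons, Multiset.nodup_cons] at h3
    refine (iff_of_eq (congrArg Multiset.Nodup h2)).2 (Multiset.nodup_cons.2 ?_)
    exact ⟨by simp, h3.2.2.map Sum.inl_injective⟩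
  mem_legs := by
    have hx : D.graph.vert x = x := D.vert_of_mem (i := i) (by simp [h])
    have hy : D.graph.vert y = y := D.vert_of_mem (i := i) (by simp [h])
    have hxy := D.ne_of_legs h
    obtain ⟨R, h1, h2⟩ := fuse_legs D.legs i l₁ l₂ x y h
    have h3 := D.nodup_legs
    have h4 := D.mem_legs
    rw [h1, Multiset.nodup_cons, Multiset.nodup_cons] at h3
    rw [h1] at h4
    have key : ∀ k : D.graph.Flag ⊕ Bool,
        k ∈ Sum.inr false ::ₘ R.map Sum.inl ↔ fuseVert D.graph.vert x y k = k := by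
      rintro (k | k)
      · by_cases h5 : k = x
        · subst h5
          rw [fuseVert_left hx]
          simpa using fun h6 => h3.1 (Multiset.mem_cons_of_mem h6)
        · by_cases h6 : k = y
          · subst h6
            rw [fuseVert_right hy hxy]
            simpa [hxy] using h3.2.1
          · rw [fuseVert_of_ne hx hy h5 h6]
            simpa [h5, h6] using h4 k
      · cases k
        · simp [fuseVert_false]
        · simp [fuseVert_true]
    exact fun k => (iff_of_eq (congrArg (k ∈ ·) h2)).trans (key k)

/-- Insert a new string, without univalent vertices, so that it becomes the `p`-th one. -/
def addString (p : Fin (n + 1)) (D : Diagram n) : Diagram (n + 1) :=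
  D.rearrange (Fin.insertNth p [] D.legs) (by
    rw [sum_insertNth]; exact zero_add _)

/-- Remove the `i`-th string, which has no univalent vertex. -/
def removeString (i : Fin (n + 1)) (D : Diagram (n + 1)) (h : D.legs i = []) : Diagram n :=
  D.rearrange (fun j => D.legs (i.succAbove j)) (by
    rw [Fin.sum_univ_succAbove _ i, h]; exact (zero_add _).symm)

open Classical in
/-- The `i`-th list is replaced by two lists: its members in `A`, and its members not in `A`. -/
def splitLegs {α : Type} (f : Fin n → List α) (i : Fin n) (A : Finset α) : Fin (n + 1) → List α :=
  Fin.insertNth i.castSucc ((f i).filter (· ∈ A)) (Function.update f i ((f i).filter (· ∉ A)))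

/-- Replace the `i`-th string by two strings; of its univalent vertices, those in `A` are attached
to the left string and the others to the right string. -/
def split (i : Fin n) (D : Diagram n) (A : Finset D.graph.Flag) : Diagram (n + 1) :=
  D.rearrange (splitLegs D.legs i A) (by
    classical
    rw [splitLegs, sum_insertNth, sum_update, sum_eq D.legs i, ← add_assoc]
    congr 1
    have := Multiset.filter_add_not (· ∈ A) (D.legs i : Multiset D.graph.Flag)
    convert this using 2 <;> simp)

/-- Permute the strings: the `i`-th string becomes the `π i`-th one. -/
def permute (π : Equiv.Perm (Fin n)) (D : Diagram n) : Diagram n :=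
  D.rearrange (fun j => D.legs (π.symm j))
    (Equiv.sum_comp π.symm fun j => (D.legs j : Multiset D.graph.Flag))

end Diagram

/-- The relations between diagrams: equivalent diagrams are equal, and the STU relation `S = T - U`.
Here `T` has two neighbouring univalent vertices, `U` differs from `T` by their exchange, and in `S`
they are joined to a trivalent vertex attached to the string by an edge.  With the string drawn
from left to right, the dashed graph above it, and `x` before `y` in `T`, the counterclockwise
order at the trivalent vertex of `S` is: edge to the string, edge of `y` (right), edge of `x`
(left). -/
def relations (n : ℕ) : Set (Diagram n →₀ ℚ) :=
  {r | (∃ D E : Diagram n, D.Equivalent E ∧ r = Finsupp.single D 1 - Finsupp.single E 1) ∨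
    ∃ (D : Diagram n) (i : Fin n) (l₁ l₂ : List D.graph.Flag) (x y : D.graph.Flag)
      (h : D.legs i = l₁ ++ x :: y :: l₂),
      r = Finsupp.single (D.fuse i l₁ l₂ x y h) 1 -
        (Finsupp.single D 1 - Finsupp.single (D.exchange i l₁ l₂ x y h) 1)}

/-- The rational vector space of Chinese character diagrams on `n` strings, modulo STU. -/
abbrev P (n : ℕ) : Type 1 := (Diagram n →₀ ℚ) ⧸ Submodule.span ℚ (relations n)

/-- The class of a diagram. -/
def Diagram.cls {n : ℕ} (D : Diagram n) : P n := Submodule.Quotient.mk (Finsupp.single D 1)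

variable {n : ℕ}

theorem cls_equivalent {D E : Diagram n} (h : D.Equivalent E) : D.cls = E.cls :=
  (Submodule.Quotient.eq _).2 (Submodule.subset_span (Or.inl ⟨D, E, h, rfl⟩))

theorem cls_stu (D : Diagram n) (i : Fin n) (l₁ l₂ : List D.graph.Flag) (x y : D.graph.Flag)
    (h : D.legs i = l₁ ++ x :: y :: l₂) :
    (D.fuse i l₁ l₂ x y h).cls = D.cls - (D.exchange i l₁ l₂ x y h).cls := by
  refine ((Submodule.Quotient.eq _).2 (Submodule.subset_span ?_)).trans
    (Submodule.Quotient.mk_sub _)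
  exact Or.inr ⟨D, i, l₁, l₂, x, y, h, rfl⟩

/-- Extend linearly to `P n` a function of diagrams that respects the relations. -/
def P.lift {M : Type 1} [AddCommGroup M] [Module ℚ M] (f : Diagram n → M)
    (h₁ : ∀ D E : Diagram n, D.Equivalent E → f D = f E)
    (h₂ : ∀ (D : Diagram n) (i : Fin n) (l₁ l₂ : List D.graph.Flag) (x y : D.graph.Flag)
      (h : D.legs i = l₁ ++ x :: y :: l₂),
      f (D.fuse i l₁ l₂ x y h) = f D - f (D.exchange i l₁ l₂ x y h)) : P n →ₗ[ℚ] M :=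
  Submodule.liftQ _ (Finsupp.linearCombination ℚ f) (by
    rw [Submodule.span_le]
    rintro r (⟨D, E, h, rfl⟩ | ⟨D, i, l₁, l₂, x, y, h, rfl⟩)
    · simp [h₁ D E h]
    · simp [h₂ D i l₁ l₂ x y h])

theorem P.lift_cls {M : Type 1} [AddCommGroup M] [Module ℚ M] (f : Diagram n → M) (h₁) (h₂)
    (D : Diagram n) : P.lift f h₁ h₂ D.cls = f D := by
  simp [P.lift, Diagram.cls]

theorem P.hom_ext {M : Type 1} [AddCommGroup M] [Module ℚ M] {f g : P n →ₗ[ℚ] M}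
    (h : ∀ D : Diagram n, f D.cls = g D.cls) : f = g := by
  refine Submodule.linearMap_qext _ (Finsupp.lhom_ext' fun D => LinearMap.ext_ring ?_)
  exact h D

theorem Diagram.cls_of_legs {G : Graph} {a₁ a₂ : ∀ h, ∃ k, G.vert k = k ∧ G.Linked h k}
    {l₁ l₂ : Fin n → List G.Flag} {b₁ b₂ c₁ c₂} (h : l₁ = l₂) :
    (⟨G, a₁, l₁, b₁, c₁⟩ : Diagram n).cls = (⟨G, a₂, l₂, b₂, c₂⟩ : Diagram n).cls := by
  subst h; rfl

theorem insertNth_update {α : Type} (p : Fin (n + 1)) (l v : List α) (f : Fin n → List α)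
    (i : Fin n) : Fin.insertNth (α := fun _ => List α) p l (Function.update f i v)
      = Function.update (Fin.insertNth (α := fun _ => List α) p l f) (p.succAbove i) v := by
  funext j
  refine Fin.succAboveCases p ?_ (fun j => ?_) j
  · rw [Function.update_of_ne (Fin.ne_succAbove p i)]; simp
  · rw [Fin.insertNth_apply_succAbove]
    by_cases hj : j = i
    · subst hj; rw [Function.update_self, Function.update_self]
    · rw [Function.update_of_ne hj,
        Function.update_of_ne (fun h => hj (Fin.succAbove_right_injective h))]
      simp

theorem map_insertNth {α β : Type} (p : Fin (n + 1)) (l : List α) (f : Fin n → List α)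
    (g : α → β) : (fun j => (Fin.insertNth (α := fun _ => List α) p l f j).map g)
      = Fin.insertNth (α := fun _ => List β) p (l.map g) (fun j => (f j).map g) := by
  funext j
  refine Fin.succAboveCases p ?_ (fun j => ?_) j <;> simp

theorem update_comp_of_injective {α : Type} {m : ℕ} (f : Fin n → List α) (g : Fin m → Fin n)
    (hg : Function.Injective g) (i : Fin m) (v : List α) :
    (fun j => Function.update f (g i) v (g j)) = Function.update (fun j => f (g j)) i v :=
  Function.update_comp_eq_of_injective f hg i v

theorem stu_rearrange (D : Diagram n) (i : Fin n) (l₁ l₂ : List D.graph.Flag)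
    (x y : D.graph.Flag) (h : D.legs i = l₁ ++ x :: y :: l₂) {k : ℕ}
    (ℓ : Fin k → List D.graph.Flag)
    (ℓU : Fin k → List (D.exchange i l₁ l₂ x y h).graph.Flag)
    (ℓS : Fin k → List (D.fuse i l₁ l₂ x y h).graph.Flag)
    (hℓ : ∑ j, (ℓ j : Multiset D.graph.Flag) = ∑ j, (D.legs j : Multiset D.graph.Flag))
    (hℓU : ∑ j, (ℓU j : Multiset (D.exchange i l₁ l₂ x y h).graph.Flag)
      = ∑ j, ((D.exchange i l₁ l₂ x y h).legs j :
        Multiset (D.exchange i l₁ l₂ x y h).graph.Flag))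
    (hℓS : ∑ j, (ℓS j : Multiset (D.fuse i l₁ l₂ x y h).graph.Flag)
      = ∑ j, ((D.fuse i l₁ l₂ x y h).legs j : Multiset (D.fuse i l₁ l₂ x y h).graph.Flag))
    (i' : Fin k) (l₁' l₂' : List D.graph.Flag) (h' : ℓ i' = l₁' ++ x :: y :: l₂')
    (hU : ℓU = (Function.update ℓ i' (l₁' ++ y :: x :: l₂') : Fin k → List D.graph.Flag))
    (hS : ℓS = (Function.update (fun j => (ℓ j).map Sum.inl) i'
      (l₁'.map Sum.inl ++ Sum.inr false :: l₂'.map Sum.inl) :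
        Fin k → List (D.graph.Flag ⊕ Bool))) :
    ((D.fuse i l₁ l₂ x y h).rearrange ℓS hℓS).cls
      = (D.rearrange ℓ hℓ).cls - ((D.exchange i l₁ l₂ x y h).rearrange ℓU hℓU).cls := by
  subst hU hS
  exact cls_stu (D.rearrange ℓ hℓ) i' l₁' l₂' x y h'

/-- Adding an empty string at the place `p`. -/
def addString (p : Fin (n + 1)) : P n →ₗ[ℚ] P (n + 1) :=
  P.lift (fun D => (D.addString p).cls)
    (by
      rintro D E ⟨f, h1, h2, h3⟩
      refine cls_equivalent ⟨f, h1, h2, fun i => ?_⟩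
      change (Fin.insertNth (α := fun _ => List _) p [] D.legs i).map f
        = Fin.insertNth (α := fun _ => List _) p [] E.legs i
      refine Fin.succAboveCases p ?_ (fun j => ?_) i
      · simp
      · simpa using h3 j)
    (by
      intro D i l₁ l₂ x y h
      exact stu_rearrange D i l₁ l₂ x y h _ _ _ _ _ _ (p.succAbove i) l₁ l₂
        ((Fin.insertNth_apply_succAbove p _ _ _).trans h) (insertNth_update p [] _ D.legs i)
        ((insertNth_update p [] _ (fun j => (D.legs j).map Sum.inl) i).trans
          (congrArg (fun F => Function.update F _ _) (map_insertNth p [] D.legs Sum.inl).symm)))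

theorem addString_cls (p : Fin (n + 1)) (D : Diagram n) :
    addString p D.cls = (D.addString p).cls := P.lift_cls _ _ _ D

/-- The action of the symmetric group by permuting the strings. -/
def permute (π : Equiv.Perm (Fin n)) : P n →ₗ[ℚ] P n :=
  P.lift (fun D => (D.permute π).cls)
    (by
      rintro D E ⟨f, h1, h2, h3⟩
      exact cls_equivalent ⟨f, h1, h2, fun i => h3 _⟩)
    (by
      intro D i l₁ l₂ x y h
      have key : ∀ {α : Type} (f : Fin n → List α) (v : List α),
          (fun j => Function.update f i v (π.symm j))
            = Function.update (fun j => f (π.symm j)) (π i) v := by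
        intro α f v
        have := update_comp_of_injective f π.symm π.symm.injective (π i) v
        rwa [Equiv.symm_apply_apply] at this
      exact stu_rearrange D i l₁ l₂ x y h _ _ _ _ _ _ (π i) l₁ l₂
        ((congrArg D.legs (π.symm_apply_apply i)).trans h) (key _ _)
        (key (fun j => (D.legs j).map Sum.inl) _))

theorem permute_cls (π : Equiv.Perm (Fin n)) (D : Diagram n) :
    permute π D.cls = (D.permute π).cls := P.lift_cls _ _ _ D

open Classical in
/-- `ε_i`: remove the `i`-th string if it has no univalent vertex; otherwise the result is `0`. -/
def counit (i : Fin (n + 1)) : P (n + 1) →ₗ[ℚ] P n :=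
  P.lift (fun D => if h : D.legs i = [] then (D.removeString i h).cls else 0)
    (by
      rintro D E ⟨f, h1, h2, h3⟩
      by_cases h : D.legs i = []
      · have h' : E.legs i = [] := by rw [← h3, h]; rfl
        simp only [h, h', dif_pos]
        exact cls_equivalent ⟨f, h1, h2, fun j => h3 _⟩
      · have h' : E.legs i ≠ [] := by rw [← h3]; simpa using h
        simp only [h, h', dif_neg, not_false_eq_true])
    (by
      intro D k l₁ l₂ x y h
      by_cases hk : i = k
      · subst hk
        have e1 : (D.fuse i l₁ l₂ x y h).legs i
            = (l₁.map Sum.inl ++ Sum.inr false :: l₂.map Sum.inl : List (D.graph.Flag ⊕ Bool)) :=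
          Function.update_self i _ fun j => (D.legs j).map Sum.inl
        have e2 : (D.exchange i l₁ l₂ x y h).legs i
            = (l₁ ++ y :: x :: l₂ : List D.graph.Flag) :=
          Function.update_self i _ D.legs
        rw [dif_neg, dif_neg, dif_neg, sub_zero]
        · exact fun h0 => List.append_ne_nil_of_right_ne_nil _ (by simp) (e2.symm.trans h0)
        · simp [h]
        · exact fun h0 => List.append_ne_nil_of_right_ne_nil _ (by simp) (e1.symm.trans h0)
      · obtain ⟨k, rfl⟩ := Fin.exists_succAbove_eq (Ne.symm hk)
        have e1 : (D.fuse _ l₁ l₂ x y h).legs i = (D.legs i).map Sum.inl :=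
          Function.update_of_ne hk _ fun j => (D.legs j).map Sum.inl
        have e2 : (D.exchange _ l₁ l₂ x y h).legs i = D.legs i :=
          Function.update_of_ne hk _ D.legs
        by_cases h0 : D.legs i = []
        · have e1' : (D.fuse _ l₁ l₂ x y h).legs i = [] := e1.trans (by rw [h0]; rfl)
          have e2' : (D.exchange _ l₁ l₂ x y h).legs i = [] := e2.trans h0
          rw [dif_pos e1', dif_pos h0, dif_pos e2']
          exact stu_rearrange D _ l₁ l₂ x y h _ _ _ _ _ _ k l₁ l₂ h
            (update_comp_of_injective _ _ Fin.succAbove_right_injective _ _)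
            (update_comp_of_injective (fun j => (D.legs j).map Sum.inl) _
              Fin.succAbove_right_injective _ _)
        · have e1' : (D.fuse _ l₁ l₂ x y h).legs i ≠ [] :=
            fun h' => h0 (List.map_eq_nil_iff.1 (e1.symm.trans h'))
          have e2' : (D.exchange _ l₁ l₂ x y h).legs i ≠ [] := fun h' => h0 (e2.symm.trans h')
          rw [dif_neg e1', dif_neg h0, dif_neg e2', sub_zero])

theorem counit_cls (i : Fin (n + 1)) (D : Diagram (n + 1)) (h : D.legs i = []) :
    counit i D.cls = (D.removeString i h).cls := (P.lift_cls _ _ _ D).trans (dif_pos h)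

theorem counit_cls_of_ne (i : Fin (n + 1)) (D : Diagram (n + 1)) (h : D.legs i ≠ []) :
    counit i D.cls = 0 := (P.lift_cls _ _ _ D).trans (dif_neg h)

section split

open Diagram

variable {α β : Type}

theorem splitLegs_update_of_ne (f : Fin n → List α) {i j : Fin n} (hij : i ≠ j) (v : List α)
    (A : Finset α) : splitLegs (Function.update f i v) j A
      = Function.update (splitLegs f j A) (j.castSucc.succAbove i) v := by
  rw [splitLegs, splitLegs, ← insertNth_update, Function.update_of_ne hij.symm,
    Function.update_comm hij]

open Classical in
theorem splitLegs_update_self (f : Fin n → List α) (j : Fin n) (v : List α) (A : Finset α) :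
    splitLegs (Function.update f j v) j A
      = Fin.insertNth (α := fun _ => List α) j.castSucc (v.filter (· ∈ A))
        (Function.update f j (v.filter (· ∉ A))) := by
  rw [splitLegs, Function.update_self, Function.update_idem]

open Classical in
theorem update_splitLegs_left (f : Fin n → List α) (j : Fin n) (v : List α) (A : Finset α) :
    Function.update (splitLegs f j A) j.castSucc v
      = Fin.insertNth (α := fun _ => List α) j.castSucc v
        (Function.update f j ((f j).filter (· ∉ A))) := by
  funext k
  refine Fin.succAboveCases j.castSucc ?_ (fun k => ?_) k
  · simp
  · rw [Function.update_of_ne (Fin.succAbove_ne _ _), splitLegs, Fin.insertNth_apply_succAbove,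
      Fin.insertNth_apply_succAbove]

open Classical in
theorem update_splitLegs_right (f : Fin n → List α) (j : Fin n) (v : List α) (A : Finset α) :
    Function.update (splitLegs f j A) (j.castSucc.succAbove j) v
      = Fin.insertNth (α := fun _ => List α) j.castSucc ((f j).filter (· ∈ A))
        (Function.update f j v) := by
  rw [splitLegs, ← insertNth_update, Function.update_idem]

open Classical in
theorem filter_map_image (g : α → β) (hg : Function.Injective g) (l : List α) (A : Finset α) :
    (l.map g).filter (· ∈ A.image g) = (l.filter (· ∈ A)).map g ∧
    (l.map g).filter (· ∉ A.image g) = (l.filter (· ∉ A)).map g := by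
  constructor <;>
  · rw [List.filter_map]
    congr 1
    refine List.filter_congr fun x _ => ?_
    simp [hg.eq_iff]

open Classical in
theorem splitLegs_map (f : Fin n → List α) (g : α → β) (hg : Function.Injective g) (j : Fin n)
    (A : Finset α) : splitLegs (fun k => (f k).map g) j (A.image g)
      = fun k => (splitLegs f j A k).map g := by
  rw [splitLegs, splitLegs, map_insertNth, (filter_map_image g hg _ A).1,
    (filter_map_image g hg _ A).2]
  congr 1
  funext k
  by_cases hk : k = j
  · subst hk; simp
  · simp [hk]

open Classical in
/-- The sum of `F A` over all sets `A` of members of the list `l`. -/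
def subsetSum {M : Type 1} [AddCommMonoid M] (l : List α) (F : Finset α → M) : M :=
  ∑ A ∈ l.toFinset.powerset, F A

open Classical in
theorem subsetSum_map {M : Type 1} [AddCommMonoid M] (g : α → β) (hg : Function.Injective g)
    (l : List α) (F : Finset β → M) :
    subsetSum (l.map g) F = subsetSum l fun A => F (A.image g) := by
  have e : (l.map g).toFinset = l.toFinset.image g := by ext; simp
  rw [subsetSum, subsetSum, e]
  symm
  refine Finset.sum_bij (fun A _ => A.image g) ?_ ?_ ?_ ?_
  · intro A hA
    exact Finset.mem_powerset.2 (Finset.image_subset_image (Finset.mem_powerset.1 hA))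
  · intro A _ B _ h
    exact Finset.image_injective hg h
  · intro B hB
    obtain ⟨A, hA, rfl⟩ := Finset.subset_image_iff.1 (Finset.mem_powerset.1 hB)
    exact ⟨A, Finset.mem_powerset.2 (by exact_mod_cast hA), rfl⟩
  · intro A _; rfl

open Classical in
theorem subsetSum_stu {M : Type 1} [AddCommGroup M] (g : α → β)
    (hg : Function.Injective g) {u : β} (hu : ∀ a, g a ≠ u) {l₁ l₂ : List α} {x y : α}
    (hnd : (l₁ ++ x :: y :: l₂).Nodup) (F U : Finset α → M) (S : Finset β → M)
    (h₁ : ∀ A, (x ∈ A ↔ y ∉ A) → F A = U A)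
    (h₂ : ∀ B, x ∉ B → y ∉ B → S (B.image g) = F B - U B)
    (h₃ : ∀ B, x ∉ B → y ∉ B → S (insert u (B.image g))
      = F (insert x (insert y B)) - U (insert x (insert y B))) :
    subsetSum (l₁.map g ++ u :: l₂.map g) S
      = subsetSum (l₁ ++ x :: y :: l₂) F - subsetSum (l₁ ++ y :: x :: l₂) U := by
  have hnd' : (x :: y :: (l₁ ++ l₂)).Nodup :=
    (List.perm_middle.trans (List.Perm.cons _ List.perm_middle)).nodup_iff.1 hnd
  simp only [List.nodup_cons, List.mem_cons, List.mem_append, not_or] at hnd'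
  obtain ⟨⟨hxy, hx1, hx2⟩, ⟨hy1, hy2⟩, -⟩ := hnd'
  have s1 : (l₁ ++ x :: y :: l₂).toFinset = insert x (insert y (l₁ ++ l₂).toFinset) := by
    ext k; simp
  have s2 : (l₁ ++ y :: x :: l₂).toFinset = insert x (insert y (l₁ ++ l₂).toFinset) := by
    ext k; simp; tauto
  have s3 : (l₁.map g ++ u :: l₂.map g).toFinset
      = insert u ((l₁ ++ l₂).map g).toFinset := by
    ext k; simp
  have hxW : x ∉ insert y (l₁ ++ l₂).toFinset := by simp [hxy, hx1, hx2]
  have hyW : y ∉ (l₁ ++ l₂).toFinset := by simp [hy1, hy2]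
  have hmap : ∀ F : Finset β → M, _ := subsetSum_map g hg (l₁ ++ l₂)
  simp only [subsetSum] at hmap ⊢
  rw [s1, s2, s3, ← Finset.sum_sub_distrib, Finset.sum_powerset_insert (by simp [hu]),
    Finset.sum_powerset_insert hxW, Finset.sum_powerset_insert hyW,
    Finset.sum_powerset_insert hyW, hmap, hmap,
    ← Finset.sum_add_distrib, ← Finset.sum_add_distrib, ← Finset.sum_add_distrib,
    ← Finset.sum_add_distrib]
  refine Finset.sum_congr rfl fun B hB => ?_
  have hBW := Finset.mem_powerset.1 hB
  have hxB : x ∉ B := fun h' => hxW (Finset.mem_insert_of_mem (hBW h'))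
  have hyB : y ∉ B := fun h' => hyW (hBW h')
  rw [h₂ B hxB hyB, h₃ B hxB hyB, h₁ (insert y B) (by simp [hxy, hxB]),
    h₁ (insert x B) (by simp [Ne.symm hxy, hyB])]
  abel

open Classical in
theorem filter_insert_insert {x y : α} {l : List α} (hx : x ∉ l) (hy : y ∉ l) (B : Finset α) :
    l.filter (· ∈ insert x (insert y B)) = l.filter (· ∈ B) ∧
    l.filter (· ∉ insert x (insert y B)) = l.filter (· ∉ B) := by
  constructor <;>
  · refine List.filter_congr fun k hk => ?_
    have h1 : k ≠ x := fun h => hx (h ▸ hk)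
    have h2 : k ≠ y := fun h => hy (h ▸ hk)
    simp [h1, h2]

open Classical in
theorem filter_map_insert (g : α → β) (hg : Function.Injective g) {u : β} (hu : ∀ a, g a ≠ u)
    (l : List α) (A : Finset α) :
    (l.map g).filter (· ∈ insert u (A.image g)) = (l.filter (· ∈ A)).map g ∧
    (l.map g).filter (· ∉ insert u (A.image g)) = (l.filter (· ∉ A)).map g := by
  constructor <;>
  · rw [List.filter_map]
    congr 1
    refine List.filter_congr fun x _ => ?_
    simp [hg.eq_iff, hu]

open Classical in
theorem filter_stu (g : α → β) (hg : Function.Injective g) {u : β} (hu : ∀ a, g a ≠ u)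
    {l₁ l₂ : List α} {x y : α} (hx₁ : x ∉ l₁) (hx₂ : x ∉ l₂) (hy₁ : y ∉ l₁) (hy₂ : y ∉ l₂)
    {B : Finset α} (hx : x ∉ B) (hy : y ∉ B) :
    (l₁.map g ++ u :: l₂.map g).filter (· ∈ B.image g)
        = ((l₁ ++ x :: y :: l₂).map g).filter (· ∈ B.image g) ∧
    (l₁.map g ++ u :: l₂.map g).filter (· ∉ B.image g)
        = (l₁.filter (· ∉ B)).map g ++ u :: (l₂.filter (· ∉ B)).map g ∧
    (l₁.map g ++ u :: l₂.map g).filter (· ∈ insert u (B.image g))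
        = (l₁.filter (· ∈ B)).map g ++ u :: (l₂.filter (· ∈ B)).map g ∧
    (l₁.map g ++ u :: l₂.map g).filter (· ∉ insert u (B.image g))
        = ((l₁ ++ x :: y :: l₂).map g).filter (· ∉ (insert x (insert y B)).image g) := by
  have hu' : u ∉ B.image g := by simp [hu]
  have hu'' : u ∈ insert u (B.image g) := Finset.mem_insert_self _ _
  refine ⟨?_, ?_, ?_, ?_⟩
  · rw [(filter_map_image g hg _ B).1, List.filter_append, List.filter_cons_of_neg (by simpa using hu'),
      (filter_map_image g hg _ B).1, (filter_map_image g hg _ B).1]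
    simp [hx, hy]
  · rw [List.filter_append, List.filter_cons_of_pos (by simpa using hu'),
      (filter_map_image g hg _ B).2, (filter_map_image g hg _ B).2]
  · rw [List.filter_append, List.filter_cons_of_pos (by simp),
      (filter_map_insert g hg hu _ B).1, (filter_map_insert g hg hu _ B).1]
  · rw [(filter_map_image g hg _ _).2, List.filter_append, List.filter_cons_of_neg (by simp),
      (filter_map_insert g hg hu _ B).2, (filter_map_insert g hg hu _ B).2, List.filter_append,
      List.filter_cons_of_neg (by simp), List.filter_cons_of_neg (by simp),
      (filter_insert_insert hx₁ hy₁ B).2, (filter_insert_insert hx₂ hy₂ B).2, List.map_append]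

end split

/-- `Δ_i` of a diagram: the sum of all ways to distribute the univalent vertices of the `i`-th
string over the two strings that replace it. -/
def Diagram.coproduct (i : Fin n) (D : Diagram n) : P (n + 1) :=
  subsetSum (D.legs i) fun A => (D.split i A).cls

theorem Diagram.coproduct_equivalent (i : Fin n) {D E : Diagram n} (h : D.Equivalent E) :
    D.coproduct i = E.coproduct i := by
  classical
  obtain ⟨f, h1, h2, h3⟩ := h
  rw [coproduct, coproduct, ← h3 i, subsetSum_map f f.injective]
  congr 1
  funext A
  refine cls_equivalent ⟨f, h1, h2, fun k => ?_⟩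
  have h4 := congrFun (splitLegs_map D.legs f f.injective i A) k
  refine h4.symm.trans ?_
  have : (fun k => (D.legs k).map f) = E.legs := funext h3
  rw [this]
  change _ = splitLegs E.legs i _ k
  congr!

open Classical in
theorem Diagram.coproduct_stu_of_ne (D : Diagram n) {i j : Fin n} (hij : i ≠ j)
    (l₁ l₂ : List D.graph.Flag) (x y : D.graph.Flag) (h : D.legs i = l₁ ++ x :: y :: l₂) :
    (D.fuse i l₁ l₂ x y h).coproduct j
      = D.coproduct j - (D.exchange i l₁ l₂ x y h).coproduct j := by
  have e1 : (D.fuse i l₁ l₂ x y h).legs j = (D.legs j).map Sum.inl :=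
    Function.update_of_ne hij.symm _ fun j => (D.legs j).map Sum.inl
  have e2 : (D.exchange i l₁ l₂ x y h).legs j = D.legs j :=
    Function.update_of_ne hij.symm _ D.legs
  refine (congrArg (fun l => subsetSum l fun A => ((D.fuse i l₁ l₂ x y h).split j A).cls)
    e1).trans ?_
  refine Eq.trans ?_ (congrArg (fun l => D.coproduct j - subsetSum l fun A =>
    ((D.exchange i l₁ l₂ x y h).split j A).cls) e2).symm
  refine (subsetSum_map (Sum.inl : _ → D.graph.Flag ⊕ Bool) Sum.inl_injective (D.legs j) _).trans ?_
  refine Eq.trans ?_ (Finset.sum_sub_distrib _ _)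
  refine Finset.sum_congr rfl fun A _ => ?_
  refine stu_rearrange D i l₁ l₂ x y h _ _ _ _ _ _ (j.castSucc.succAbove i) l₁ l₂ ?_
    (splitLegs_update_of_ne D.legs hij _ A)
    ((splitLegs_update_of_ne (fun k => (D.legs k).map Sum.inl) hij _ _).trans
      (congrArg (fun F => Function.update F _ _) (splitLegs_map D.legs _ Sum.inl_injective j A)))
  rw [splitLegs, Fin.insertNth_apply_succAbove, Function.update_of_ne hij, h]

open Classical in
theorem Diagram.coproduct_stu_self (D : Diagram n) (i : Fin n)
    (l₁ l₂ : List D.graph.Flag) (x y : D.graph.Flag) (h : D.legs i = l₁ ++ x :: y :: l₂) :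
    (D.fuse i l₁ l₂ x y h).coproduct i
      = D.coproduct i - (D.exchange i l₁ l₂ x y h).coproduct i := by
  have hnd := D.nodup i
  rw [h] at hnd
  have hnd' : (x :: y :: (l₁ ++ l₂)).Nodup :=
    (List.perm_middle.trans (List.Perm.cons _ List.perm_middle)).nodup_iff.1 hnd
  simp only [List.nodup_cons, List.mem_cons, List.mem_append, not_or] at hnd'
  obtain ⟨⟨hxy, hx1, hx2⟩, ⟨hy1, hy2⟩, -⟩ := hnd'
  have f1 : D.coproduct i
      = subsetSum (l₁ ++ x :: y :: l₂) fun A => (D.split i A).cls := by rw [coproduct, h]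
  have f2 : (D.exchange i l₁ l₂ x y h).legs i = (l₁ ++ y :: x :: l₂ : List D.graph.Flag) :=
    Function.update_self i _ D.legs
  have f3 : (D.fuse i l₁ l₂ x y h).legs i
      = (l₁.map Sum.inl ++ Sum.inr false :: l₂.map Sum.inl : List (D.graph.Flag ⊕ Bool)) :=
    Function.update_self i _ fun j => (D.legs j).map Sum.inl
  rw [f1]
  refine (congrArg (fun l => subsetSum l fun A => ((D.fuse i l₁ l₂ x y h).split i A).cls)
    f3).trans ?_
  refine Eq.trans ?_ (congrArg (fun l => _ - subsetSum l fun A =>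
    ((D.exchange i l₁ l₂ x y h).split i A).cls) f2).symm
  have key := fun (B : Finset D.graph.Flag) (hxB : x ∉ B) (hyB : y ∉ B) =>
    filter_stu (Sum.inl : _ → D.graph.Flag ⊕ Bool) Sum.inl_injective
      (u := Sum.inr false) (fun _ => Sum.inl_ne_inr) hx1 hx2 hy1 hy2 hxB hyB
  refine subsetSum_stu (Sum.inl : _ → D.graph.Flag ⊕ Bool) Sum.inl_injective (fun _ => Sum.inl_ne_inr)
    hnd (fun A => (D.split i A).cls)
    (fun A => ((D.exchange i l₁ l₂ x y h).split i A).cls)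
    (fun A => ((D.fuse i l₁ l₂ x y h).split i A).cls) ?_ ?_ ?_
  · intro a ha
    refine Diagram.cls_of_legs (n := n + 1) (G := D.graph) ?_
    change splitLegs D.legs i a = splitLegs (Function.update D.legs i (l₁ ++ y :: x :: l₂)) i a
    rw [splitLegs_update_self, splitLegs, h]
    by_cases hx : x ∈ a
    · have hy : y ∉ a := ha.1 hx
      simp [hx, hy]
    · have hy : y ∈ a := by by_contra hy; exact hx (ha.2 hy)
      simp [hx, hy]
  · intro B hxB hyB
    refine stu_rearrange D i l₁ l₂ x y h _ _ _ _ _ _ (i.castSucc.succAbove i)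
      (l₁.filter (· ∉ B)) (l₂.filter (· ∉ B)) ?_ ?_ ?_
    · rw [splitLegs, Fin.insertNth_apply_succAbove, Function.update_self, h]
      simp [hxB, hyB]
    · refine (splitLegs_update_self D.legs i _ B).trans
        (Eq.trans ?_ (update_splitLegs_right _ _ _ _).symm)
      rw [h]
      simp [hxB, hyB]
    · refine (splitLegs_update_self (fun k => (D.legs k).map Sum.inl) i _ _).trans ?_
      rw [← splitLegs_map D.legs _ Sum.inl_injective, update_splitLegs_right]
      rw [h]
      exact congrArg₂ (fun a b => Fin.insertNth (α := fun _ => List (D.graph.Flag ⊕ Bool))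
        i.castSucc a (Function.update (fun k => (D.legs k).map Sum.inl) i b))
        (key B hxB hyB).1 (key B hxB hyB).2.1
  · intro B hxB hyB
    have k1 := (filter_insert_insert hx1 hy1 B).1
    have k2 := (filter_insert_insert hx2 hy2 B).1
    refine stu_rearrange D i l₁ l₂ x y h _ _ _ _ _ _ i.castSucc
      (l₁.filter (· ∈ B)) (l₂.filter (· ∈ B)) ?_ ?_ ?_
    · rw [splitLegs, Fin.insertNth_apply_same, h, List.filter_append,
        List.filter_cons_of_pos (by simp), List.filter_cons_of_pos (by simp), k1, k2]
    · refine (splitLegs_update_self D.legs i _ _).trans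
        (Eq.trans ?_ (update_splitLegs_left _ _ _ _).symm)
      rw [h, List.filter_append, List.filter_cons_of_pos (by simp),
        List.filter_cons_of_pos (by simp), k1, k2]
      simp
    · refine (splitLegs_update_self (fun k => (D.legs k).map Sum.inl) i _ _).trans ?_
      rw [← splitLegs_map D.legs _ Sum.inl_injective, update_splitLegs_left]
      rw [h]
      exact congrArg₂ (fun a b => Fin.insertNth (α := fun _ => List (D.graph.Flag ⊕ Bool))
        i.castSucc a (Function.update (fun k => (D.legs k).map Sum.inl) i b))
        (key B hxB hyB).2.2.1 (key B hxB hyB).2.2.2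

/-- `Δ_i`: double the `i`-th string. -/
def coproduct (i : Fin n) : P n →ₗ[ℚ] P (n + 1) :=
  P.lift (fun D => D.coproduct i) (fun _ _ h => Diagram.coproduct_equivalent i h) (by
    intro D k l₁ l₂ x y h
    by_cases hk : k = i
    · subst hk; exact D.coproduct_stu_self k l₁ l₂ x y h
    · exact D.coproduct_stu_of_ne hk l₁ l₂ x y h)

theorem coproduct_cls (i : Fin n) (D : Diagram n) : coproduct i D.cls = D.coproduct i :=
  P.lift_cls _ _ _ D

/-- The differential `d x = 1 ⊗ x - Δ₁ x + Δ₂ x - ⋯ + (-1)ⁿ Δₙ x + (-1)ⁿ⁺¹ x ⊗ 1`. -/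
def differential (n : ℕ) : P n →ₗ[ℚ] P (n + 1) :=
  addString 0 + ∑ i : Fin n, (-1 : ℚ) ^ (i.val + 1) • coproduct i
    + (-1 : ℚ) ^ (n + 1) • addString (Fin.last n)

/-- `x` is non-degenerate if `ε_i x = 0` for all `i`. -/
def Nondegenerate : ∀ {n : ℕ}, P n → Prop
  | 0, _ => True
  | _ + 1, x => ∀ i, counit i x = 0

/-- The degree `m` part of the lattice of integral linear combinations of g-connected
non-degenerate diagrams on `n` strings; the degree of a diagram is half the number of vertices of
its dashed graph. -/
def integralLattice (n m : ℕ) : AddSubgroup (P n) :=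
  AddSubgroup.closure {x | ∃ D : Diagram n, D.graph.Connected ∧ D.graph.numVertices = 2 * m ∧
    Nondegenerate D.cls ∧ D.cls = x}

/-- The symmetric elements: `x + (-1) ^ (n (n + 1) / 2) σ x = 0`, where `σ` reverses the order of
the strings. -/
def symmetricPart (n : ℕ) : AddSubgroup (P n) :=
  (LinearMap.ker (LinearMap.id + (-1 : ℚ) ^ (n * (n + 1) / 2) • permute Fin.revPerm)
    : Submodule ℚ (P n)).toAddSubgroup

theorem mem_symmetricPart {x : P n} : x ∈ symmetricPart n ↔
    x + (-1 : ℚ) ^ (n * (n + 1) / 2) • permute Fin.revPerm x = 0 := Iff.rfl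

/-- The degree `m` part of the `n`-th cochain group of the integral symmetric complex. -/
def symCochains (n m : ℕ) : AddSubgroup (P n) := integralLattice n m ⊓ symmetricPart n

section preservation

open Diagram

theorem insertNth_succ_update {α : Type} (j : Fin n) (a b : List α) (f : Fin n → List α) :
    Fin.insertNth (α := fun _ => List α) j.succ a (Function.update f j b)
      = Fin.insertNth (α := fun _ => List α) j.castSucc b (Function.update f j a) := by
  funext k
  refine Fin.succAboveCases j.castSucc ?_ (fun k => ?_) k
  · have : j.castSucc = j.succ.succAbove j := by simp
    rw [Fin.insertNth_apply_same, this, Fin.insertNth_apply_succAbove, Function.update_self]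
  · rw [Fin.insertNth_apply_succAbove]
    by_cases hk : k = j
    · subst hk
      rw [Fin.succAbove_castSucc_self, Fin.insertNth_apply_same, Function.update_self]
    · have : j.castSucc.succAbove k = j.succ.succAbove k := by
        rcases lt_or_gt_of_ne hk with h | h
        · rw [Fin.succAbove_castSucc_of_lt _ _ h, Fin.succAbove_succ_of_le _ _ h.le]
        · rw [Fin.succAbove_castSucc_of_le _ _ h.le, Fin.succAbove_succ_of_lt _ _ h]
      rw [this, Fin.insertNth_apply_succAbove, Function.update_of_ne hk, Function.update_of_ne hk]

theorem eq_zero_or_legs_ne_nil (D : Diagram n) (h : Nondegenerate D.cls) :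
    D.cls = 0 ∨ ∀ i, D.legs i ≠ [] := by
  by_contra! hc
  obtain ⟨h0, i, hi⟩ := hc
  obtain _ | n := n
  · exact i.elim0
  · have h1 := h i
    rw [counit_cls i D hi] at h1
    have h2 := addString_cls i (D.removeString i hi)
    rw [h1, map_zero] at h2
    refine h0 (Eq.trans ?_ h2.symm)
    refine cls_of_legs (n := n + 1) (G := D.graph) ?_
    funext j
    refine Fin.succAboveCases i ?_ (fun k => ?_) j
    · rw [hi]; exact (Fin.insertNth_apply_same (α := fun _ => List _) _ _ _).symm
    · exact (Fin.insertNth_apply_succAbove (α := fun _ => List _) i []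
        (fun j => D.legs (i.succAbove j)) k).symm

theorem nondegenerate_of_legs (D : Diagram n) (h : ∀ i, D.legs i ≠ []) :
    Nondegenerate D.cls := by
  obtain _ | n := n
  · trivial
  · exact fun i => counit_cls_of_ne i D (h i)

theorem telescope (a : Fin (n + 1) → P (n + 1)) :
    a 0 + ∑ i : Fin n, (-1 : ℚ) ^ (i.val + 1) • (a i.castSucc + a i.succ)
      + (-1 : ℚ) ^ (n + 1) • a (Fin.last n) = 0 := by
  have h1 := Fin.sum_univ_castSucc fun k : Fin (n + 1) => (-1 : ℚ) ^ k.val • a k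
  have h2 := Fin.sum_univ_succ fun k : Fin (n + 1) => (-1 : ℚ) ^ k.val • a k
  have h3 : ∑ i : Fin n, (-1 : ℚ) ^ (i.val + 1) • (a i.castSucc + a i.succ)
      = - ∑ i : Fin n, (-1 : ℚ) ^ i.castSucc.val • a i.castSucc
        + ∑ i : Fin n, (-1 : ℚ) ^ i.succ.val • a i.succ := by
    rw [← Finset.sum_neg_distrib, ← Finset.sum_add_distrib]
    refine Finset.sum_congr rfl fun i _ => ?_
    simp [pow_succ]
  rw [h3]
  simp only [Fin.val_last, Fin.val_zero, pow_zero, one_smul] at h1 h2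
  rw [h1] at h2
  rw [pow_succ, mul_neg_one, neg_smul]
  have := sub_eq_zero.2 h2
  rw [← neg_eq_zero, ← this]
  abel

theorem neg_one_pow_smul_mem {H : AddSubgroup (P n)} {x : P n} (hx : x ∈ H) (k : ℕ) :
    (-1 : ℚ) ^ k • x ∈ H := by
  rcases neg_one_pow_eq_or ℚ k with h | h <;> rw [h]
  · simpa using hx
  · simpa using hx

open Classical in
theorem coproduct_mem (m : ℕ) (D : Diagram n) (hc : D.graph.Connected)
    (hm : D.graph.numVertices = 2 * m) (h : ∀ i, D.legs i ≠ []) (i : Fin n) :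
    coproduct i D.cls - (addString i.castSucc D.cls + addString i.succ D.cls)
      ∈ integralLattice (n + 1) m := by
  set L := (D.legs i).toFinset with hL
  have hL0 : L ≠ ∅ := by simpa [hL, List.toFinset_eq_empty_iff] using h i
  have e0 : addString i.castSucc D.cls = (D.split i ∅).cls := by
    rw [addString_cls]
    refine cls_of_legs (n := n + 1) (G := D.graph) ?_
    rw [splitLegs]; simp
  have e1 : addString i.succ D.cls = (D.split i L).cls := by
    rw [addString_cls]
    refine cls_of_legs (n := n + 1) (G := D.graph) ?_
    have a1 : (D.legs i).filter (· ∈ L) = D.legs i := by simp [hL]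
    have a2 : (D.legs i).filter (· ∉ L) = [] := by simp [hL]
    rw [splitLegs, a1, a2, ← insertNth_succ_update, Function.update_eq_self]
  have e2 : coproduct i D.cls = (D.split i ∅).cls + (D.split i L).cls
      + ∑ A ∈ (L.powerset.erase ∅).erase L, (D.split i A).cls := by
    rw [coproduct_cls, Diagram.coproduct, subsetSum, ← hL,
      ← Finset.add_sum_erase L.powerset _ (Finset.empty_mem_powerset L),
      ← Finset.add_sum_erase (L.powerset.erase ∅) _
        (Finset.mem_erase.2 ⟨hL0, Finset.mem_powerset_self L⟩), add_assoc]
  rw [e0, e1, e2, add_sub_cancel_left]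
  refine AddSubgroup.sum_mem _ fun A hA => AddSubgroup.subset_closure
    ⟨D.split i A, hc, hm, nondegenerate_of_legs _ ?_, rfl⟩
  simp only [Finset.mem_erase, Finset.mem_powerset] at hA
  obtain ⟨hAL, hA0, hA⟩ := hA
  intro k
  change splitLegs D.legs i A k ≠ []
  rw [splitLegs]
  refine Fin.succAboveCases i.castSucc ?_ (fun k => ?_) k
  · rw [Fin.insertNth_apply_same]
    obtain ⟨a, ha⟩ := Finset.nonempty_iff_ne_empty.2 hA0
    have : a ∈ (D.legs i).filter (· ∈ A) := by
      simpa [ha] using List.mem_toFinset.1 (hA ha)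
    exact List.ne_nil_of_mem this
  · rw [Fin.insertNth_apply_succAbove]
    by_cases hk : k = i
    · subst hk
      rw [Function.update_self]
      obtain ⟨a, ha, ha'⟩ := Finset.exists_of_ssubset (hA.ssubset_of_ne hAL)
      have : a ∈ (D.legs k).filter (· ∉ A) := by
        simpa [ha'] using List.mem_toFinset.1 ha
      exact List.ne_nil_of_mem this
    · rw [Function.update_of_ne hk]; exact h k

theorem differential_mem_integralLattice {m : ℕ} {x : P n} (hx : x ∈ integralLattice n m) :
    differential n x ∈ integralLattice (n + 1) m := by
  induction hx using AddSubgroup.closure_induction with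
  | zero => rw [map_zero]; exact zero_mem _
  | add x y _ _ h1 h2 => rw [map_add]; exact add_mem h1 h2
  | neg x _ h => rw [map_neg]; exact neg_mem h
  | mem x hx =>
    obtain ⟨D, hc, hm, hn, rfl⟩ := hx
    rcases eq_zero_or_legs_ne_nil D hn with h | h
    · rw [h, map_zero]; exact zero_mem _
    · have key : differential n D.cls = ∑ i : Fin n, (-1 : ℚ) ^ (i.val + 1) •
          (coproduct i D.cls - (addString i.castSucc D.cls + addString i.succ D.cls)) := by
        rw [← sub_eq_zero, ← telescope fun p => addString p D.cls]
        simp only [differential, LinearMap.add_apply, LinearMap.sum_apply, LinearMap.smul_apply,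
          smul_sub, Finset.sum_sub_distrib]
        abel
      rw [key]
      exact AddSubgroup.sum_mem _ fun i _ =>
        neg_one_pow_smul_mem (coproduct_mem m D hc hm h i) _

theorem permute_addString (p : Fin (n + 1)) (x : P n) :
    permute Fin.revPerm (addString p x) = addString p.rev (permute Fin.revPerm x) := by
  have : permute Fin.revPerm ∘ₗ addString p
      = (addString p.rev ∘ₗ permute Fin.revPerm : P n →ₗ[ℚ] P (n + 1)) := by
    refine P.hom_ext fun D => ?_
    rw [LinearMap.comp_apply, LinearMap.comp_apply, addString_cls, permute_cls, permute_cls,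
      addString_cls]
    refine cls_of_legs (n := n + 1) (G := D.graph) ?_
    funext k
    exact Fin.insertNth_rev p [] D.legs k
  exact LinearMap.congr_fun this x

open Classical in
theorem splitLegs_rev {α : Type} (f : Fin n → List α) (i : Fin n) (A : Finset α) :
    (fun k => splitLegs f i A k.rev)
      = splitLegs (fun k => f k.rev) i.rev ((f i).toFinset \ A) := by
  funext k
  have c1 : (f i).filter (· ∈ (f i).toFinset \ A) = (f i).filter (· ∉ A) :=
    List.filter_congr fun a ha => by simp [ha]
  have c2 : (f i).filter (· ∉ (f i).toFinset \ A) = (f i).filter (· ∈ A) :=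
    List.filter_congr fun a ha => by simp [ha]
  have c3 : ∀ v : List α, Function.update f i v ∘ Fin.rev
      = Function.update (fun k => f k.rev) i.rev v := by
    intro v
    have := update_comp_of_injective f Fin.rev Fin.rev_injective i.rev v
    rwa [Fin.rev_rev] at this
  unfold splitLegs
  simp only [Fin.rev_rev]
  rw [Fin.insertNth_rev, c3, c1, c2, Fin.rev_castSucc, insertNth_succ_update]

open Classical in
theorem permute_coproduct (i : Fin n) (x : P n) :
    permute Fin.revPerm (coproduct i x) = coproduct i.rev (permute Fin.revPerm x) := by
  have : permute Fin.revPerm ∘ₗ coproduct i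
      = (coproduct i.rev ∘ₗ permute Fin.revPerm : P n →ₗ[ℚ] P (n + 1)) := by
    refine P.hom_ext fun D => ?_
    rw [LinearMap.comp_apply, LinearMap.comp_apply, coproduct_cls, permute_cls, coproduct_cls,
      Diagram.coproduct, Diagram.coproduct, subsetSum, map_sum]
    have hl : (D.permute Fin.revPerm).legs i.rev = D.legs i := congrArg D.legs (Fin.rev_rev i)
    refine Eq.trans ?_ (congrArg (fun l => subsetSum l fun A =>
      ((D.permute Fin.revPerm).split i.rev A).cls) hl).symm
    dsimp only [subsetSum]
    refine Finset.sum_nbij' (fun A => (D.legs i).toFinset \ A) (fun A => (D.legs i).toFinset \ A)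
      ?_ ?_ ?_ ?_ ?_
    · intro A _; exact Finset.mem_powerset.2 Finset.sdiff_subset
    · intro A _; exact Finset.mem_powerset.2 Finset.sdiff_subset
    · intro A hA; exact Finset.sdiff_sdiff_eq_self (Finset.mem_powerset.1 hA)
    · intro A hA; exact Finset.sdiff_sdiff_eq_self (Finset.mem_powerset.1 hA)
    · intro A hA
      rw [permute_cls]
      refine cls_of_legs (n := n + 1) (G := D.graph) ?_
      exact splitLegs_rev D.legs i A
  exact LinearMap.congr_fun this x

theorem permute_differential (x : P n) : permute Fin.revPerm (differential n x)
    = (-1 : ℚ) ^ (n + 1) • differential n (permute Fin.revPerm x) := by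
  simp only [differential, LinearMap.add_apply, LinearMap.sum_apply, LinearMap.smul_apply, map_add,
    map_sum, map_smul, permute_addString, permute_coproduct, Fin.rev_zero, Fin.rev_last, smul_add,
    Finset.smul_sum, smul_smul, ← pow_add]
  rw [← Equiv.sum_comp Fin.revPerm]
  have h1 : (-1 : ℚ) ^ (n + 1 + (n + 1)) = 1 := Even.neg_one_pow ⟨n + 1, rfl⟩
  rw [h1, one_smul]
  have h2 : ∀ i : Fin n, (-1 : ℚ) ^ (i.rev.val + 1) = (-1 : ℚ) ^ (n + 1 + (i.val + 1)) := by
    intro i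
    rw [neg_one_pow_congr]
    simp only [Fin.val_rev, Nat.even_iff]
    omega
  simp only [Fin.revPerm_apply, Fin.rev_rev, h2]
  abel

theorem differential_mem_symmetricPart {x : P n} (hx : x ∈ symmetricPart n) :
    differential n x ∈ symmetricPart (n + 1) := by
  rw [mem_symmetricPart] at hx ⊢
  have e : (n + 1) * (n + 1 + 1) / 2 = n * (n + 1) / 2 + (n + 1) := by
    rw [show (n + 1) * (n + 1 + 1) = n * (n + 1) + (n + 1) * 2 by ring,
      Nat.add_mul_div_right _ _ two_pos]
  rw [permute_differential, smul_smul, ← pow_add, e, add_assoc, pow_add,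
    Even.neg_one_pow ⟨n + 1, rfl⟩, mul_one, ← map_smul, ← map_add, hx, map_zero]

end preservation

/-- The differential of the degree `m` part of the integral symmetric complex. -/
def symDifferential (n m : ℕ) : symCochains n m →+ symCochains (n + 1) m :=
  ((differential n).toAddMonoidHom.comp (symCochains n m).subtype).codRestrict _ fun x =>
    ⟨differential_mem_integralLattice x.2.1, differential_mem_symmetricPart x.2.2⟩

/-- The coboundaries in `symCochains n m`. -/
def symCoboundaries : ∀ n m : ℕ, AddSubgroup (symCochains n m)
  | 0, _ => ⊥
  | n + 1, m => (symDifferential n m).range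

/-- The degree `m` part of the `n`-th cohomology group of the integral symmetric complex:
cocycles modulo those cocycles that are coboundaries. -/
abbrev SymCohomology (n m : ℕ) : Type 1 :=
  (symDifferential n m).ker ⧸ (symCoboundaries n m).addSubgroupOf (symDifferential n m).ker

end

end CobarComplex

/-! A family of words in the letters of `n` strings acts as a linear map `op : P n → P k`: each new
string is a product of old ones, and every univalent vertex (leg) is distributed in all ways over
the occurrences of its string. These maps compose by substitution (`op_op`), as in a cocommutative
Hopf algebra. Insertion of an empty string, `Δ_i` and permutations are of this kind, so relations
between them reduce to computations with words.

The power `ψ_i^a` of the `i`-th string depends polynomially on `a` (`power_cls`). Over `ℚ` every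
element is therefore a sum of elements having a weight `s i` on each string
(`Diagram.cls_mem_span_weights`). Weight one means that the string is primitive: `Δ_i` is then the
sum of two insertions of an empty string (`coproduct_of_isPrimitive`).

Let `h_r` be the signed sum of the slides of the `a`-th power of a string `i` into an earlier string
`j ≥ r`. If the first `r` strings are primitive, then `d h_r + h_r d` is the sum over `i ≥ r` of
`ψ_i^(a+1) - 1`, minus a signed sum `R_r` of moves of a later string to the place `r`, plus terms
measuring the failure of `ψ_i^a z` to be primitive (`homotopy_identity_zero` and its variants).
Averaging over `a` with rational weights that extract the linear coefficient turns `ψ_i^(a+1) - 1`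
into `s i`, kills the failure terms, and makes the string moved to the place `r` primitive. For a
cocycle `z` of total weight `j` on four strings, with `z₁ = R₀ z`, `z₂ = R₁ z₁`, `z₃ = R₂ z₂`, this
gives `d h₀ z = j z - z₁`, `d h₁ z₁ = (j - 1) z₁ - z₂`, `d h₂ z₂ = (j - 2) z₂ - z₃`, `(j - 3) z₃ =
R₃ z₃`. The composite `R₃ R₂ R₁ R₀` antisymmetrizes over all orders of the strings. Reversing four
strings is an even permutation, whereas a symmetric cochain satisfies `σ z = -z`; so the composite
kills `z` (`average_rotation_eq_zero`). Hence `z₃ = 0`, and `j (j - 1) (j - 2) z` is a coboundary.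

It remains to bound denominators. By an Euler characteristic count a connected graph of degree `m`
has at most `m + 1` legs, so `j ≤ m + 1` and `j (j - 1) (j - 2)` divides `(m + 1)!`. Each weight is
at most `m - 1`, so each average costs `(m - 1)!`. The weight components of an integral cocycle need
not be integral; their images under the homotopies are recovered by interpolation from those of
`scale b z`. Together this costs `(m!)² ((m - 1)!)²` (`exists_preimage_of_cocycle`).
Antisymmetrizing the primitive under `σ` costs the last factor `2`. -/

open scoped Nat

namespace CobarComplex

noncomputable section

variable {n k l m : ℕ}

/-! ### Placing legs along labelled words -/

/-- The members of the lists of a family are pairwise distinct. -/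
def Separated {β : Type} (w : Fin k → List β) : Prop :=
  (∀ a, (w a).Nodup) ∧ ∀ a b x, x ∈ w a → x ∈ w b → a = b

theorem mem_sum_coe {β : Type} (w : Fin k → List β) (x : β) :
    x ∈ ∑ a, (w a : Multiset β) ↔ ∃ a, x ∈ w a := by
  simp [Multiset.mem_sum]

theorem sum_coe_nodup_iff {β : Type} (w : Fin k → List β) :
    (∑ a, (w a : Multiset β)).Nodup ↔ Separated w := by
  have e : ∑ a, (w a : Multiset β) = (Finset.univ : Finset (Fin k)).val.bind
      fun a => (w a : Multiset β) := rfl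
  rw [e, Multiset.nodup_bind]
  refine and_congr (by simp) ⟨fun h a b x ha hb => ?_, fun h => ?_⟩
  · by_contra hab
    exact Multiset.disjoint_left.1
      (h.forall (Finset.mem_univ a) (Finset.mem_univ b) hab) ha hb
  · refine Multiset.Nodup.pairwise (fun a _ b _ hab => ?_) Finset.univ.nodup
    exact Multiset.disjoint_left.2 fun {x} ha hb => hab (h a b x ha hb)

theorem Diagram.separated_legs (D : Diagram n) : Separated D.legs :=
  (sum_coe_nodup_iff _).1 D.nodup_legs

open Classical in
/-- Of the string named by each letter of the word `w a`, take the legs whose colour is the label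
of the letter, and concatenate. -/
def place {α Λ : Type} (f : Fin n → List α) (w : Fin k → List (Fin n × Λ)) (c : α → Λ) :
    Fin k → List α :=
  fun a => (w a).flatMap fun p => (f p.1).filter fun x => c x = p.2

theorem mem_place {α Λ : Type} {f : Fin n → List α} {w : Fin k → List (Fin n × Λ)} {c : α → Λ}
    {a : Fin k} {x : α} : x ∈ place f w c a ↔ ∃ i, (i, c x) ∈ w a ∧ x ∈ f i := by
  simp only [place, List.mem_flatMap, List.mem_filter, decide_eq_true_eq, Prod.exists]
  constructor
  · rintro ⟨i, t, h, hx, rfl⟩; exact ⟨i, h, hx⟩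
  · rintro ⟨i, h, hx⟩; exact ⟨i, _, h, hx, rfl⟩

/-- A leg determines its string, because `f` is separated, and its colour. It can thus only be
placed at one letter, and that letter occurs once. -/
theorem separated_place {α Λ : Type} {f : Fin n → List α} (hf : Separated f)
    {w : Fin k → List (Fin n × Λ)} (hw : Separated w) (c : α → Λ) : Separated (place f w c) := by
  classical
  refine ⟨fun a => ?_, fun a b x ha hb => ?_⟩
  · rw [place, List.nodup_flatMap]
    refine ⟨fun p _ => (hf.1 _).filter _, ?_⟩
    refine (hw.1 a).imp fun {p q} hpq => ?_
    rw [Function.onFun, List.disjoint_left]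
    intro x hx hy
    simp only [List.mem_filter, decide_eq_true_eq] at hx hy
    exact hpq (Prod.ext (hf.2 _ _ x hx.1 hy.1) (hx.2.symm.trans hy.2))
  · obtain ⟨i, h1, h2⟩ := mem_place.1 ha
    obtain ⟨j, h3, h4⟩ := mem_place.1 hb
    obtain rfl := hf.2 _ _ x h2 h4
    exact hw.2 _ _ _ h1 h3

/-- Neither side has repetitions, so only the supports matter, and a placement can only lose legs:
those whose letter occurs in no word. -/
theorem sum_place_eq_iff {α Λ : Type} {f : Fin n → List α} (hf : Separated f)
    {w : Fin k → List (Fin n × Λ)} (hw : Separated w) (c : α → Λ) :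
    ∑ a, (place f w c a : Multiset α) = ∑ i, (f i : Multiset α) ↔
      ∀ i, ∀ x ∈ f i, ∃ a, (i, c x) ∈ w a := by
  constructor
  · intro h i x hx
    have : x ∈ ∑ a, (place f w c a : Multiset α) := by
      rw [h, mem_sum_coe]; exact ⟨i, hx⟩
    obtain ⟨a, ha⟩ := (mem_sum_coe _ _).1 this
    obtain ⟨j, h1, h2⟩ := mem_place.1 ha
    obtain rfl := hf.2 _ _ x hx h2
    exact ⟨a, h1⟩
  · intro h
    refine (Multiset.Nodup.ext ((sum_coe_nodup_iff _).2 (separated_place hf hw c))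
      ((sum_coe_nodup_iff _).2 hf)).2 fun x => ?_
    rw [mem_sum_coe, mem_sum_coe]
    constructor
    · rintro ⟨a, ha⟩
      obtain ⟨i, -, hi⟩ := mem_place.1 ha
      exact ⟨i, hi⟩
    · rintro ⟨i, hi⟩
      obtain ⟨a, ha⟩ := h i x hi
      exact ⟨a, mem_place.2 ⟨i, ha, hi⟩⟩

/-! ### Sums over colourings, and independence of the labels -/

open Classical in
/-- The colourings of the univalent vertices, extended by a default value to all flags. -/
def Graph.colorings (G : Graph) (Λ : Type) [Fintype Λ] [Inhabited Λ] : Finset (G.Flag → Λ) :=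
  letI := G.finite
  letI := Fintype.ofFinite G.Flag
  Finset.univ.filter fun c => ∀ h, G.vert h ≠ h → c h = default

theorem Graph.mem_colorings {G : Graph} {Λ : Type} [Fintype Λ] [Inhabited Λ] {c : G.Flag → Λ} :
    c ∈ G.colorings Λ ↔ ∀ h, G.vert h ≠ h → c h = default := by
  simp [Graph.colorings]

namespace Diagram

open Classical in
/-- The class of the diagram obtained by placing the univalent vertices of `D` according to `f`. -/
def realize (D : Diagram n) (f : Fin k → List D.graph.Flag) : P k :=
  if h : ∑ j, (f j : Multiset D.graph.Flag) = ∑ i, (D.legs i : Multiset D.graph.Flag) then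
    (D.rearrange f h).cls else 0

theorem realize_of_eq (D : Diagram n) {f : Fin k → List D.graph.Flag}
    (h : ∑ j, (f j : Multiset D.graph.Flag) = ∑ i, (D.legs i : Multiset D.graph.Flag)) :
    D.realize f = (D.rearrange f h).cls := dif_pos h

theorem realize_of_ne (D : Diagram n) {f : Fin k → List D.graph.Flag}
    (h : ∑ j, (f j : Multiset D.graph.Flag) ≠ ∑ i, (D.legs i : Multiset D.graph.Flag)) :
    D.realize f = 0 := dif_neg h

theorem realize_legs (D : Diagram n) : D.realize D.legs = D.cls := D.realize_of_eq rfl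

theorem realize_rearrange (D : Diagram n) (f : Fin k → List D.graph.Flag)
    (h : ∑ j, (f j : Multiset D.graph.Flag) = ∑ i, (D.legs i : Multiset D.graph.Flag))
    (g : Fin l → List D.graph.Flag) : (D.rearrange f h).realize g = D.realize g := by
  by_cases hg : ∑ j, (g j : Multiset D.graph.Flag) = ∑ i, (D.legs i : Multiset D.graph.Flag)
  · rw [D.realize_of_eq hg]
    exact realize_of_eq (D.rearrange f h) (f := g) (hg.trans h.symm)
  · rw [D.realize_of_ne hg]
    exact realize_of_ne (D.rearrange f h) (f := g) fun h' => hg (h'.trans h)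

theorem realize_eq_zero (D : Diagram n) {f : Fin k → List D.graph.Flag} {i : Fin n}
    {x : D.graph.Flag} (hx : x ∈ D.legs i) (h : ∀ a, x ∉ f a) : D.realize f = 0 := by
  refine D.realize_of_ne fun h' => ?_
  have : x ∈ ∑ j, (f j : Multiset D.graph.Flag) := by
    rw [h', mem_sum_coe]; exact ⟨i, hx⟩
  obtain ⟨a, ha⟩ := (mem_sum_coe _ _).1 this
  exact h a ha

/-- Inadmissible colourings contribute zero. Sums may therefore run over all colourings, which makes
reindexing simple. -/
theorem realize_place_of_notMem (D : Diagram n) {Λ : Type} {w : Fin k → List (Fin n × Λ)}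
    {c : D.graph.Flag → Λ} {i : Fin n} {x : D.graph.Flag} (hx : x ∈ D.legs i)
    (h : ∀ a, (i, c x) ∉ w a) : D.realize (place D.legs w c) = 0 := by
  refine D.realize_eq_zero hx fun a ha => ?_
  obtain ⟨j, h1, h2⟩ := mem_place.1 ha
  obtain rfl := D.separated_legs.2 _ _ x hx h2
  exact h a h1

/-- The sum over all ways to distribute the univalent vertices on each string over the labelled
occurrences of this string in the words `w`. -/
def labelledOp {Λ : Type} [Fintype Λ] [Inhabited Λ] (w : Fin k → List (Fin n × Λ))
    (D : Diagram n) : P k :=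
  ∑ c ∈ D.graph.colorings Λ, D.realize (place D.legs w c)

variable {Λ Λ' : Type} [Fintype Λ] [Inhabited Λ] [Fintype Λ'] [Inhabited Λ']

/-- By `hw` the first label of a letter determines the second one. An admissible colouring by first
labels has exactly one refinement that loses no leg; an inadmissible one has none. -/
theorem labelledOp_forget (D : Diagram n) (w : Fin k → List (Fin n × Λ × Λ'))
    (hw : ∀ a b i s t t', (i, s, t) ∈ w a → (i, s, t') ∈ w b → t = t') :
    labelledOp (fun a => (w a).map fun p => (p.1, p.2.1)) D = labelledOp w D := by
  classical
  have key : ∀ c ∈ D.graph.colorings Λ,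
      D.realize (place D.legs (fun a => (w a).map fun p => (p.1, p.2.1)) c)
        = ∑ c' ∈ D.graph.colorings Λ', D.realize (place D.legs w fun h => (c h, c' h)) := by
    intro c hc
    by_cases hx : ∀ i, ∀ x ∈ D.legs i, ∃ t a, (i, c x, t) ∈ w a
    · have hx' : ∀ x, ∃ t, (D.graph.vert x ≠ x → t = default) ∧
          ∀ i, x ∈ D.legs i → ∃ a, (i, c x, t) ∈ w a := by
        intro x
        by_cases h : D.graph.vert x = x
        · obtain ⟨i, hi⟩ := (mem_sum_coe _ _).1 ((D.mem_legs x).2 h)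
          obtain ⟨t, a, ha⟩ := hx i x hi
          refine ⟨t, fun h' => absurd h h', fun j hj => ?_⟩
          obtain rfl := D.separated_legs.2 _ _ x hi hj
          exact ⟨a, ha⟩
        · exact ⟨default, fun _ => rfl, fun i hi => absurd (D.vert_of_mem hi) h⟩
      choose c' hc' hcw using hx'
      rw [Finset.sum_eq_single c']
      · congr 1
        funext a
        simp only [place, List.flatMap_map]
        refine List.flatMap_congr fun p hp => List.filter_congr fun x hx => ?_
        obtain ⟨i, s, t⟩ := p
        simp only [Prod.mk.injEq, decide_eq_decide]
        refine ⟨fun h => ⟨h, ?_⟩, fun h => h.1⟩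
        subst h
        obtain ⟨b, hb⟩ := hcw x i hx
        exact hw _ _ _ _ _ _ hb hp
      · intro e he hne
        obtain ⟨x, hx⟩ := Function.ne_iff.1 hne
        have hv : D.graph.vert x = x := by
          by_contra h
          exact hx ((Graph.mem_colorings.1 he x h).trans (hc' x h).symm)
        obtain ⟨i, hi⟩ := (mem_sum_coe _ _).1 ((D.mem_legs x).2 hv)
        refine D.realize_place_of_notMem hi fun a ha => hx ?_
        obtain ⟨b, hb⟩ := hcw x i hi
        exact hw _ _ _ _ _ _ ha hb
      · intro h
        exact absurd (Graph.mem_colorings.2 hc') h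
    · push Not at hx
      obtain ⟨i, x, hx, h⟩ := hx
      rw [D.realize_place_of_notMem hx, Finset.sum_eq_zero]
      · exact fun c' _ => D.realize_place_of_notMem hx fun a => h _ a
      · intro a ha
        obtain ⟨⟨j, s, t⟩, hp, he⟩ := List.mem_map.1 ha
        simp only [Prod.mk.injEq] at he
        obtain ⟨rfl, rfl⟩ := he
        exact h t a hp
  rw [labelledOp, Finset.sum_congr rfl key, labelledOp, ← Finset.sum_product']
  refine Finset.sum_bij (fun p _ h => (p.1 h, p.2 h)) ?_ ?_ ?_ ?_
  · intro p hp
    obtain ⟨h1, h2⟩ := Finset.mem_product.1 hp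
    exact Graph.mem_colorings.2 fun h hh =>
      Prod.ext (Graph.mem_colorings.1 h1 h hh) (Graph.mem_colorings.1 h2 h hh)
  · intro p _ q _ h
    refine Prod.ext (funext fun x => ?_) (funext fun x => ?_)
    · exact congrArg Prod.fst (congrFun h x)
    · exact congrArg Prod.snd (congrFun h x)
  · intro c hc
    rw [Graph.mem_colorings] at hc
    refine ⟨(fun h => (c h).1, fun h => (c h).2), ?_, rfl⟩
    exact Finset.mem_product.2 ⟨Graph.mem_colorings.2 fun h hh => congrArg Prod.fst (hc h hh),
      Graph.mem_colorings.2 fun h hh => congrArg Prod.snd (hc h hh)⟩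
  · intro p _; rfl

theorem exists_zip {β γ δ : Type} : ∀ (u : List (β × γ)) (v : List (β × δ)),
    u.map Prod.fst = v.map Prod.fst → ∃ z : List (β × γ × δ),
      z.map (fun p => (p.1, p.2.1)) = u ∧ z.map (fun p => (p.1, p.2.2)) = v
  | [], v, h => by
    rw [List.map_nil, eq_comm, List.map_eq_nil_iff] at h
    exact ⟨[], rfl, h.symm⟩
  | p :: u, [], h => by simp at h
  | (b, s) :: u, (b', t) :: v, h => by
    simp only [List.map_cons, List.cons.injEq] at h
    obtain ⟨rfl, h⟩ := h
    obtain ⟨z, h1, h2⟩ := exists_zip u v h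
    exact ⟨(b, s, t) :: z, by simp [h1], by simp [h2]⟩

theorem _root_.CobarComplex.Separated.eq_of_map {β γ : Type} {w : Fin k → List β} (g : β → γ)
    (hw : Separated fun a => (w a).map g) {a b : Fin k} {x y : β} (hx : x ∈ w a) (hy : y ∈ w b)
    (h : g x = g y) : x = y := by
  have hy' : g x ∈ (w b).map g := h ▸ List.mem_map_of_mem hy
  obtain rfl := hw.2 a b (g x) (List.mem_map_of_mem hx) hy'
  exact List.inj_on_of_nodup_map (hw.1 a) hx hy h

/-- Lets `labelledOp_forget` drop either component, so that two labellings are compared through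
their common refinement. -/
theorem labelledOp_swap (D : Diagram n) (w : Fin k → List (Fin n × Λ × Λ')) :
    labelledOp w D = labelledOp (fun a => (w a).map fun p => (p.1, p.2.2, p.2.1)) D := by
  classical
  refine Finset.sum_bij (fun c _ h => (c h).swap) ?_ ?_ ?_ ?_
  · intro c hc
    rw [Graph.mem_colorings] at hc ⊢
    intro h hh
    rw [hc h hh]; rfl
  · intro c _ c' _ h
    exact funext fun x => Prod.swap_injective (congrFun h x)
  · intro c hc
    refine ⟨fun h => (c h).swap, ?_, by simp⟩
    rw [Graph.mem_colorings] at hc ⊢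
    intro h hh
    rw [hc h hh]; rfl
  · intro c _
    congr 1
    funext a
    simp only [place, List.flatMap_map]
    refine List.flatMap_congr fun p hp => List.filter_congr fun x hx => ?_
    obtain ⟨i, s, t⟩ := p
    simp [Prod.ext_iff, and_comm]

/-- The labels of the occurrences do not matter. -/
theorem labelledOp_congr (D : Diagram n) {u : Fin k → List (Fin n × Λ)}
    {v : Fin k → List (Fin n × Λ')} (hu : Separated u) (hv : Separated v)
    (h : ∀ a, (u a).map Prod.fst = (v a).map Prod.fst) : labelledOp u D = labelledOp v D := by
  choose z h1 h2 using fun a => exists_zip (u a) (v a) (h a)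
  obtain rfl : (fun a => (z a).map fun p => (p.1, p.2.1)) = u := funext h1
  obtain rfl : (fun a => (z a).map fun p => (p.1, p.2.2)) = v := funext h2
  rw [labelledOp_forget, labelledOp_swap, ← labelledOp_forget]
  · congr 1
    funext a
    simp
  · intro a b i s t t' ha hb
    simp only [List.mem_map, Prod.mk.injEq, Prod.exists] at ha hb
    obtain ⟨_, _, _, ha, rfl, rfl, rfl⟩ := ha
    obtain ⟨_, _, _, hb, rfl, rfl, rfl⟩ := hb
    have := hv.eq_of_map (fun p : Fin n × Λ × Λ' => (p.1, p.2.2)) ha hb rfl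
    simp only [Prod.mk.injEq] at this
    exact this.2.1
  · intro a b i s t t' ha hb
    have := hu.eq_of_map (fun p : Fin n × Λ × Λ' => (p.1, p.2.1)) ha hb rfl
    simp only [Prod.mk.injEq] at this
    exact this.2.2

end Diagram

/-! ### Unlabelled words and their substitution -/

/-- Label each letter of a family of words by its position. -/
def positions (w : Fin k → FreeMonoid (Fin n)) :
    Fin k → List (Fin n × Option (Σ a, Fin (w a).toList.length)) :=
  fun a => List.ofFn fun q => ((w a).toList.get q, some ⟨a, q⟩)

theorem separated_positions (w : Fin k → FreeMonoid (Fin n)) : Separated (positions w) := by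
  refine ⟨fun a => ?_, fun a b x ha hb => ?_⟩
  · rw [positions, List.nodup_ofFn]
    intro q q' h
    simpa using congrArg Prod.snd h
  · simp only [positions, List.mem_ofFn] at ha hb
    obtain ⟨q, rfl⟩ := ha
    obtain ⟨q', h⟩ := hb
    simp only [Prod.mk.injEq, Option.some.injEq, Sigma.mk.injEq] at h
    exact h.2.1.symm

theorem map_fst_positions (w : Fin k → FreeMonoid (Fin n)) (a : Fin k) :
    (positions w a).map Prod.fst = (w a).toList := by
  rw [positions, List.map_ofFn]
  exact List.ofFn_get _

/-- `none` labels no letter. It is the colour of flags that are not legs, and it keeps the type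
inhabited when all words are empty. -/
instance (w : Fin k → FreeMonoid (Fin n)) : Inhabited (Option (Σ a, Fin (w a).toList.length)) :=
  ⟨none⟩

namespace Diagram

/-- The word operation on diagrams. -/
def wordOp (w : Fin k → FreeMonoid (Fin n)) (D : Diagram n) : P k :=
  labelledOp (positions w) D

/-- Any labels that separate the letters may be used in place of positions: `Bool` for a doubled
string, pairs for substituted words. -/
theorem wordOp_eq {Λ : Type} [Fintype Λ] [Inhabited Λ] (D : Diagram n)
    {u : Fin k → List (Fin n × Λ)} (hu : Separated u) (w : Fin k → FreeMonoid (Fin n))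
    (h : ∀ a, (u a).map Prod.fst = (w a).toList) : wordOp w D = labelledOp u D :=
  D.labelledOp_congr (separated_positions w) hu fun a => (map_fst_positions w a).trans (h a).symm

/-- Placing twice is placing along the substituted words; a letter there remembers its label in `u`
and the label of the letter of `v` it came from. -/
theorem place_place {α Λ Λ' : Type} (f : Fin n → List α) (u : Fin k → List (Fin n × Λ))
    (v : Fin l → List (Fin k × Λ')) (c : α → Λ) (c' : α → Λ') :
    place (place f u c) v c' = place f
      (fun a => (v a).flatMap fun q => (u q.1).map fun p => (p.1, p.2, q.2))
      fun x => (c x, c' x) := by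
  classical
  funext a
  simp only [place, List.flatMap_assoc, List.flatMap_map, List.filter_flatMap, List.filter_filter]
  refine List.flatMap_congr fun q _ => List.flatMap_congr fun p _ => List.filter_congr fun x _ => ?_
  simp [Bool.and_comm]

theorem separated_substitute {Λ Λ' : Type} {u : Fin k → List (Fin n × Λ)}
    {v : Fin l → List (Fin k × Λ')} (hu : Separated u) (hv : Separated v) :
    Separated fun a => (v a).flatMap fun q => (u q.1).map fun p => (p.1, p.2, q.2) := by
  constructor
  · intro a
    rw [List.nodup_flatMap]
    refine ⟨fun q _ => (hu.1 _).map fun p p' h => ?_, (hv.1 a).imp fun {q q'} hq => ?_⟩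
    · simp only [Prod.mk.injEq] at h
      exact Prod.ext h.1 h.2.1
    · rw [Function.onFun, List.disjoint_left]
      intro x hx hy
      obtain ⟨p, hp, rfl⟩ := List.mem_map.1 hx
      obtain ⟨p', hp', h⟩ := List.mem_map.1 hy
      simp only [Prod.mk.injEq] at h
      obtain rfl : p' = p := Prod.ext h.1 h.2.1
      exact hq (Prod.ext (hu.2 _ _ _ hp hp') h.2.2.symm)
  · intro a b x ha hb
    obtain ⟨q, hq, hx⟩ := List.mem_flatMap.1 ha
    obtain ⟨q', hq', hy⟩ := List.mem_flatMap.1 hb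
    obtain ⟨p, hp, rfl⟩ := List.mem_map.1 hx
    obtain ⟨p', hp', h⟩ := List.mem_map.1 hy
    simp only [Prod.mk.injEq] at h
    obtain rfl : p' = p := Prod.ext h.1 h.2.1
    obtain rfl : q' = q := Prod.ext (hu.2 _ _ _ hp' hp) h.2.2
    exact hv.2 _ _ _ hq hq'

end Diagram

/-! ### Invariance under equivalence and STU -/

namespace Diagram

theorem place_map {α β Λ : Type} (g : α → β) (f : Fin n → List α) (w : Fin k → List (Fin n × Λ))
    (c : α → Λ) (c' : β → Λ) (h : ∀ i, ∀ x ∈ f i, c' (g x) = c x) :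
    place (fun i => (f i).map g) w c' = fun a => (place f w c a).map g := by
  classical
  funext a
  simp only [place, List.map_flatMap, List.filter_map]
  refine List.flatMap_congr fun p _ => ?_
  congr 1
  refine List.filter_congr fun x hx => ?_
  simp [h _ x hx]

theorem realize_map {D E : Diagram n} (f : D.graph.Flag ≃ E.graph.Flag)
    (h1 : ∀ h, f (D.graph.edge h) = E.graph.edge (f h))
    (h2 : ∀ h, f (D.graph.vert h) = E.graph.vert (f h))
    (h3 : ∀ i, (D.legs i).map f = E.legs i) (g : Fin k → List D.graph.Flag) :
    D.realize g = E.realize fun a => (g a).map f := by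
  have e1 : ∑ i, (E.legs i : Multiset E.graph.Flag)
      = Multiset.mapAddMonoidHom f (∑ i, (D.legs i : Multiset D.graph.Flag)) := by
    rw [map_sum]
    refine Finset.sum_congr rfl fun i _ => ?_
    rw [← h3 i]; rfl
  have e2 : ∑ a, (((g a).map f : List _) : Multiset E.graph.Flag)
      = Multiset.mapAddMonoidHom f (∑ a, (g a : Multiset D.graph.Flag)) := by
    rw [map_sum]; rfl
  by_cases h : ∑ j, (g j : Multiset D.graph.Flag) = ∑ i, (D.legs i : Multiset D.graph.Flag)
  · rw [D.realize_of_eq h, E.realize_of_eq (by rw [e1, e2, h])]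
    exact cls_equivalent ⟨f, h1, h2, fun i => rfl⟩
  · rw [D.realize_of_ne h, E.realize_of_ne]
    rw [e1, e2]
    exact fun h' => h (Multiset.map_injective f.injective h')

variable {Λ : Type} [Fintype Λ] [Inhabited Λ]

theorem labelledOp_equivalent {D E : Diagram n} (h : D.Equivalent E)
    (w : Fin k → List (Fin n × Λ)) : labelledOp w D = labelledOp w E := by
  obtain ⟨f, h1, h2, h3⟩ := h
  refine Finset.sum_bij (fun c _ => c ∘ f.symm) ?_ ?_ ?_ ?_
  · intro c hc
    rw [Graph.mem_colorings] at hc ⊢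
    intro h hh
    refine hc _ fun h' => hh ?_
    rw [← f.apply_symm_apply h, ← h2, h']
  · intro c _ c' _ h
    exact f.symm.surjective.injective_comp_right h
  · intro c hc
    refine ⟨c ∘ f, ?_, by funext x; simp⟩
    rw [Graph.mem_colorings] at hc ⊢
    intro h hh
    refine hc _ fun h' => hh (f.injective ?_)
    rw [h2, h']
  · intro c _
    rw [realize_map f h1 h2 h3]
    congr 1
    have : E.legs = fun i => (D.legs i).map f := funext fun i => (h3 i).symm
    rw [this]
    exact (place_map f D.legs w c (c ∘ f.symm) (by simp)).symm

/-- The STU relation after placement, valid also for the default value zero of `realize`: all three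
terms vanish together, as each is nonzero only if the legs other than `x` and `y` are the right
ones. -/
theorem realize_fuse (D : Diagram n) (i : Fin n) (l₁ l₂ : List D.graph.Flag) (x y : D.graph.Flag)
    (h : D.legs i = l₁ ++ x :: y :: l₂) (f : Fin k → List D.graph.Flag) (a : Fin k)
    (m₁ m₂ : List D.graph.Flag) (hf : f a = m₁ ++ x :: y :: m₂) :
    (D.fuse i l₁ l₂ x y h).realize (Function.update (fun j => (f j).map Sum.inl) a
      (m₁.map Sum.inl ++ Sum.inr false :: m₂.map Sum.inl) : Fin k → List (D.graph.Flag ⊕ Bool))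
      = D.realize f - (D.exchange i l₁ l₂ x y h).realize
        (Function.update f a (m₁ ++ y :: x :: m₂) : Fin k → List D.graph.Flag) := by
  obtain ⟨R, hR1, hR2⟩ := fuse_legs D.legs i l₁ l₂ x y h
  obtain ⟨R', hR1', hR2'⟩ := fuse_legs f a m₁ m₂ x y hf
  have hex : ∑ j, ((Function.update f a (m₁ ++ y :: x :: m₂)) j : Multiset D.graph.Flag)
      = ∑ j, (f j : Multiset D.graph.Flag) := by
    rw [sum_update, sum_eq f a, hf]
    congr 1
    exact Multiset.coe_eq_coe.2 (List.Perm.append_left _ (List.Perm.swap _ _ _))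
  have hex' : ∑ j, (Function.update D.legs i (l₁ ++ y :: x :: l₂) j : Multiset D.graph.Flag)
      = ∑ j, (D.legs j : Multiset D.graph.Flag) := by
    rw [sum_update, sum_eq D.legs i, h]
    congr 1
    exact Multiset.coe_eq_coe.2 (List.Perm.append_left _ (List.Perm.swap _ _ _))
  by_cases hR : R' = R
  · subst hR
    have e1 : ∑ j, (f j : Multiset D.graph.Flag) = ∑ j, (D.legs j : Multiset D.graph.Flag) :=
      hR1'.trans hR1.symm
    have e2 := hex.trans (e1.trans hex'.symm)
    have e3 := hR2'.trans hR2.symm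
    refine (realize_of_eq (D.fuse i l₁ l₂ x y h) e3).trans (Eq.trans ?_ (congrArg₂ (· - ·)
      (D.realize_of_eq e1).symm (realize_of_eq (D.exchange i l₁ l₂ x y h) e2).symm))
    exact stu_rearrange D i l₁ l₂ x y h _ _ _ e1 e2 e3 a m₁ m₂ hf rfl rfl
  · have e1 : ∑ j, (f j : Multiset D.graph.Flag) ≠ ∑ j, (D.legs j : Multiset D.graph.Flag) := by
      rw [hR1, hR1']
      simpa using hR
    refine (realize_of_ne (D.fuse i l₁ l₂ x y h) fun h' => hR ?_).trans ((sub_zero 0).symm.trans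
      (congrArg₂ (· - ·) (D.realize_of_ne e1).symm (realize_of_ne (D.exchange i l₁ l₂ x y h)
        (fun h' => e1 (hex.symm.trans (h'.trans hex')))).symm))
    have := hR2'.symm.trans (h'.trans hR2)
    rw [Multiset.cons_inj_right] at this
    exact Multiset.map_injective Sum.inl_injective this

theorem realize_exchange (D : Diagram n) (i : Fin n) (l₁ l₂ : List D.graph.Flag)
    (x y : D.graph.Flag) (h : D.legs i = l₁ ++ x :: y :: l₂) (f : Fin k → List D.graph.Flag) :
    (D.exchange i l₁ l₂ x y h).realize f = D.realize f := realize_rearrange _ _ _ _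

/-- The invariance under STU, for one colouring in which the two vertices have the same colour. -/
theorem realize_place_stu {Λ : Type} (D : Diagram n) (i : Fin n) (l₁ l₂ : List D.graph.Flag)
    (x y : D.graph.Flag) (h : D.legs i = l₁ ++ x :: y :: l₂) {w : Fin k → List (Fin n × Λ)}
    (hw : Separated w) (c : D.graph.Flag → Λ) (c' : D.graph.Flag ⊕ Bool → Λ) (hxy : c x = c y)
    (hz : c' (Sum.inr false) = c x) (hc : ∀ u, u ≠ x → u ≠ y → c' (Sum.inl u) = c u) :
    (D.fuse i l₁ l₂ x y h).realize
        (place (D.fuse i l₁ l₂ x y h).legs w (c' : (D.fuse i l₁ l₂ x y h).graph.Flag → Λ))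
      = D.realize (place D.legs w c) - (D.exchange i l₁ l₂ x y h).realize
        (place (D.exchange i l₁ l₂ x y h).legs w c) := by
  classical
  have hfuse : (D.fuse i l₁ l₂ x y h).legs = (Function.update (fun j => (D.legs j).map Sum.inl) i
    (l₁.map Sum.inl ++ Sum.inr false :: l₂.map Sum.inl) : Fin n → List (D.graph.Flag ⊕ Bool)) := rfl
  have hsep := D.separated_legs
  have hnd := hsep.1 i
  rw [h] at hnd
  have hnd' : (x :: y :: (l₁ ++ l₂)).Nodup :=
    (List.perm_middle.trans (List.Perm.cons _ List.perm_middle)).nodup_iff.1 hnd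
  simp only [List.nodup_cons, List.mem_cons, List.mem_append, not_or] at hnd'
  obtain ⟨⟨hxy', hx1, hx2⟩, ⟨hy1, hy2⟩, -⟩ := hnd'
  have hxi : x ∈ D.legs i := by simp [h]
  have hyi : y ∈ D.legs i := by simp [h]
  by_cases hp : ∃ a, (i, c x) ∈ w a
  · obtain ⟨a, ha⟩ := hp
    -- the pieces that do not contain `x` and `y`
    have other : ∀ p : Fin n × Λ, p ≠ (i, c x) →
        (Function.update D.legs i (l₁ ++ y :: x :: l₂) p.1).filter (fun u => c u = p.2)
          = (D.legs p.1).filter (fun u => c u = p.2) ∧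
        (Function.update (fun j => (D.legs j).map Sum.inl) i
          (l₁.map Sum.inl ++ Sum.inr false :: l₂.map Sum.inl) p.1).filter (fun u => c' u = p.2)
          = ((D.legs p.1).filter (fun u => c u = p.2)).map Sum.inl := by
      rintro ⟨j, t⟩ hne
      have lift : ∀ m : List D.graph.Flag, x ∉ m → y ∉ m →
          (m.map Sum.inl : List (D.graph.Flag ⊕ Bool)).filter (fun u => c' u = t)
            = (m.filter fun u => c u = t).map Sum.inl := by
        intro m hxm hym
        rw [List.filter_map]
        congr 1
        refine List.filter_congr fun u hu => ?_
        have := hc u (fun e => hxm (e ▸ hu)) (fun e => hym (e ▸ hu))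
        simp [this]
      by_cases hj : j = i
      · subst hj
        have ht : ¬ c x = t := fun e => hne (by rw [e])
        have ht' : ¬ c y = t := fun e => ht (hxy.trans e)
        dsimp only
        rw [Function.update_self, Function.update_self, h]
        simp [ht, ht', hz, lift l₁ hx1 hy1, lift l₂ hx2 hy2]
      · dsimp only
        rw [Function.update_of_ne hj, Function.update_of_ne hj]
        exact ⟨rfl, lift _ (fun e => hj (hsep.2 _ _ x e hxi)) (fun e => hj (hsep.2 _ _ y e hyi))⟩
    obtain ⟨u, v, huv⟩ := List.append_of_mem ha
    have huv' := hw.1 a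
    rw [huv, List.nodup_append] at huv'
    have hu : (i, c x) ∉ u := fun h' => huv'.2.2 _ h' _ List.mem_cons_self rfl
    have hv : (i, c x) ∉ v := (List.nodup_cons.1 huv'.2.1).1
    have hne_u : ∀ p ∈ u, p ≠ (i, c x) := fun p hp e => hu (e ▸ hp)
    have hne_v : ∀ p ∈ v, p ≠ (i, c x) := fun p hp e => hv (e ▸ hp)
    have hne_b : ∀ b, b ≠ a → ∀ p ∈ w b, p ≠ (i, c x) :=
      fun b hb p hp e => hb (hw.2 _ _ _ (e ▸ hp) ha)
    set A := u.flatMap fun p => (D.legs p.1).filter fun t => c t = p.2 with hA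
    set B := v.flatMap fun p => (D.legs p.1).filter fun t => c t = p.2 with hB
    set m₁ := l₁.filter fun t => c t = c x with hm₁
    set m₂ := l₂.filter fun t => c t = c x with hm₂
    -- The letter `(i, c x)` occurs once. Since `x` and `y` have the same colour they stay
    -- neighbours in its piece, so STU applies on the string `a`.
    have e1 : place D.legs w c a = (A ++ m₁) ++ x :: y :: (m₂ ++ B) := by
      unfold place
      rw [huv]
      simp [h, hxy.symm, hA, hB, hm₁, hm₂]
    have e2 : place (Function.update D.legs i (l₁ ++ y :: x :: l₂)) w c
        = Function.update (place D.legs w c) a ((A ++ m₁) ++ y :: x :: (m₂ ++ B)) := by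
      funext b
      by_cases hb : b = a
      · subst hb
        rw [Function.update_self]
        unfold place
        rw [huv, List.flatMap_append, List.flatMap_cons,
          List.flatMap_congr fun p hp => (other p (hne_u p hp)).1,
          List.flatMap_congr fun p hp => (other p (hne_v p hp)).1]
        simp [hxy.symm, hA, hB, hm₁, hm₂]
      · rw [Function.update_of_ne hb]
        exact List.flatMap_congr fun p hp => (other p (hne_b b hb p hp)).1
    have e3 : place (Function.update (fun j => (D.legs j).map Sum.inl) i
          (l₁.map Sum.inl ++ Sum.inr false :: l₂.map Sum.inl)) w c'
        = Function.update (fun j => (place D.legs w c j).map Sum.inl) a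
          ((A ++ m₁).map Sum.inl ++ Sum.inr false :: (m₂ ++ B).map Sum.inl) := by
      have lift : ∀ m : List D.graph.Flag, x ∉ m → y ∉ m →
          (m.map Sum.inl : List (D.graph.Flag ⊕ Bool)).filter (fun u => c' u = c x)
            = (m.filter fun u => c u = c x).map Sum.inl := by
        intro m hxm hym
        rw [List.filter_map]
        congr 1
        refine List.filter_congr fun u hu => ?_
        have := hc u (fun e => hxm (e ▸ hu)) (fun e => hym (e ▸ hu))
        simp [this]
      funext b
      by_cases hb : b = a
      · subst hb
        rw [Function.update_self]
        unfold place
        rw [huv, List.flatMap_append, List.flatMap_cons,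
          List.flatMap_congr fun p hp => (other p (hne_u p hp)).2,
          List.flatMap_congr fun p hp => (other p (hne_v p hp)).2]
        simp [hz, hA, hB, hm₁, hm₂, List.map_flatMap, lift l₁ hx1 hy1,
          lift l₂ hx2 hy2]
      · rw [Function.update_of_ne hb]
        unfold place
        rw [List.map_flatMap]
        exact List.flatMap_congr fun p hp => (other p (hne_b b hb p hp)).2
    exact (congrArg _ e3).trans ((realize_fuse D i l₁ l₂ x y h _ a _ _ e1).trans
      (congrArg₂ (· - ·) rfl (congrArg (D.exchange i l₁ l₂ x y h).realize e2.symm)))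
  -- No letter receives the common colour, so all three terms lose a leg and vanish.
  · push Not at hp
    have hxi' : x ∈ Function.update D.legs i (l₁ ++ y :: x :: l₂) i := by
      rw [Function.update_self]; simp
    rw [D.realize_place_of_notMem hxi hp,
      realize_place_of_notMem (D.exchange i l₁ l₂ x y h) (i := i) (x := x) hxi' hp, sub_zero]
    refine realize_place_of_notMem (D.fuse i l₁ l₂ x y h) (i := i)
      (x := (Sum.inr false : D.graph.Flag ⊕ Bool)) ?_ fun a => by rw [hz]; exact hp a
    rw [hfuse, Function.update_self]
    exact List.mem_append_right _ List.mem_cons_self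

/-- Vertices of different colours go to different letters, so their order on the original string is
not seen. -/
theorem place_exchange_of_ne {α Λ : Type} (f : Fin n → List α) (i : Fin n) (l₁ l₂ : List α)
    (x y : α) (h : f i = l₁ ++ x :: y :: l₂) (w : Fin k → List (Fin n × Λ))
    (c : α → Λ) (hxy : c x ≠ c y) :
    place (Function.update f i (l₁ ++ y :: x :: l₂)) w c = place f w c := by
  classical
  funext a
  refine List.flatMap_congr fun p _ => ?_
  by_cases hp : p.1 = i
  · rw [hp, Function.update_self, h]
    by_cases h1 : c x = p.2
    · have h2 : ¬ c y = p.2 := fun h2 => hxy (h1.trans h2.symm)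
      simp [h1, h2]
    · simp [h1, List.filter_cons]
  · rw [Function.update_of_ne hp]

/-- Colourings separating `x` from `y` cancel in the difference. The others correspond to the
colourings of the fused graph. -/
theorem labelledOp_stu (D : Diagram n) (i : Fin n) (l₁ l₂ : List D.graph.Flag)
    (x y : D.graph.Flag) (h : D.legs i = l₁ ++ x :: y :: l₂) {w : Fin k → List (Fin n × Λ)}
    (hw : Separated w) : labelledOp w (D.fuse i l₁ l₂ x y h)
      = labelledOp w D - labelledOp w (D.exchange i l₁ l₂ x y h) := by
  classical
  have hx : D.graph.vert x = x := D.vert_of_mem (i := i) (by simp [h])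
  have hy : D.graph.vert y = y := D.vert_of_mem (i := i) (by simp [h])
  have hxy := D.ne_of_legs h
  refine Eq.trans ?_ (Finset.sum_sub_distrib (s := D.graph.colorings Λ)
    (fun c => D.realize (place D.legs w c)) fun c =>
    (D.exchange i l₁ l₂ x y h).realize (place (D.exchange i l₁ l₂ x y h).legs w c))
  refine Eq.trans ?_ (Finset.sum_filter_of_ne (p := fun c : D.graph.Flag → Λ => c x = c y) ?_)
  -- The new leg `inr false` carries the common colour of `x` and `y`; these two flags and `inr
  -- true` become internal and must take the default colour.
  · refine Finset.sum_bij' (i := fun (c' : D.graph.Flag ⊕ Bool → Λ) _ =>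
        fun u => if u = x ∨ u = y then c' (Sum.inr false) else c' (Sum.inl u))
      (j := fun c _ => (Sum.elim (fun u => if u = x ∨ u = y then default else c u)
        (fun b => if b then default else c x) : D.graph.Flag ⊕ Bool → Λ)) ?_ ?_ ?_ ?_ ?_
    · intro c' hc'
      have hc' : ∀ u, fuseVert D.graph.vert x y u ≠ u → c' u = default := Graph.mem_colorings.1 hc'
      refine Finset.mem_filter.2 ⟨Graph.mem_colorings.2 fun u hu => ?_, by simp⟩
      have h1 : u ≠ x := fun e => hu (e ▸ hx)
      have h2 : u ≠ y := fun e => hu (e ▸ hy)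
      simp only [h1, h2, or_self, if_false]
      refine hc' _ fun h' => hu ?_
      rw [fuseVert_of_ne hx hy h1 h2] at h'
      exact Sum.inl_injective h'
    · intro c hc
      obtain ⟨hc, hcxy⟩ := Finset.mem_filter.1 hc
      refine Graph.mem_colorings.2 ?_
      change ∀ u : D.graph.Flag ⊕ Bool, fuseVert D.graph.vert x y u ≠ u → _
      rintro (u | b) hu
      · by_cases h1 : u = x ∨ u = y
        · simp [h1]
        · push Not at h1
          rw [fuseVert_of_ne hx hy h1.1 h1.2] at hu
          simp only [Sum.elim_inl, h1.1, h1.2, or_self, if_false]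
          exact Graph.mem_colorings.1 hc u fun h' => hu (by rw [h'])
      · cases b
        · exact absurd fuseVert_false hu
        · simp
    · intro c' hc'
      have hc' : ∀ u, fuseVert D.graph.vert x y u ≠ u → c' u = default := Graph.mem_colorings.1 hc'
      funext u
      rcases u with u | b
      · by_cases h1 : u = x ∨ u = y
        · simp only [Sum.elim_inl, h1, if_true]
          refine (hc' _ ?_).symm
          rcases h1 with rfl | rfl
          · rw [fuseVert_left hx]; simp
          · rw [fuseVert_right hy hxy]; simpa using hxy
        · simp [h1]
      · cases b
        · simp
        · simp only [Sum.elim_inr, if_true]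
          refine (hc' _ ?_).symm
          rw [fuseVert_true]; simp
    · intro c hc
      obtain ⟨hc, hcxy⟩ := Finset.mem_filter.1 hc
      funext u
      by_cases h1 : u = x
      · simp [h1]
      · by_cases h2 : u = y
        · simp [h2, hcxy]
        · simp [h1, h2]
    · intro c' _
      refine realize_place_stu D i l₁ l₂ x y h hw _ _ ?_ ?_ ?_
      · simp
      · simp
      · intro u h1 h2; simp [h1, h2]
  · intro c _ hne
    by_contra hcxy
    refine hne ?_
    refine sub_eq_zero.2 (Eq.trans ?_ (realize_exchange D i l₁ l₂ x y h _).symm)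
    exact congrArg D.realize (place_exchange_of_ne D.legs i l₁ l₂ x y h w c hcxy).symm

end Diagram

/-! ### Word operations on diagrams modulo relations -/

/-- The operation of a family of words: the string `a` of the result is the concatenation of the
strings named by the letters of `w a`, and each univalent vertex on a string is placed in all ways
on one of the occurrences of this string. -/
def op (w : Fin k → FreeMonoid (Fin n)) : P n →ₗ[ℚ] P k :=
  P.lift (Diagram.wordOp w) (fun _ _ h => Diagram.labelledOp_equivalent h _)
    (fun D i l₁ l₂ x y h => D.labelledOp_stu i l₁ l₂ x y h (separated_positions w))

theorem op_cls (w : Fin k → FreeMonoid (Fin n)) (D : Diagram n) : op w D.cls = D.wordOp w :=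
  P.lift_cls _ _ _ D

/-- Holds also where `realize` is zero by default: a leg lost in the first placement is still
missing after the second. -/
theorem op_realize (v : Fin l → FreeMonoid (Fin k)) (D : Diagram n) {Λ Λ' : Type} [Fintype Λ']
    [Inhabited Λ'] {u : Fin k → List (Fin n × Λ)} (hu : Separated u)
    (c : D.graph.Flag → Λ) {v' : Fin l → List (Fin k × Λ')} (hv' : Separated v')
    (h : ∀ a, (v' a).map Prod.fst = (v a).toList) :
    op v (D.realize (place D.legs u c))
      = ∑ c' ∈ D.graph.colorings Λ', D.realize (place (place D.legs u c) v' c') := by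
  by_cases hc : ∑ j, (place D.legs u c j : Multiset D.graph.Flag)
      = ∑ i, (D.legs i : Multiset D.graph.Flag)
  · rw [D.realize_of_eq hc, op_cls, Diagram.wordOp_eq _ hv' v h]
    exact Finset.sum_congr rfl fun c' _ => D.realize_rearrange _ hc _
  · rw [D.realize_of_ne hc, map_zero, eq_comm]
    refine Finset.sum_eq_zero fun c' _ => ?_
    rw [sum_place_eq_iff D.separated_legs hu] at hc
    push Not at hc
    obtain ⟨i, x, hx, hi⟩ := hc
    refine D.realize_eq_zero hx fun a ha => ?_
    obtain ⟨j, -, hj⟩ := mem_place.1 ha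
    obtain ⟨i', h1, h2⟩ := mem_place.1 hj
    obtain rfl := D.separated_legs.2 _ _ x hx h2
    exact hi j h1

instance {Λ Λ' : Type} [Inhabited Λ] [Inhabited Λ'] : Inhabited (Λ × Λ') := inferInstance

/-- Word operations compose by substitution. -/
theorem op_op (v : Fin l → FreeMonoid (Fin k)) (w : Fin k → FreeMonoid (Fin n)) (z : P n) :
    op v (op w z) = op (fun a => FreeMonoid.lift w (v a)) z := by
  have : op v ∘ₗ op w = (op fun a => FreeMonoid.lift w (v a) : P n →ₗ[ℚ] P l) := by
    refine P.hom_ext fun D => ?_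
    rw [LinearMap.comp_apply, op_cls, op_cls, Diagram.wordOp, Diagram.labelledOp, map_sum]
    rw [Diagram.wordOp_eq D
      (Diagram.separated_substitute (separated_positions w) (separated_positions v))]
    · rw [Finset.sum_congr rfl fun c _ => op_realize v D (separated_positions w) c
        (separated_positions v) (map_fst_positions v), Diagram.labelledOp, ← Finset.sum_product']
      refine Finset.sum_bij (fun p _ h => (p.1 h, p.2 h)) ?_ ?_ ?_ ?_
      · intro p hp
        obtain ⟨h1, h2⟩ := Finset.mem_product.1 hp
        exact Graph.mem_colorings.2 fun h hh =>
          Prod.ext (Graph.mem_colorings.1 h1 h hh) (Graph.mem_colorings.1 h2 h hh)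
      · intro p _ q _ h
        refine Prod.ext (funext fun x => ?_) (funext fun x => ?_)
        · exact congrArg Prod.fst (congrFun h x)
        · exact congrArg Prod.snd (congrFun h x)
      · intro c hc
        rw [Graph.mem_colorings] at hc
        refine ⟨(fun h => (c h).1, fun h => (c h).2), ?_, rfl⟩
        exact Finset.mem_product.2 ⟨Graph.mem_colorings.2 fun h hh => congrArg Prod.fst (hc h hh),
          Graph.mem_colorings.2 fun h hh => congrArg Prod.snd (hc h hh)⟩
      · intro p _
        rw [Diagram.place_place]
    · intro a
      rw [List.map_flatMap]
      simp only [List.map_map, Function.comp_def]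
      have : ∀ b, (positions w b).map (fun p => p.1) = (w b).toList := map_fst_positions w
      simp only [this]
      rw [FreeMonoid.lift_apply, FreeMonoid.toList_prod, ← map_fst_positions v a]
      simp [List.flatMap_def, List.map_map, Function.comp_def]
  exact LinearMap.congr_fun this z

theorem mem_of_mem_pow {α : Type} {x : α} {w : FreeMonoid α} {a : ℕ} (h : x ∈ w ^ a) : x ∈ w := by
  induction a with
  | zero => exact absurd h FreeMonoid.notMem_one
  | succ a ih =>
    rw [pow_succ, FreeMonoid.mem_mul] at h
    exact h.elim ih id

namespace Diagram

/-- If no string is named twice there is nothing to distribute: labels in `Unit` suffice, and there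
is a single colouring. -/
theorem op_cls_of_separated (w : Fin k → FreeMonoid (Fin n)) (hw : Separated fun a => (w a).toList)
    (D : Diagram n) : op w D.cls = D.realize fun a => (w a).toList.flatMap D.legs := by
  classical
  have hs : Separated fun a => (w a).toList.map fun i => (i, ()) := by
    refine ⟨fun a => (hw.1 a).map fun i j h => congrArg Prod.fst h, fun a b x ha hb => ?_⟩
    obtain ⟨i, hi, rfl⟩ := List.mem_map.1 ha
    obtain ⟨j, hj, h⟩ := List.mem_map.1 hb
    obtain rfl : j = i := congrArg Prod.fst h
    exact hw.2 _ _ _ hi hj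
  rw [op_cls, wordOp_eq D hs w (fun a => by simp [Function.comp_def]), labelledOp,
    Finset.sum_eq_single fun _ => ()]
  · congr 1
    funext a
    simp [place, List.flatMap_map]
  · exact fun c _ hc => absurd (Subsingleton.elim _ _) hc
  · exact fun h => absurd (Graph.mem_colorings.2 fun _ _ => rfl) h

end Diagram

/-! ### The structure maps as word operations -/

theorem op_congr {w w' : Fin k → FreeMonoid (Fin n)} (h : ∀ a, w a = w' a) : op w = op w' := by
  rw [funext h]

theorem op_of (z : P n) : op FreeMonoid.of z = z := by
  have : op FreeMonoid.of = (LinearMap.id : P n →ₗ[ℚ] P n) := by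
    refine P.hom_ext fun D => ?_
    rw [Diagram.op_cls_of_separated _ ⟨fun a => by simp, fun a b x ha hb => by simp_all⟩]
    simp [Diagram.realize_legs]
  exact LinearMap.congr_fun this z

theorem addString_eq_op (p : Fin (n + 1)) (z : P n) : addString p z
    = op (Fin.insertNth (α := fun _ => FreeMonoid (Fin n)) p 1 FreeMonoid.of) z := by
  have : addString p
      = (op (Fin.insertNth (α := fun _ => FreeMonoid (Fin n)) p 1 FreeMonoid.of)) := by
    refine P.hom_ext fun D => ?_
    rw [addString_cls, Diagram.op_cls_of_separated]
    · have e : (fun a => ((Fin.insertNth (α := fun _ => FreeMonoid (Fin n)) p 1 FreeMonoid.of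
          : Fin (n + 1) → FreeMonoid (Fin n)) a).toList.flatMap D.legs)
          = Fin.insertNth (α := fun _ => List D.graph.Flag) p [] D.legs := by
        funext a
        refine Fin.succAboveCases p ?_ (fun j => ?_) a <;> simp
      rw [e]
      exact (D.realize_of_eq _).symm
    · refine ⟨fun a => ?_, fun a b x => ?_⟩
      · refine Fin.succAboveCases p ?_ (fun j => ?_) a <;> simp
      · refine Fin.succAboveCases p ?_ (fun j => ?_) a
        · simp
        · refine Fin.succAboveCases p ?_ (fun j' => ?_) b
          · simp
          · simp only [Fin.insertNth_apply_succAbove, FreeMonoid.toList_of, List.mem_singleton]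
            rintro rfl rfl; rfl
  exact LinearMap.congr_fun this z

theorem permute_eq_op (π : Equiv.Perm (Fin n)) (z : P n) :
    permute π z = op (fun j => FreeMonoid.of (π.symm j)) z := by
  have : permute π = op (fun j => FreeMonoid.of (π.symm j)) := by
    refine P.hom_ext fun D => ?_
    rw [permute_cls, Diagram.op_cls_of_separated]
    · have e : (fun a => (FreeMonoid.of (π.symm a)).toList.flatMap D.legs)
          = fun j => D.legs (π.symm j) := by
        funext a; simp
      rw [e]
      exact (D.realize_of_eq _).symm
    · refine ⟨fun a => by simp, fun a b x => ?_⟩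
      simp only [FreeMonoid.toList_of, List.mem_singleton]
      rintro rfl h
      exact π.symm.injective h
  exact LinearMap.congr_fun this z

/-- The letter `i` is written twice, labelled `true` for the left copy and `false` for the right
one. A colouring which is `true` at a leg of another string contributes zero; the remaining ones are
the subsets of the legs of the `i`-th string. -/
theorem coproduct_eq_op (i : Fin n) (z : P n) : coproduct i z = op
    (Fin.insertNth (α := fun _ => FreeMonoid (Fin n)) i.castSucc (FreeMonoid.of i) FreeMonoid.of)
    z := by
  classical
  have : coproduct i = op (Fin.insertNth (α := fun _ => FreeMonoid (Fin n)) i.castSucc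
      (FreeMonoid.of i) FreeMonoid.of) := by
    refine P.hom_ext fun D => ?_
    have hs : Separated (Fin.insertNth (α := fun _ => List (Fin n × Bool)) i.castSucc [(i, true)]
        fun j => [(j, false)]) := by
      refine ⟨fun a => ?_, fun a b x => ?_⟩
      · refine Fin.succAboveCases i.castSucc ?_ (fun j => ?_) a <;> simp
      · refine Fin.succAboveCases i.castSucc ?_ (fun j => ?_) a <;>
        refine Fin.succAboveCases i.castSucc ?_ (fun j => ?_) b <;>
        simp +contextual
    rw [coproduct_cls, op_cls, D.wordOp_eq hs]
    · rw [Diagram.coproduct, subsetSum, Diagram.labelledOp]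
      -- The default colour is `false`, so the indicator of a set of legs is a colouring.
      refine Finset.sum_of_injOn (fun A x => decide (x ∈ A)) ?_ ?_ ?_ ?_
      · intro A _ B _ h
        ext x
        simpa using congrFun h x
      · intro A hA
        refine Graph.mem_colorings.2 fun x hx => ?_
        refine decide_eq_false fun h' => hx ?_
        exact D.vert_of_mem (List.mem_toFinset.1 (Finset.mem_powerset.1 hA h'))
      · intro c hc hcA
        by_cases h : ∀ x, c x = true → x ∈ D.legs i
        · refine absurd ⟨(D.legs i).toFinset.filter fun x => c x = true, ?_, ?_⟩ hcA
          · exact Finset.mem_coe.2 (Finset.mem_powerset.2 (Finset.filter_subset _ _))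
          · funext x
            by_cases hx : c x = true
            · simp [hx, h x hx]
            · simp [hx]
        · push Not at h
          obtain ⟨x, hx, hxi⟩ := h
          have hv : D.graph.vert x = x := by
            by_contra hv
            rw [Graph.mem_colorings.1 hc x hv] at hx
            exact absurd hx (by decide)
          obtain ⟨j, hj⟩ := (mem_sum_coe _ _).1 ((D.mem_legs x).2 hv)
          refine D.realize_place_of_notMem hj fun a => ?_
          rw [hx]
          refine Fin.succAboveCases i.castSucc ?_ (fun j' => ?_) a
          · simp only [Fin.insertNth_apply_same, List.mem_singleton, Prod.mk.injEq, and_true]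
            rintro rfl; exact hxi hj
          · simp
      · intro A hA
        have e : place D.legs (Fin.insertNth (α := fun _ => List (Fin n × Bool)) i.castSucc
            [(i, true)] fun j => [(j, false)]) (fun x => decide (x ∈ A)) = Diagram.splitLegs D.legs
                i A := by
          funext a
          rw [Diagram.splitLegs]
          refine Fin.succAboveCases i.castSucc ?_ (fun j => ?_) a
          · simp [place]
          · rw [Fin.insertNth_apply_succAbove]
            simp only [place, Fin.insertNth_apply_succAbove, List.flatMap_cons, List.flatMap_nil,
              List.append_nil, decide_eq_false_iff_not]
            by_cases hj : j = i
            · subst hj; rw [Function.update_self]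
            · rw [Function.update_of_ne hj, List.filter_eq_self]
              intro x hx
              refine decide_eq_true fun hxA => hj ?_
              exact D.separated_legs.2 _ _ x hx
                (List.mem_toFinset.1 (Finset.mem_powerset.1 hA hxA))
        rw [e]
        exact (D.realize_of_eq _).symm
    · intro a
      refine Fin.succAboveCases i.castSucc ?_ (fun j => ?_) a <;> simp
  exact LinearMap.congr_fun this z

/-! ### Word operations and the integral lattice -/

theorem op_cls_mem {H : AddSubgroup (P k)} (w : Fin k → FreeMonoid (Fin n)) (D : Diagram n)
    (h : ∀ (f : Fin k → List D.graph.Flag)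
      (hf : ∑ j, (f j : Multiset D.graph.Flag) = ∑ i, (D.legs i : Multiset D.graph.Flag)),
      (∀ a, ∀ x ∈ f a, ∃ i ∈ w a, x ∈ D.legs i) → (D.rearrange f hf).cls ∈ H) :
    op w D.cls ∈ H := by
  rw [op_cls, Diagram.wordOp, Diagram.labelledOp]
  refine AddSubgroup.sum_mem _ fun c _ => ?_
  by_cases hc : ∑ j, (place D.legs (positions w) c j : Multiset D.graph.Flag)
      = ∑ i, (D.legs i : Multiset D.graph.Flag)
  · rw [D.realize_of_eq hc]
    refine h _ hc fun a x hx => ?_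
    obtain ⟨i, h1, h2⟩ := mem_place.1 hx
    refine ⟨i, ?_, h2⟩
    have := List.mem_map_of_mem (f := Prod.fst) h1
    rw [map_fst_positions] at this
    exact this
  · rw [D.realize_of_ne hc]; exact zero_mem _

/-- If a string with a univalent vertex is named by no word, then the operation gives zero. -/
theorem op_cls_eq_zero (w : Fin k → FreeMonoid (Fin n)) (D : Diagram n) (i : Fin n)
    (hi : D.legs i ≠ []) (h : ∀ a, i ∉ w a) : op w D.cls = 0 := by
  have : op w D.cls ∈ (⊥ : AddSubgroup (P k)) := by
    refine op_cls_mem w D fun f hf hfw => ?_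
    obtain ⟨x, hx⟩ := List.exists_mem_of_ne_nil _ hi
    have : x ∈ ∑ j, (f j : Multiset D.graph.Flag) := by
      rw [hf, mem_sum_coe]; exact ⟨i, hx⟩
    obtain ⟨a, ha⟩ := (mem_sum_coe _ _).1 this
    obtain ⟨j, h1, h2⟩ := hfw a x ha
    obtain rfl := D.separated_legs.2 _ _ x hx h2
    exact absurd h1 (h a)
  exact AddSubgroup.mem_bot.1 this

/-- An element of the lattice is an integral linear combination of diagrams all of whose strings
carry a univalent vertex. -/
theorem integralLattice_induction {p : P n → Prop} {x : P n} (hx : x ∈ integralLattice n m)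
    (mem : ∀ D : Diagram n, D.graph.Connected → D.graph.numVertices = 2 * m →
      (∀ i, D.legs i ≠ []) → p D.cls) (zero : p 0) (add : ∀ x y, p x → p y → p (x + y))
    (neg : ∀ x, p x → p (-x)) : p x := by
  refine AddSubgroup.closure_induction (p := fun x _ => p x) ?_ zero
    (fun x y _ _ => add x y) (fun x _ => neg x) hx
  rintro x ⟨D, h1, h2, h3, rfl⟩
  rcases eq_zero_or_legs_ne_nil D h3 with h | h
  · rw [h]; exact zero
  · exact mem D h1 h2 h

/-- A word operation respects the lattices if each word contains a letter that occurs in no other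
word. -/
theorem op_mem_integralLattice (w : Fin k → FreeMonoid (Fin n)) (i : Fin k → Fin n)
    (hi : ∀ a b, i a ∈ w b → b = a) {x : P n} (hx : x ∈ integralLattice n m) :
    op w x ∈ integralLattice k m := by
  refine integralLattice_induction (p := fun x => op w x ∈ integralLattice k m) hx (fun D h1 h2 h3
      => ?_) ?_ ?_ ?_
  · refine op_cls_mem w D fun f hf hfw => AddSubgroup.subset_closure
      ⟨_, h1, h2, nondegenerate_of_legs _ fun a => ?_, rfl⟩
    -- A leg of the string `i a` can only land on the string `a` of the result, which is therefore
    -- not empty.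
    obtain ⟨x, hx⟩ := List.exists_mem_of_ne_nil _ (h3 (i a))
    have : x ∈ ∑ j, (f j : Multiset D.graph.Flag) := by
      rw [hf, mem_sum_coe]; exact ⟨_, hx⟩
    obtain ⟨b, hb⟩ := (mem_sum_coe _ _).1 this
    obtain ⟨j, h4, h5⟩ := hfw b x hb
    obtain rfl := D.separated_legs.2 _ _ x hx h5
    obtain rfl := hi a b h4
    exact List.ne_nil_of_mem hb
  · rw [map_zero]; exact zero_mem _
  · intro x y hx hy; rw [map_add]; exact add_mem hx hy
  · intro x hx; rw [map_neg]; exact neg_mem hx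

/-! ### Interpolation weights and their denominators -/

section interpolation

/-- The product is `b! (-1)^d d!`. It is the denominator of a Lagrange basis polynomial with nodes
`0, …, b + d`, hence divides `(b + d)!`. -/
theorem prod_sub_eq (b d : ℕ) : ((b + d).choose b : ℤ) * (-1) ^ d
    * ∏ j ∈ (Finset.range (b + d + 1)).erase b, ((b : ℤ) - j) = ((b + d)! : ℤ) := by
  induction d with
  | zero =>
    have e : (Finset.range (b + 0 + 1)).erase b = Finset.range b := by
      ext j; simp only [Finset.mem_erase, Finset.mem_range]; omega
    rw [e, add_zero, Nat.choose_self, ← Nat.descFactorial_self, Nat.descFactorial_eq_prod_range,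
      Nat.cast_prod, Nat.cast_one, pow_zero, one_mul, one_mul]
    refine Finset.prod_congr rfl fun j hj => ?_
    rw [Nat.cast_sub (Finset.mem_range.1 hj).le]
  | succ d ih =>
    have e : (Finset.range (b + (d + 1) + 1)).erase b
        = insert (b + d + 1) ((Finset.range (b + d + 1)).erase b) := by
      ext j; simp only [Finset.mem_erase, Finset.mem_range, Finset.mem_insert]; omega
    have h := Nat.choose_mul_succ_eq (b + d) b
    rw [show b + d + 1 - b = d + 1 by omega] at h
    have h' : ((b + d).choose b : ℤ) * (b + d + 1) = ((b + d + 1).choose b : ℤ) * (d + 1) := by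
      exact_mod_cast h
    rw [e, Finset.prod_insert (by simp), ← add_assoc, Nat.factorial_succ]
    push_cast
    rw [← ih, pow_succ]
    linear_combination (-1 : ℤ) ^ d * (∏ j ∈ (Finset.range (b + d + 1)).erase b, ((b : ℤ) - j)) *
        (-h')

/-- Weights which extract a coefficient of a polynomial of degree at most `K` from its values at
`0, …, K`; their denominators divide `K!`. -/
theorem exists_weights (K t : ℕ) : ∃ c : ℕ → ℚ,
    (∀ s ≤ K, ∑ b ∈ Finset.range (K + 1), c b * (b : ℚ) ^ s = if s = t then 1 else 0) ∧
    ∀ b ≤ K, ∃ z : ℤ, (K ! : ℚ) * c b = z := by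
  classical
  let v : ℕ → ℚ := fun b => b
  have hv : Set.InjOn v (Finset.range (K + 1)) := fun a _ b _ h => Nat.cast_injective h
  refine ⟨fun b => (Lagrange.basis (Finset.range (K + 1)) v b).coeff t, fun s hs => ?_,
    fun b hb => ?_⟩
  · have h := Lagrange.eq_interpolate (f := (Polynomial.X ^ s : Polynomial ℚ)) hv (by
      rw [Polynomial.degree_X_pow, Finset.card_range]
      exact_mod_cast Nat.lt_succ_of_le hs)
    have h' := congrArg (fun p => Polynomial.coeff p t) h
    simp only [Lagrange.interpolate_apply, Polynomial.finsetSum_coeff, Polynomial.coeff_C_mul,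
      Polynomial.eval_pow, Polynomial.eval_X, Polynomial.coeff_X_pow] at h'
    rw [show (if s = t then (1 : ℚ) else 0) = if t = s then 1 else 0 by simp [eq_comm], h']
    exact Finset.sum_congr rfl fun b _ => mul_comm _ _
  · obtain ⟨d, rfl⟩ := Nat.exists_eq_add_of_le hb
    -- The basis polynomial is a scalar times a polynomial with integral coefficients, so only the
    -- scalar matters for the denominator.
    have h1 : Lagrange.basis (Finset.range (b + d + 1)) v b
        = Polynomial.C (∏ j ∈ (Finset.range (b + d + 1)).erase b, ((b : ℚ) - j)⁻¹)
          * Polynomial.map (Int.castRingHom ℚ)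
            (∏ j ∈ (Finset.range (b + d + 1)).erase b, (Polynomial.X - Polynomial.C (j : ℤ))) := by
      rw [Lagrange.basis, Polynomial.map_prod, map_prod, ← Finset.prod_mul_distrib]
      refine Finset.prod_congr rfl fun j _ => ?_
      simp [Lagrange.basisDivisor, v]
    have h2 : ∏ j ∈ (Finset.range (b + d + 1)).erase b, ((b : ℚ) - j) ≠ 0 := by
      refine Finset.prod_ne_zero_iff.2 fun j hj => sub_ne_zero.2 fun h => ?_
      exact (Finset.mem_erase.1 hj).1 (Nat.cast_injective h).symm
    have h3 : ((b + d)! : ℚ) * ∏ j ∈ (Finset.range (b + d + 1)).erase b, ((b : ℚ) - j)⁻¹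
        = ((b + d).choose b : ℤ) * (-1) ^ d := by
      have := congrArg (Int.cast (R := ℚ)) (prod_sub_eq b d)
      push_cast at this
      rw [← this, Finset.prod_inv_distrib, mul_assoc, mul_inv_cancel₀ h2, mul_one]
      norm_cast
    refine ⟨((b + d).choose b : ℤ) * (-1) ^ d * (∏ j ∈ (Finset.range (b + d + 1)).erase b,
      (Polynomial.X - Polynomial.C (j : ℤ))).coeff t, ?_⟩
    dsimp only
    rw [h1, Polynomial.coeff_C_mul, Polynomial.coeff_map, ← mul_assoc, h3]
    push_cast
    rfl

theorem exists_choose_eq (t : ℕ) : ∃ c : ℕ → ℚ, ∀ a : ℕ,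
    (a.choose t : ℚ) = ∑ s ∈ Finset.range (t + 1), c s * (a : ℚ) ^ s := by
  refine ⟨fun s => (t ! : ℚ)⁻¹ * (descPochhammer ℚ t).coeff s, fun a => ?_⟩
  have h : (descPochhammer ℚ t).eval (a : ℚ) = (a.choose t : ℚ) * t ! := by
    rw [descPochhammer_eval_eq_descFactorial, Nat.descFactorial_eq_factorial_mul_choose]
    push_cast; ring
  have h2 : (t ! : ℚ) ≠ 0 := by positivity
  rw [Polynomial.eval_eq_sum_range' (n := t + 1)
    (by rw [descPochhammer_natDegree]; exact Nat.lt_succ_self t)] at h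
  refine mul_right_cancel₀ h2 ?_
  rw [← h, Finset.sum_mul]
  refine Finset.sum_congr rfl fun s _ => ?_
  field_simp

end interpolation

/-! ### Powers of a string are polynomial in the exponent -/

/-- Replace the `i`-th string by its `a`-th power. -/
def power (i : Fin n) (a : ℕ) : P n →ₗ[ℚ] P n :=
  op (Function.update FreeMonoid.of i (FreeMonoid.of i ^ a))

theorem power_one (i : Fin n) (z : P n) : power i 1 z = z := by
  rw [power, pow_one, Function.update_eq_self, op_of]

theorem lift_update_pow (i j : Fin n) (a : ℕ) (w : Fin n → FreeMonoid (Fin k)) :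
    FreeMonoid.lift w (Function.update FreeMonoid.of i (FreeMonoid.of i ^ a) j)
      = Function.update w i (w i ^ a) j := by
  by_cases h : j = i
  · subst h; simp
  · simp [h]

theorem power_op (i : Fin k) (a : ℕ) (w : Fin k → FreeMonoid (Fin n)) (z : P n) :
    power i a (op w z) = op (Function.update w i (w i ^ a)) z := by
  rw [power, op_op]
  simp only [lift_update_pow]

theorem power_power (i : Fin n) (a b : ℕ) (z : P n) :
    power i a (power i b z) = power i (b * a) z := by
  rw [power.eq_1 i b, power_op, power]
  simp [pow_mul]

theorem power_comm (i j : Fin n) (a b : ℕ) (z : P n) :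
    power i a (power j b z) = power j b (power i a z) := by
  by_cases h : i = j
  · subst h; rw [power_power, power_power, mul_comm]
  · have h1 := power_op i a (Function.update FreeMonoid.of j (FreeMonoid.of j ^ b)) z
    have h2 := power_op j b (Function.update FreeMonoid.of i (FreeMonoid.of i ^ a)) z
    rw [Function.update_of_ne h] at h1
    rw [Function.update_of_ne (Ne.symm h), Function.update_comm h] at h2
    exact h1.trans h2.symm

/-- Summation of a difference equation by Pascal's rule. -/
theorem eq_add_sum_choose {V : Type 1} [AddCommGroup V] [Module ℚ V] (κ : ℕ) (f g : ℕ → V)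
    (h : ∀ a, f (a + 1) = f a + ∑ t ∈ Finset.range κ, (a.choose t : ℚ) • g t) (a : ℕ) :
    f a = f 0 + ∑ t ∈ Finset.range κ, (a.choose (t + 1) : ℚ) • g t := by
  induction a with
  | zero => simp
  | succ a ih =>
    rw [h, ih, add_assoc, ← Finset.sum_add_distrib]
    congr 1
    refine Finset.sum_congr rfl fun t _ => ?_
    rw [Nat.choose_succ_succ, Nat.cast_add, add_smul, add_comm]

/-- This is `x^(a+1) = x^a · x`: double the string, raise the left copy to the `a`-th power,
multiply the copies. -/
theorem power_coproduct (i : Fin n) (a : ℕ) (z : P n) : power i (a + 1) z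
    = op (Function.update (fun j => FreeMonoid.of (i.castSucc.succAbove j)) i
        (FreeMonoid.of i.castSucc * FreeMonoid.of (i.castSucc.succAbove i)))
      (power i.castSucc a (coproduct i z)) := by
  rw [coproduct_eq_op, power_op, op_op, power]
  refine LinearMap.congr_fun (op_congr fun j => ?_) z
  by_cases h : j = i
  · subst h
    simp only [Function.update_self, map_mul, FreeMonoid.lift_eval_of, Fin.insertNth_apply_same]
    rw [Function.update_of_ne (Fin.succAbove_ne _ _), Fin.insertNth_apply_succAbove, pow_succ]
  · rw [Function.update_of_ne h, Function.update_of_ne h, FreeMonoid.lift_eval_of,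
      Function.update_of_ne (Fin.succAbove_ne _ _), Fin.insertNth_apply_succAbove]

-- The term of `Δ_i` with all legs on the left copy: the right copy is empty, and multiplying by it
-- changes nothing.
open Classical in
theorem op_split_univ (i : Fin n) (a : ℕ) (D : Diagram n) :
    op (Function.update (fun j => FreeMonoid.of (i.castSucc.succAbove j)) i
        (FreeMonoid.of i.castSucc * FreeMonoid.of (i.castSucc.succAbove i)))
      (power i.castSucc a (D.split i (D.legs i).toFinset).cls) = power i a D.cls := by
  have e : (D.split i (D.legs i).toFinset).cls = addString i.succ D.cls := by
    rw [addString_cls]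
    refine Diagram.cls_of_legs (n := n + 1) (G := D.graph) ?_
    have a1 : (D.legs i).filter (· ∈ (D.legs i).toFinset) = D.legs i := by simp
    have a2 : (D.legs i).filter (· ∉ (D.legs i).toFinset) = [] := by simp
    rw [Diagram.splitLegs, a1, a2, ← insertNth_succ_update, Function.update_eq_self]
  have e1 : i.castSucc = i.succ.succAbove i := by simp
  rw [e, addString_eq_op, power_op, op_op, power]
  refine LinearMap.congr_fun (op_congr fun j => ?_) D.cls
  by_cases h : j = i
  · subst h
    simp only [Function.update_self, map_mul, FreeMonoid.lift_eval_of]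
    rw [Fin.succAbove_castSucc_self, Function.update_of_ne Fin.castSucc_lt_succ.ne',
      Fin.insertNth_apply_same, mul_one]
    congr 1
    conv_lhs => rw [e1]
    rw [Fin.insertNth_apply_succAbove]
  · have e2 : i.castSucc.succAbove j = i.succ.succAbove j := by
      rcases lt_or_gt_of_ne h with h | h
      · rw [Fin.succAbove_castSucc_of_lt _ _ h, Fin.succAbove_succ_of_le _ _ h.le]
      · rw [Fin.succAbove_castSucc_of_le _ _ h.le, Fin.succAbove_succ_of_lt _ _ h]
    rw [Function.update_of_ne h, Function.update_of_ne h, FreeMonoid.lift_eval_of,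
      Function.update_of_ne (Fin.succAbove_ne _ _), e2, Fin.insertNth_apply_succAbove]

/-- By `power_coproduct` and `op_split_univ`, the difference of two consecutive powers is a sum over
proper subsets of the legs. There the left copy has fewer legs, so induction applies, with one more
string; hence `n` varies. Summing the differences raises the degree by one. -/
theorem power_cls_choose (κ : ℕ) : ∀ {n : ℕ} (D : Diagram n) (i : Fin n), (D.legs i).length = κ →
    ∃ g : ℕ → P n, ∀ a, power i a D.cls
      = ∑ t ∈ Finset.range (κ + 1), (a.choose t : ℚ) • g t := by
  classical
  induction κ using Nat.strong_induction_on with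
  | _ κ ih =>
    intro n D i hκ
    set L := (D.legs i).toFinset with hL
    set μ : P (n + 1) →ₗ[ℚ] P n :=
      op (Function.update (fun j => FreeMonoid.of (i.castSucc.succAbove j)) i
        (FreeMonoid.of i.castSucc * FreeMonoid.of (i.castSucc.succAbove i))) with hμ
    have key : ∀ A ∈ L.powerset.erase L, ∃ g : ℕ → P (n + 1), ∀ a,
        power i.castSucc a (D.split i A).cls
          = ∑ t ∈ Finset.range κ, (a.choose t : ℚ) • g t := by
      intro A hA
      obtain ⟨h1, h2⟩ := Finset.mem_erase.1 hA
      rw [Finset.mem_powerset] at h2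
      have e : (D.split i A).legs i.castSucc = (D.legs i).filter (· ∈ A) :=
        Fin.insertNth_apply_same (α := fun _ => List D.graph.Flag) _ _ _
      have hlt : ((D.split i A).legs i.castSucc).length < κ := by
        refine (congrArg List.length e).trans_lt ?_
        rw [← hκ]
        refine List.length_filter_lt_length_iff_exists.2 ?_
        obtain ⟨x, hx, hxA⟩ := Finset.exists_of_ssubset (h2.ssubset_of_ne h1)
        exact ⟨x, List.mem_toFinset.1 hx, by simpa using hxA⟩
      obtain ⟨g, hg⟩ := ih _ hlt (D.split i A) i.castSucc rfl
      -- The coefficients are padded by zero to a length not depending on `A`.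
      refine ⟨fun t => if t ∈ Finset.range (((D.split i A).legs i.castSucc).length + 1)
        then g t else 0, fun a => ?_⟩
      rw [hg]
      refine Finset.sum_subset_zero_on_sdiff (fun t ht => ?_) (fun t ht => ?_) (fun t ht => ?_)
      · rw [Finset.mem_range] at ht ⊢; omega
      · dsimp only
        rw [if_neg (Finset.mem_sdiff.1 ht).2, smul_zero]
      · dsimp only
        rw [if_pos ht]
    choose! g hg using key
    have hstep : ∀ a, power i (a + 1) D.cls = power i a D.cls
        + ∑ t ∈ Finset.range κ, (a.choose t : ℚ) • ∑ A ∈ L.powerset.erase L, μ (g A t) := by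
      intro a
      rw [power_coproduct, coproduct_cls, Diagram.coproduct, subsetSum, map_sum, map_sum, ← hL,
        ← Finset.add_sum_erase _ _ (Finset.mem_powerset_self L), hL, op_split_univ]
      congr 1
      simp only [Finset.smul_sum]
      rw [Finset.sum_comm]
      refine Finset.sum_congr rfl fun A hA => ?_
      rw [hg A hA, map_sum]
      exact Finset.sum_congr rfl fun t _ => map_smul _ _ _
    refine ⟨fun t => t.casesOn (power i 0 D.cls) fun t => ∑ A ∈ L.powerset.erase L, μ (g A t),
      fun a => ?_⟩
    rw [eq_add_sum_choose κ (fun a => power i a D.cls) _ hstep a, Finset.sum_range_succ']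
    simp [add_comm]

/-- The binomials are rewritten as polynomials in `a`. The zeroth power deletes the only letter `i`,
so the constant term vanishes if the string carries a leg. -/
theorem power_cls (D : Diagram n) (i : Fin n) : ∃ g : ℕ → P n,
    (D.legs i ≠ [] → g 0 = 0) ∧ ∀ a, power i a D.cls
      = ∑ t ∈ Finset.range ((D.legs i).length + 1), (a : ℚ) ^ t • g t := by
  obtain ⟨g, hg⟩ := power_cls_choose _ D i rfl
  choose c hc using exists_choose_eq
  set κ := (D.legs i).length
  have h : ∀ a, power i a D.cls = ∑ s ∈ Finset.range (κ + 1),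
      (a : ℚ) ^ s • ∑ t ∈ Finset.range (κ + 1), (if s ≤ t then c t s else 0) • g t := by
    intro a
    rw [hg]
    simp only [Finset.smul_sum, smul_smul]
    rw [Finset.sum_comm]
    refine Finset.sum_congr rfl fun t ht => ?_
    rw [← Finset.sum_smul, hc]
    congr 1
    rw [Finset.mem_range] at ht
    refine Finset.sum_subset_zero_on_sdiff (fun s hs => ?_) (fun s hs => ?_) (fun s hs => ?_)
    · rw [Finset.mem_range] at hs ⊢; omega
    · have := (Finset.mem_sdiff.1 hs).2
      rw [Finset.mem_range] at this
      rw [if_neg (by omega), mul_zero]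
    · rw [Finset.mem_range] at hs
      rw [if_pos (by omega), mul_comm]
  refine ⟨_, fun hne => ?_, h⟩
  have h0 := h 0
  rw [power, op_cls_eq_zero _ D i hne, Finset.sum_eq_single 0] at h0
  · simpa using h0.symm
  · intro s _ hs
    simp [hs]
  · simp
  · intro j
    by_cases hj : j = i
    · subst hj; simp [FreeMonoid.notMem_one]
    · rw [Function.update_of_ne hj, FreeMonoid.mem_of]; exact Ne.symm hj

/-! ### Decomposition into weights -/

/-- `u` is homogeneous of weight `s i` on the `i`-th string, for every `i`. -/
def IsWeight (s : Fin n → ℕ) (u : P n) : Prop :=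
  ∀ (i : Fin n) (a : ℕ), power i a u = (a : ℚ) ^ s i • u

/-- The powers of the `i`-th string of `u` depend polynomially on the exponent, with degree at most
`κ`, and without constant term if `κ` is positive. -/
def PolynomialPowers (κ : ℕ) (i : Fin n) (u : P n) : Prop :=
  ∃ g : ℕ → P n, (κ ≠ 0 → g 0 = 0) ∧
    ∀ a, power i a u = ∑ t ∈ Finset.range (κ + 1), (a : ℚ) ^ t • g t

theorem PolynomialPowers.map {κ : ℕ} {i : Fin n} {u : P n} (h : PolynomialPowers κ i u)
    (T : P n →ₗ[ℚ] P n) (hT : ∀ a z, power i a (T z) = T (power i a z)) :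
    PolynomialPowers κ i (T u) := by
  obtain ⟨g, h0, hg⟩ := h
  refine ⟨fun t => T (g t), fun hκ => (congrArg T (h0 hκ)).trans (map_zero T), fun a => ?_⟩
  rw [hT, hg, map_sum]
  exact Finset.sum_congr rfl fun t _ => map_smul _ _ _

/-- Average of the powers of the `i`-th string with the given coefficients. -/
def powerAverage (c : ℕ → ℚ) (K : ℕ) (i : Fin n) : P n →ₗ[ℚ] P n :=
  ∑ b ∈ Finset.range (K + 1), c b • power i b

theorem powerAverage_apply (c : ℕ → ℚ) (K : ℕ) (i : Fin n) (z : P n) :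
    powerAverage c K i z = ∑ b ∈ Finset.range (K + 1), c b • power i b z := by
  simp [powerAverage, LinearMap.sum_apply]

theorem power_powerAverage (c : ℕ → ℚ) (K : ℕ) (i j : Fin n) (a : ℕ) (z : P n) :
    power j a (powerAverage c K i z) = powerAverage c K i (power j a z) := by
  simp only [powerAverage_apply, map_sum, map_smul, power_comm j i]

/-- The strings are treated one at a time. The coefficients in the powers of the `j`-th string are
averages of those powers, hence commute with powers of the other strings and inherit what is already
known. -/
theorem mem_span_weights_on (κ : Fin n → ℕ) (F : Finset (Fin n)) {z : P n}
    (hz : ∀ i, PolynomialPowers (κ i) i z) :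
    z ∈ Submodule.span ℚ {u : P n | (∀ i, PolynomialPowers (κ i) i u) ∧
      ∃ s : Fin n → ℕ, ∀ i ∈ F, s i ≤ κ i ∧ (κ i ≠ 0 → s i ≠ 0) ∧
        ∀ a : ℕ, power i a u = (a : ℚ) ^ s i • u} := by
  classical
  induction F using Finset.induction_on with
  | empty => exact Submodule.subset_span ⟨hz, 0, by simp⟩
  | insert j F _ ih =>
    refine Submodule.span_le.2 ?_ ih
    rintro u ⟨hu, s, hs⟩
    obtain ⟨g, h0, hg⟩ := hu j
    have h1 : u = ∑ t ∈ Finset.range (κ j + 1), g t := by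
      have := hg 1
      simpa [power_one] using this
    rw [h1]
    refine Submodule.sum_mem _ fun t ht => ?_
    have ht' : t ≤ κ j := Nat.lt_succ_iff.1 (Finset.mem_range.1 ht)
    obtain ⟨c, hc, -⟩ := exists_weights (κ j) t
    -- Powers multiply exponents, so the average sees the polynomial at `a * b`, and extracting the
    -- coefficient of `b ^ t` leaves `a ^ t`.
    have avg : ∀ a : ℕ, powerAverage c (κ j) j (power j a u) = (a : ℚ) ^ t • g t := by
      intro a
      simp only [powerAverage_apply, power_power]
      simp only [hg, Finset.smul_sum, smul_smul]
      rw [Finset.sum_comm, Finset.sum_eq_single t]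
      · rw [← Finset.sum_smul]
        have := hc t ht'
        rw [if_pos rfl] at this
        rw [← mul_one ((a : ℚ) ^ t), ← this, Finset.mul_sum]
        congr 1
        refine Finset.sum_congr rfl fun b _ => ?_
        push_cast
        ring
      · intro s hs hst
        rw [← Finset.sum_smul]
        have := hc s (Nat.lt_succ_iff.1 (Finset.mem_range.1 hs))
        rw [if_neg hst] at this
        have e : ∑ b ∈ Finset.range (κ j + 1), c b * ((a * b : ℕ) : ℚ) ^ s = 0 := by
          rw [← mul_zero ((a : ℚ) ^ s), ← this, Finset.mul_sum]
          refine Finset.sum_congr rfl fun b _ => ?_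
          push_cast
          ring
        rw [e, zero_smul]
      · exact fun h => absurd ht h
    have ht1 : g t = powerAverage c (κ j) j u := by
      have := avg 1
      rw [power_one] at this
      rw [this]; simp
    by_cases hz0 : κ j ≠ 0 ∧ t = 0
    · rw [hz0.2, h0 hz0.1]; exact zero_mem _
    · refine Submodule.subset_span ⟨fun i => ?_, Function.update s j t, fun i hi => ?_⟩
      · rw [ht1]
        exact (hu i).map _ fun a z => power_powerAverage c _ j i a z
      · by_cases hij : i = j
        · subst hij
          rw [Function.update_self]
          refine ⟨ht', fun hk h => hz0 ⟨hk, h⟩, fun a => ?_⟩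
          rw [← avg, ht1, power_powerAverage]
        · rw [Function.update_of_ne hij]
          obtain ⟨h2, h3, h4⟩ := hs i ((Finset.mem_insert.1 hi).resolve_left hij)
          refine ⟨h2, h3, fun a => ?_⟩
          rw [ht1, power_powerAverage, h4, map_smul]

theorem Diagram.cls_mem_span_weights (D : Diagram n) :
    D.cls ∈ Submodule.span ℚ {u : P n | ∃ s : Fin n → ℕ, IsWeight s u ∧
      ∀ i, s i ≤ (D.legs i).length ∧ (D.legs i ≠ [] → s i ≠ 0)} := by
  refine Submodule.span_mono ?_ (mem_span_weights_on (fun i => (D.legs i).length) Finset.univ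
    fun i => ?_)
  · rintro u ⟨-, s, hs⟩
    refine ⟨s, fun i a => (hs i (Finset.mem_univ i)).2.2 a, fun i => ?_⟩
    obtain ⟨h1, h2, -⟩ := hs i (Finset.mem_univ i)
    exact ⟨h1, fun h => h2 (by rwa [Ne, List.length_eq_zero_iff])⟩
  · obtain ⟨g, h0, hg⟩ := power_cls D i
    exact ⟨g, fun h => h0 (by rwa [Ne, List.length_eq_zero_iff] at h), hg⟩

theorem mem_span_weights (z : P n) :
    z ∈ Submodule.span ℚ {u : P n | ∃ s : Fin n → ℕ, IsWeight s u} := by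
  have key : (⊤ : Submodule ℚ (P n)) ≤ Submodule.span ℚ {u : P n | ∃ s, IsWeight s u} := by
    intro z _
    obtain ⟨f, rfl⟩ := Submodule.Quotient.mk_surjective _ z
    induction f using Finsupp.induction_linear with
    | zero => exact zero_mem _
    | add f g hf hg => exact add_mem (hf trivial) (hg trivial)
    | single D a =>
      have : (Submodule.Quotient.mk (Finsupp.single D a) : P n) = a • D.cls := by
        rw [Diagram.cls, ← Submodule.Quotient.mk_smul, Finsupp.smul_single, smul_eq_mul, mul_one]
      rw [this]
      refine Submodule.smul_mem _ _ (Submodule.span_mono ?_ D.cls_mem_span_weights)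
      rintro u ⟨s, hs, -⟩
      exact ⟨s, hs⟩
  exact key trivial

/-! ### Primitive strings -/

/-- Homogeneity of weight one under simultaneous powers of two strings. -/
theorem eq_add_of_power_power {i j : Fin n} {v : P n}
    (h : ∀ c : ℕ, power i c (power j c v) = (c : ℚ) • v) : v = power i 0 v + power j 0 v := by
  let T : (ℕ → ℚ) → ℕ → P n →ₗ[ℚ] P n := fun e K =>
    ∑ c ∈ Finset.range (K + 1), e c • (power i c ∘ₗ power j c)
  -- The bound on the weights occurring in `v` is not known beforehand, so `K₀` depends on `v`; `T e
  -- K` projects to total weight one on the strings `i` and `j`.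
  have key : ∀ v : P n, ∃ K₀, ∀ K ≥ K₀, ∀ e : ℕ → ℚ,
      (∀ s ≤ K, ∑ b ∈ Finset.range (K + 1), e b * (b : ℚ) ^ s = if s = 1 then 1 else 0) →
      T e K v = power i 0 (T e K v) + power j 0 (T e K v) := by
    intro v
    induction mem_span_weights v using Submodule.span_induction with
    | zero => exact ⟨0, fun K _ e _ => by simp⟩
    | add x y _ _ hx hy =>
      obtain ⟨K₁, h1⟩ := hx
      obtain ⟨K₂, h2⟩ := hy
      refine ⟨max K₁ K₂, fun K hK e he => ?_⟩
      have e1 := h1 K (le_trans (le_max_left _ _) hK) e he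
      have e2 := h2 K (le_trans (le_max_right _ _) hK) e he
      simp only [map_add]
      exact (congrArg₂ (· + ·) e1 e2).trans (add_add_add_comm _ _ _ _)
    | smul a x _ hx =>
      obtain ⟨K₁, h1⟩ := hx
      refine ⟨K₁, fun K hK e he => ?_⟩
      have e1 := h1 K hK e he
      simp only [map_smul]
      rw [← smul_add, ← e1]
    | mem u hu =>
      obtain ⟨s, hs⟩ := hu
      refine ⟨s i + s j, fun K hK e he => ?_⟩
      have e1 : T e K u = (if s i + s j = 1 then (1 : ℚ) else 0) • u := by
        rw [← he _ hK, Finset.sum_smul]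
        simp only [T, LinearMap.sum_apply, LinearMap.smul_apply, LinearMap.comp_apply, hs j,
          map_smul, hs i, smul_smul]
        refine Finset.sum_congr rfl fun c _ => ?_
        congr 1
        rw [pow_add]; ring
      rw [e1]
      -- One of the two weights is zero and the other is one, and the zeroth power of a string keeps
      -- exactly weight zero on it.
      by_cases h1 : s i + s j = 1
      · rw [if_pos h1, one_smul, hs i, hs j]
        have : (s i = 0 ∧ s j = 1) ∨ (s i = 1 ∧ s j = 0) := by omega
        rcases this with ⟨h2, h3⟩ | ⟨h2, h3⟩ <;> simp [h2, h3]
      · simp [if_neg h1]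
  obtain ⟨K₀, hK⟩ := key v
  obtain ⟨e, he, -⟩ := exists_weights (K₀ + 1) 1
  have h1 : T e (K₀ + 1) v = v := by
    have h2 := he 1 (by omega)
    rw [if_pos rfl] at h2
    conv_rhs => rw [← one_smul ℚ v, ← h2, Finset.sum_smul]
    simp only [T, LinearMap.sum_apply, LinearMap.smul_apply, LinearMap.comp_apply, h, smul_smul,
      pow_one]
  have := hK (K₀ + 1) (by omega) e he
  rwa [h1] at this

/-- The `i`-th string of `u` is primitive. -/
def IsPrimitive (i : Fin n) (u : P n) : Prop := ∀ a : ℕ, power i a u = (a : ℚ) • u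

/-- `Δ_i` turns powers of the `i`-th string into simultaneous powers of its two copies, so `Δ_i u`
has total weight one on them. It is the sum of its zeroth powers on either copy, and emptying a copy
of a doubled string amounts to inserting an empty one. -/
theorem coproduct_of_isPrimitive {i : Fin n} {u : P n} (h : IsPrimitive i u) :
    coproduct i u = addString i.castSucc u + addString i.succ u := by
  have e1 : ∀ j, Fin.insertNth (α := fun _ => FreeMonoid (Fin n)) i.castSucc (FreeMonoid.of i)
      FreeMonoid.of (i.castSucc.succAbove j) = FreeMonoid.of j := fun j =>
    Fin.insertNth_apply_succAbove (α := fun _ => FreeMonoid (Fin n)) _ _ _ j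
  have e2 := e1 i
  rw [Fin.succAbove_castSucc_self] at e2
  have e3 : Fin.insertNth (α := fun _ => FreeMonoid (Fin n)) i.castSucc (FreeMonoid.of i)
      FreeMonoid.of i.castSucc = FreeMonoid.of i :=
    Fin.insertNth_apply_same (α := fun _ => FreeMonoid (Fin n)) _ _ _
  have split : ∀ j : Fin (n + 1), j = i.castSucc ∨ j = i.succ ∨
      ∃ q, q ≠ i ∧ j = i.castSucc.succAbove q := by
    intro j
    refine Fin.succAboveCases i.castSucc (Or.inl rfl) (fun q => ?_) j
    by_cases hq : q = i
    · subst hq; exact Or.inr (Or.inl (Fin.succAbove_castSucc_self _))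
    · exact Or.inr (Or.inr ⟨q, hq, rfl⟩)
  have a2 : ∀ q, q ≠ i → i.castSucc.succAbove q ≠ i.succ := by
    intro q hq h'
    rw [← Fin.succAbove_castSucc_self] at h'
    exact hq (Fin.succAbove_right_injective h')
  have ne : i.succ ≠ i.castSucc := Fin.castSucc_lt_succ.ne'
  have key : ∀ c : ℕ, power i.castSucc c (power i.succ c (coproduct i u))
      = (c : ℚ) • coproduct i u := by
    intro c
    rw [← map_smul, ← h c, coproduct_eq_op, coproduct_eq_op, power_op, power_op, power, op_op]
    refine LinearMap.congr_fun (op_congr fun j => ?_) u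
    obtain rfl | rfl | ⟨q, hq, rfl⟩ := split j
    · rw [Function.update_self, Function.update_of_ne ne.symm, e3, FreeMonoid.lift_eval_of,
        Function.update_self]
    · rw [Function.update_of_ne ne, Function.update_self, e2, FreeMonoid.lift_eval_of,
        Function.update_self]
    · rw [Function.update_of_ne (Fin.succAbove_ne _ _), Function.update_of_ne (a2 q hq), e1,
        FreeMonoid.lift_eval_of, Function.update_of_ne hq]
  have p0 : power i.castSucc 0 (coproduct i u) = addString i.castSucc u := by
    rw [addString_eq_op, coproduct_eq_op, power_op]
    refine LinearMap.congr_fun (op_congr fun j => ?_) u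
    refine Fin.succAboveCases i.castSucc ?_ (fun q => ?_) j
    · rw [Function.update_self, pow_zero]
      exact (Fin.insertNth_apply_same (α := fun _ => FreeMonoid (Fin n)) _ _ _).symm
    · rw [Function.update_of_ne (Fin.succAbove_ne _ _), e1, Fin.insertNth_apply_succAbove]
  have p1 : power i.succ 0 (coproduct i u) = addString i.succ u := by
    rw [addString_eq_op, coproduct_eq_op, power_op]
    refine LinearMap.congr_fun (op_congr fun j => ?_) u
    have e4 : i.castSucc = i.succ.succAbove i := by simp
    obtain rfl | rfl | ⟨q, hq, rfl⟩ := split j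
    · rw [Function.update_of_ne ne.symm, e3]
      conv_rhs => rw [e4]
      rw [Fin.insertNth_apply_succAbove]
    · rw [Function.update_self, Fin.insertNth_apply_same, pow_zero]
    · have e5 : i.castSucc.succAbove q = i.succ.succAbove q := by
        rcases lt_or_gt_of_ne hq with h | h
        · rw [Fin.succAbove_castSucc_of_lt _ _ h, Fin.succAbove_succ_of_le _ _ h.le]
        · rw [Fin.succAbove_castSucc_of_le _ _ h.le, Fin.succAbove_succ_of_lt _ _ h]
      rw [Function.update_of_ne (a2 q hq), e1, e5, Fin.insertNth_apply_succAbove]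
  exact (eq_add_of_power_power key).trans (congrArg₂ (· + ·) p0 p1)

/-! ### Explicit words for three, four and five strings -/

section explicit

open FreeMonoid (of)

/-- `op` with target three strings, the words written out. -/
def op3 (a b c : FreeMonoid (Fin n)) : P n →ₗ[ℚ] P 3 := op ![a, b, c]

/-- `op` with target four strings, the words written out. -/
def op4 (a b c d : FreeMonoid (Fin n)) : P n →ₗ[ℚ] P 4 := op ![a, b, c, d]

/-- `op` with target five strings, the words written out. -/
def op5 (a b c d e : FreeMonoid (Fin n)) : P n →ₗ[ℚ] P 5 := op ![a, b, c, d, e]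

theorem op_eq_op3 (w : Fin 3 → FreeMonoid (Fin n)) : op w = op3 (w 0) (w 1) (w 2) :=
  op_congr fun a => by fin_cases a <;> rfl

theorem op_eq_op4 (w : Fin 4 → FreeMonoid (Fin n)) : op w = op4 (w 0) (w 1) (w 2) (w 3) :=
  op_congr fun a => by fin_cases a <;> rfl

theorem op_eq_op5 (w : Fin 5 → FreeMonoid (Fin n)) :
    op w = op5 (w 0) (w 1) (w 2) (w 3) (w 4) :=
  op_congr fun a => by fin_cases a <;> rfl

theorem op4_of (z : P 4) : op4 (of 0) (of 1) (of 2) (of 3) z = z := by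
  rw [← op_eq_op4 of, op_of]

theorem op3_op (a b c : FreeMonoid (Fin k)) (w : Fin k → FreeMonoid (Fin n)) (z : P n) :
    op3 a b c (op w z)
      = op3 (FreeMonoid.lift w a) (FreeMonoid.lift w b) (FreeMonoid.lift w c) z := by
  rw [op3, op_op, op_eq_op3]; rfl

theorem op4_op (a b c d : FreeMonoid (Fin k)) (w : Fin k → FreeMonoid (Fin n)) (z : P n) :
    op4 a b c d (op w z) = op4 (FreeMonoid.lift w a) (FreeMonoid.lift w b)
      (FreeMonoid.lift w c) (FreeMonoid.lift w d) z := by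
  rw [op4, op_op, op_eq_op4]; rfl

theorem op5_op (a b c d e : FreeMonoid (Fin k)) (w : Fin k → FreeMonoid (Fin n)) (z : P n) :
    op5 a b c d e (op w z) = op5 (FreeMonoid.lift w a) (FreeMonoid.lift w b)
      (FreeMonoid.lift w c) (FreeMonoid.lift w d) (FreeMonoid.lift w e) z := by
  rw [op5, op_op, op_eq_op5]; rfl

theorem differential_three (z : P 3) : differential 3 z
    = op4 1 (of 0) (of 1) (of 2) z - op4 (of 0) (of 0) (of 1) (of 2) z
      + op4 (of 0) (of 1) (of 1) (of 2) z - op4 (of 0) (of 1) (of 2) (of 2) z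
      + op4 (of 0) (of 1) (of 2) 1 z := by
  simp only [differential, LinearMap.add_apply, LinearMap.sum_apply, LinearMap.smul_apply,
    addString_eq_op, coproduct_eq_op, op_eq_op4, Fin.sum_univ_succ]
  norm_num
  abel

theorem differential_four (z : P 4) : differential 4 z
    = op5 1 (of 0) (of 1) (of 2) (of 3) z - op5 (of 0) (of 0) (of 1) (of 2) (of 3) z
      + op5 (of 0) (of 1) (of 1) (of 2) (of 3) z - op5 (of 0) (of 1) (of 2) (of 2) (of 3) z
      + op5 (of 0) (of 1) (of 2) (of 3) (of 3) z - op5 (of 0) (of 1) (of 2) (of 3) 1 z := by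
  simp only [differential, LinearMap.add_apply, LinearMap.sum_apply, LinearMap.smul_apply,
    addString_eq_op, coproduct_eq_op, op_eq_op5, Fin.sum_univ_succ]
  norm_num
  abel

end explicit

/-! ### The sliding homotopies -/

/-- Multiply the `j`-th string from the left by the `a`-th power of the `i`-th one, which is
removed. -/
def slide (i j : Fin (k + 1)) (a : ℕ) : P (k + 1) →ₗ[ℚ] P k :=
  op fun q => if i.succAbove q = j then FreeMonoid.of i ^ a * FreeMonoid.of j
    else FreeMonoid.of (i.succAbove q)

/-- The alternating sum of the `slide i j a` with `r ≤ j < i`. -/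
def homotopy (k r a : ℕ) : P (k + 1) →ₗ[ℚ] P k :=
  ∑ i : Fin (k + 1), (-1 : ℚ) ^ i.val •
    ∑ j : Fin (k + 1), if r ≤ j.val ∧ j.val < i.val then slide i j a else 0

open FreeMonoid (of)

theorem slide_1_0_of_4 (a : ℕ) (z : P 4) : slide 1 0 a z
    = op3 (of 1 ^ a * of 0) (of 2) (of 3) z := by
  rw [slide, op_eq_op3]; rfl

theorem slide_2_0_of_4 (a : ℕ) (z : P 4) : slide 2 0 a z
    = op3 (of 2 ^ a * of 0) (of 1) (of 3) z := by
  rw [slide, op_eq_op3]; rfl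

theorem slide_2_1_of_4 (a : ℕ) (z : P 4) : slide 2 1 a z
    = op3 (of 0) (of 2 ^ a * of 1) (of 3) z := by
  rw [slide, op_eq_op3]; rfl

theorem slide_3_0_of_4 (a : ℕ) (z : P 4) : slide 3 0 a z
    = op3 (of 3 ^ a * of 0) (of 1) (of 2) z := by
  rw [slide, op_eq_op3]; rfl

theorem slide_3_1_of_4 (a : ℕ) (z : P 4) : slide 3 1 a z
    = op3 (of 0) (of 3 ^ a * of 1) (of 2) z := by
  rw [slide, op_eq_op3]; rfl

theorem slide_3_2_of_4 (a : ℕ) (z : P 4) : slide 3 2 a z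
    = op3 (of 0) (of 1) (of 3 ^ a * of 2) z := by
  rw [slide, op_eq_op3]; rfl

theorem slide_1_0_of_5 (a : ℕ) (z : P 5) : slide 1 0 a z
    = op4 (of 1 ^ a * of 0) (of 2) (of 3) (of 4) z := by
  rw [slide, op_eq_op4]; rfl

theorem slide_2_0_of_5 (a : ℕ) (z : P 5) : slide 2 0 a z
    = op4 (of 2 ^ a * of 0) (of 1) (of 3) (of 4) z := by
  rw [slide, op_eq_op4]; rfl

theorem slide_2_1_of_5 (a : ℕ) (z : P 5) : slide 2 1 a z
    = op4 (of 0) (of 2 ^ a * of 1) (of 3) (of 4) z := by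
  rw [slide, op_eq_op4]; rfl

theorem slide_3_0_of_5 (a : ℕ) (z : P 5) : slide 3 0 a z
    = op4 (of 3 ^ a * of 0) (of 1) (of 2) (of 4) z := by
  rw [slide, op_eq_op4]; rfl

theorem slide_3_1_of_5 (a : ℕ) (z : P 5) : slide 3 1 a z
    = op4 (of 0) (of 3 ^ a * of 1) (of 2) (of 4) z := by
  rw [slide, op_eq_op4]; rfl

theorem slide_3_2_of_5 (a : ℕ) (z : P 5) : slide 3 2 a z
    = op4 (of 0) (of 1) (of 3 ^ a * of 2) (of 4) z := by
  rw [slide, op_eq_op4]; rfl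

theorem slide_4_0_of_5 (a : ℕ) (z : P 5) : slide 4 0 a z
    = op4 (of 4 ^ a * of 0) (of 1) (of 2) (of 3) z := by
  rw [slide, op_eq_op4]; rfl

theorem slide_4_1_of_5 (a : ℕ) (z : P 5) : slide 4 1 a z
    = op4 (of 0) (of 4 ^ a * of 1) (of 2) (of 3) z := by
  rw [slide, op_eq_op4]; rfl

theorem slide_4_2_of_5 (a : ℕ) (z : P 5) : slide 4 2 a z
    = op4 (of 0) (of 1) (of 4 ^ a * of 2) (of 3) z := by
  rw [slide, op_eq_op4]; rfl

theorem slide_4_3_of_5 (a : ℕ) (z : P 5) : slide 4 3 a z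
    = op4 (of 0) (of 1) (of 2) (of 4 ^ a * of 3) z := by
  rw [slide, op_eq_op4]; rfl

theorem homotopy_three_zero (a : ℕ) (z : P 4) : homotopy 3 0 a z
    = -slide 1 0 a z + slide 2 0 a z + slide 2 1 a z - slide 3 0 a z - slide 3 1 a z - slide 3 2 a
        z := by
  simp [homotopy, Fin.sum_univ_four]
  module

theorem homotopy_three_one (a : ℕ) (z : P 4) : homotopy 3 1 a z
    = slide 2 1 a z - slide 3 1 a z - slide 3 2 a z := by
  simp [homotopy, Fin.sum_univ_four]
  module

theorem homotopy_three_two (a : ℕ) (z : P 4) : homotopy 3 2 a z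
    = -slide 3 2 a z := by
  simp [homotopy, Fin.sum_univ_four]
  module

theorem homotopy_four_zero (a : ℕ) (z : P 5) : homotopy 4 0 a z
    = -slide 1 0 a z + slide 2 0 a z + slide 2 1 a z - slide 3 0 a z - slide 3 1 a z - slide 3 2 a
        z + slide 4 0 a z + slide 4 1 a z + slide 4 2 a z + slide 4 3 a z := by
  simp [homotopy, Fin.sum_univ_five]
  module

theorem homotopy_four_one (a : ℕ) (z : P 5) : homotopy 4 1 a z
    = slide 2 1 a z - slide 3 1 a z - slide 3 2 a z + slide 4 1 a z + slide 4 2 a z + slide 4 3 a z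
        := by
  simp [homotopy, Fin.sum_univ_five]
  module

theorem homotopy_four_two (a : ℕ) (z : P 5) : homotopy 4 2 a z
    = -slide 3 2 a z + slide 4 2 a z + slide 4 3 a z := by
  simp [homotopy, Fin.sum_univ_five]
  module

theorem homotopy_four_three (a : ℕ) (z : P 5) : homotopy 4 3 a z
    = slide 4 3 a z := by
  simp [homotopy, Fin.sum_univ_five]
  module

theorem op3_op3 (A B C : FreeMonoid (Fin 3)) (a b c : FreeMonoid (Fin n)) (z : P n) :
    op3 A B C (op3 a b c z) = op3 (FreeMonoid.lift ![a, b, c] A) (FreeMonoid.lift ![a, b, c] B)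
        (FreeMonoid.lift ![a, b, c] C) z :=
  op3_op _ _ _ _ z

theorem op3_op4 (A B C : FreeMonoid (Fin 4)) (a b c d : FreeMonoid (Fin n)) (z : P n) :
    op3 A B C (op4 a b c d z) = op3 (FreeMonoid.lift ![a, b, c, d] A) (FreeMonoid.lift ![a, b, c,
        d] B) (FreeMonoid.lift ![a, b, c, d] C) z :=
  op3_op _ _ _ _ z

theorem op4_op3 (A B C D : FreeMonoid (Fin 3)) (a b c : FreeMonoid (Fin n)) (z : P n) :
    op4 A B C D (op3 a b c z) = op4 (FreeMonoid.lift ![a, b, c] A) (FreeMonoid.lift ![a, b, c] B)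
        (FreeMonoid.lift ![a, b, c] C) (FreeMonoid.lift ![a, b, c] D) z :=
  op4_op _ _ _ _ _ z

theorem op4_op4 (A B C D : FreeMonoid (Fin 4)) (a b c d : FreeMonoid (Fin n)) (z : P n) :
    op4 A B C D (op4 a b c d z) = op4 (FreeMonoid.lift ![a, b, c, d] A) (FreeMonoid.lift ![a, b, c,
        d] B) (FreeMonoid.lift ![a, b, c, d] C) (FreeMonoid.lift ![a, b, c, d] D) z :=
  op4_op _ _ _ _ _ z

theorem op4_op5 (A B C D : FreeMonoid (Fin 5)) (a b c d e : FreeMonoid (Fin n)) (z : P n) :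
    op4 A B C D (op5 a b c d e z) = op4 (FreeMonoid.lift ![a, b, c, d, e] A) (FreeMonoid.lift ![a,
        b, c, d, e] B) (FreeMonoid.lift ![a, b, c, d, e] C) (FreeMonoid.lift ![a, b, c, d, e] D) z
        :=
  op4_op _ _ _ _ _ z

theorem op5_op4 (A B C D E : FreeMonoid (Fin 4)) (a b c d : FreeMonoid (Fin n)) (z : P n) :
    op5 A B C D E (op4 a b c d z) = op5 (FreeMonoid.lift ![a, b, c, d] A) (FreeMonoid.lift ![a, b,
        c, d] B) (FreeMonoid.lift ![a, b, c, d] C) (FreeMonoid.lift ![a, b, c, d] D)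
        (FreeMonoid.lift ![a, b, c, d] E) z :=
  op5_op _ _ _ _ _ _ z

theorem power_0_of_3 (a : ℕ) (z : P 3) : power 0 a z = op3 (of 0 ^ a) (of 1) (of 2) z := by
  rw [power, op_eq_op3]; rfl

theorem power_1_of_3 (a : ℕ) (z : P 3) : power 1 a z = op3 (of 0) (of 1 ^ a) (of 2) z := by
  rw [power, op_eq_op3]; rfl

theorem power_0_of_4 (a : ℕ) (z : P 4) : power 0 a z = op4 (of 0 ^ a) (of 1) (of 2) (of 3) z := by
  rw [power, op_eq_op4]; rfl

theorem power_1_of_4 (a : ℕ) (z : P 4) : power 1 a z = op4 (of 0) (of 1 ^ a) (of 2) (of 3) z := by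
  rw [power, op_eq_op4]; rfl

theorem power_2_of_4 (a : ℕ) (z : P 4) : power 2 a z = op4 (of 0) (of 1) (of 2 ^ a) (of 3) z := by
  rw [power, op_eq_op4]; rfl

theorem power_3_of_4 (a : ℕ) (z : P 4) : power 3 a z = op4 (of 0) (of 1) (of 2) (of 3 ^ a) z := by
  rw [power, op_eq_op4]; rfl

/-! ### Defects, rotations and the homotopy identities -/

/-- The failure of the `i`-th string to be primitive. -/
def defect (i : Fin n) : P n →ₗ[ℚ] P (n + 1) :=
  coproduct i - (addString i.castSucc + addString i.succ)

theorem defect_0_of_3 (z : P 3) : defect 0 z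
    = op4 (of 0) (of 0) (of 1) (of 2) z - (op4 1 (of 0) (of 1) (of 2) z
      + op4 (of 0) 1 (of 1) (of 2) z) := by
  rw [defect, LinearMap.sub_apply, LinearMap.add_apply, coproduct_eq_op, addString_eq_op,
      addString_eq_op, op_eq_op4, op_eq_op4,
    op_eq_op4]
  rfl

theorem defect_1_of_3 (z : P 3) : defect 1 z
    = op4 (of 0) (of 1) (of 1) (of 2) z - (op4 (of 0) 1 (of 1) (of 2) z
      + op4 (of 0) (of 1) 1 (of 2) z) := by
  rw [defect, LinearMap.sub_apply, LinearMap.add_apply, coproduct_eq_op, addString_eq_op,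
      addString_eq_op, op_eq_op4, op_eq_op4,
    op_eq_op4]
  rfl

theorem defect_0_of_4 (z : P 4) : defect 0 z
    = op5 (of 0) (of 0) (of 1) (of 2) (of 3) z - (op5 1 (of 0) (of 1) (of 2) (of 3) z
      + op5 (of 0) 1 (of 1) (of 2) (of 3) z) := by
  rw [defect, LinearMap.sub_apply, LinearMap.add_apply, coproduct_eq_op, addString_eq_op,
      addString_eq_op, op_eq_op5, op_eq_op5,
    op_eq_op5]
  rfl

theorem defect_1_of_4 (z : P 4) : defect 1 z
    = op5 (of 0) (of 1) (of 1) (of 2) (of 3) z - (op5 (of 0) 1 (of 1) (of 2) (of 3) z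
      + op5 (of 0) (of 1) 1 (of 2) (of 3) z) := by
  rw [defect, LinearMap.sub_apply, LinearMap.add_apply, coproduct_eq_op, addString_eq_op,
      addString_eq_op, op_eq_op5, op_eq_op5,
    op_eq_op5]
  rfl

theorem defect_2_of_4 (z : P 4) : defect 2 z
    = op5 (of 0) (of 1) (of 2) (of 2) (of 3) z - (op5 (of 0) (of 1) 1 (of 2) (of 3) z
      + op5 (of 0) (of 1) (of 2) 1 (of 3) z) := by
  rw [defect, LinearMap.sub_apply, LinearMap.add_apply, coproduct_eq_op, addString_eq_op,
      addString_eq_op, op_eq_op5, op_eq_op5,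
    op_eq_op5]
  rfl

theorem defect_3_of_4 (z : P 4) : defect 3 z
    = op5 (of 0) (of 1) (of 2) (of 3) (of 3) z - (op5 (of 0) (of 1) (of 2) 1 (of 3) z
      + op5 (of 0) (of 1) (of 2) (of 3) 1 z) := by
  rw [defect, LinearMap.sub_apply, LinearMap.add_apply, coproduct_eq_op, addString_eq_op,
      addString_eq_op, op_eq_op5, op_eq_op5,
    op_eq_op5]
  rfl

theorem IsPrimitive.defect_eq_zero {i : Fin n} {z : P n} (h : IsPrimitive i z) :
    defect i z = 0 := by
  rw [defect, LinearMap.sub_apply, LinearMap.add_apply, coproduct_of_isPrimitive h, sub_self]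

/-- The order of the strings in which the `i`-th one has been moved to the place `r ≤ i`. -/
def moved (r i q : Fin 4) : Fin 4 :=
  if q = r then i else if r < q ∧ q ≤ i then q - 1 else q

/-- The alternating sum of the ways of moving a later string, replaced by its `a`-th power, to the
place `r`. -/
def rotation (r : Fin 4) (a : ℕ) : P 4 →ₗ[ℚ] P 4 :=
  ∑ i : Fin 4, if r ≤ i then
    (-1 : ℚ) ^ (r.val + i.val) • (op (fun q => of (moved r i q)) ∘ₗ power i a) else 0

theorem rotation_zero (a : ℕ) (z : P 4) : rotation 0 a z
    = op4 (of 0 ^ a) (of 1) (of 2) (of 3) z - op4 (of 1 ^ a) (of 0) (of 2) (of 3) z + op4 (of 2 ^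
        a) (of 0) (of 1) (of 3) z - op4 (of 3 ^ a) (of 0) (of 1) (of 2) z := by
  simp [rotation, Fin.sum_univ_four, op_eq_op4, moved, op4_op4, power_0_of_4,
    power_1_of_4, power_2_of_4, power_3_of_4]
  module

theorem rotation_one (a : ℕ) (z : P 4) : rotation 1 a z
    = op4 (of 0) (of 1 ^ a) (of 2) (of 3) z - op4 (of 0) (of 2 ^ a) (of 1) (of 3) z + op4 (of 0)
        (of 3 ^ a) (of 1) (of 2) z := by
  simp [rotation, Fin.sum_univ_four, op_eq_op4, moved, op4_op4, power_1_of_4, power_2_of_4,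
      power_3_of_4]
  module

theorem rotation_two (a : ℕ) (z : P 4) : rotation 2 a z
    = op4 (of 0) (of 1) (of 2 ^ a) (of 3) z - op4 (of 0) (of 1) (of 3 ^ a) (of 2) z := by
  simp [rotation, Fin.sum_univ_four, op_eq_op4, moved, op4_op4, power_2_of_4, power_3_of_4]
  module

theorem rotation_three (a : ℕ) (z : P 4) : rotation 3 a z
    = op4 (of 0) (of 1) (of 2) (of 3 ^ a) z := by
  simp [rotation, Fin.sum_univ_four, op_eq_op4, moved, op4_op4, power_3_of_4]
  module

/-- For primitive strings the coproducts are sums of insertions, and the alternating sum telescopes.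
What remains is a differential acting only from the first non-primitive string on. -/
theorem differential_three_of_isPrimitive_1 {z : P 3} (h0 : IsPrimitive 0 z) :
    differential 3 z = -op4 (of 0) 1 (of 1) (of 2) z
      + op4 (of 0) (of 1) (of 1) (of 2) z
      - op4 (of 0) (of 1) (of 2) (of 2) z
      + op4 (of 0) (of 1) (of 2) 1 z := by
  have e0 := h0.defect_eq_zero
  rw [defect_0_of_3] at e0
  rw [differential_three]
  linear_combination (norm := module) -e0

theorem differential_three_of_isPrimitive_2 {z : P 3} (h0 : IsPrimitive 0 z) (h1 : IsPrimitive 1 z)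
    :
    differential 3 z = op4 (of 0) (of 1) 1 (of 2) z
      - op4 (of 0) (of 1) (of 2) (of 2) z
      + op4 (of 0) (of 1) (of 2) 1 z := by
  have e0 := h0.defect_eq_zero
  have e1 := h1.defect_eq_zero
  rw [defect_0_of_3] at e0
  rw [defect_1_of_3] at e1
  rw [differential_three]
  linear_combination (norm := module) -e0 + e1

theorem differential_four_of_isPrimitive_1 {z : P 4} (h0 : IsPrimitive 0 z) :
    differential 4 z = -op5 (of 0) 1 (of 1) (of 2) (of 3) z
      + op5 (of 0) (of 1) (of 1) (of 2) (of 3) z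
      - op5 (of 0) (of 1) (of 2) (of 2) (of 3) z
      + op5 (of 0) (of 1) (of 2) (of 3) (of 3) z
      - op5 (of 0) (of 1) (of 2) (of 3) 1 z := by
  have e0 := h0.defect_eq_zero
  rw [defect_0_of_4] at e0
  rw [differential_four]
  linear_combination (norm := module) -e0

theorem differential_four_of_isPrimitive_2 {z : P 4} (h0 : IsPrimitive 0 z) (h1 : IsPrimitive 1 z) :
    differential 4 z = op5 (of 0) (of 1) 1 (of 2) (of 3) z
      - op5 (of 0) (of 1) (of 2) (of 2) (of 3) z
      + op5 (of 0) (of 1) (of 2) (of 3) (of 3) z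
      - op5 (of 0) (of 1) (of 2) (of 3) 1 z := by
  have e0 := h0.defect_eq_zero
  have e1 := h1.defect_eq_zero
  rw [defect_0_of_4] at e0
  rw [defect_1_of_4] at e1
  rw [differential_four]
  linear_combination (norm := module) -e0 + e1

theorem differential_four_of_isPrimitive_3 {z : P 4} (h0 : IsPrimitive 0 z) (h1 : IsPrimitive 1 z)
    (h2 : IsPrimitive 2 z) :
    differential 4 z = -op5 (of 0) (of 1) (of 2) 1 (of 3) z
      + op5 (of 0) (of 1) (of 2) (of 3) (of 3) z
      - op5 (of 0) (of 1) (of 2) (of 3) 1 z := by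
  have e0 := h0.defect_eq_zero
  have e1 := h1.defect_eq_zero
  have e2 := h2.defect_eq_zero
  rw [defect_0_of_4] at e0
  rw [defect_1_of_4] at e1
  rw [defect_2_of_4] at e2
  rw [differential_four]
  linear_combination (norm := module) -e0 + e1 - e2

theorem differential_differential_three (z : P 3) : differential 4 (differential 3 z) = 0 := by
  simp only [differential_three, differential_four, map_add, map_sub, op5_op4,
    FreeMonoid.lift_eval_of, map_one, Matrix.cons_val]
  abel

/-- Doubling a string and sliding the second copy into the first gives the power `a + 1`. Sliding an
empty last string gives `-z`, once for each target. Sliding into an empty first string gives the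
rotation. Doubling a string into which `i ^ a` was slid differs from sliding into either copy of a
doubled string by the defect of `i ^ a`. Everything else cancels. -/
theorem homotopy_identity_zero (a : ℕ) (z : P 4) :
    differential 3 (homotopy 3 0 a z) + homotopy 4 0 a (differential 4 z)
      = (power 0 (a + 1) z - z) + (power 1 (a + 1) z - z) + (power 2 (a + 1) z - z) + (power 3 (a +
          1) z - z) - rotation 0 a z
      + (op4 (of 1 * of 0) (of 2 * of 0) (of 3) (of 4) : P 5 →ₗ[ℚ] P 4) (defect 1 (power 1 a z))
      - (op4 (of 2 * of 0) (of 3 * of 0) (of 1) (of 4) : P 5 →ₗ[ℚ] P 4) (defect 2 (power 2 a z))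
      + (op4 (of 0) (of 2 * of 1) (of 3 * of 1) (of 4) : P 5 →ₗ[ℚ] P 4) (defect 2 (power 2 a z))
      + (op4 (of 3 * of 0) (of 4 * of 0) (of 1) (of 2) : P 5 →ₗ[ℚ] P 4) (defect 3 (power 3 a z))
      - (op4 (of 0) (of 3 * of 1) (of 4 * of 1) (of 2) : P 5 →ₗ[ℚ] P 4) (defect 3 (power 3 a z))
      + (op4 (of 0) (of 1) (of 3 * of 2) (of 4 * of 2) : P 5 →ₗ[ℚ] P 4) (defect 3 (power 3 a z)) :=
          by
  rw [differential_three, differential_four]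
  simp only [homotopy_three_zero, homotopy_four_zero, rotation_zero, slide_1_0_of_4,
      slide_2_0_of_4, slide_2_1_of_4, slide_3_0_of_4, slide_3_1_of_4, slide_3_2_of_4,
      slide_1_0_of_5, slide_2_0_of_5, slide_2_1_of_5, slide_3_0_of_5, slide_3_1_of_5,
      slide_3_2_of_5, slide_4_0_of_5, slide_4_1_of_5, slide_4_2_of_5, slide_4_3_of_5, power_0_of_4,
      power_1_of_4, power_2_of_4, power_3_of_4, defect_1_of_4, defect_2_of_4, defect_3_of_4,
      map_add, map_sub, map_neg,
    op4_op3, op4_op5, op5_op4, FreeMonoid.lift_eval_of, map_one, map_mul, map_pow,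
    Matrix.cons_val, one_pow, one_mul, mul_one, pow_succ]
  simp only [op4_of]
  abel

/-- With a primitive first string, on `z` and on its homotopy, both differentials leave that string
alone, and the previous computation applies to the others. An empty string is now inserted at place
`1`. -/
theorem homotopy_identity_one (a : ℕ) (z : P 4) (h0 : IsPrimitive 0 z) (g0 : IsPrimitive 0
    (homotopy 3 1 a z)) :
    differential 3 (homotopy 3 1 a z) + homotopy 4 1 a (differential 4 z)
      = (power 1 (a + 1) z - z) + (power 2 (a + 1) z - z) + (power 3 (a + 1) z - z) - rotation 1 a z
      + (op4 (of 0) (of 2 * of 1) (of 3 * of 1) (of 4) : P 5 →ₗ[ℚ] P 4) (defect 2 (power 2 a z))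
      - (op4 (of 0) (of 3 * of 1) (of 4 * of 1) (of 2) : P 5 →ₗ[ℚ] P 4) (defect 3 (power 3 a z))
      + (op4 (of 0) (of 1) (of 3 * of 2) (of 4 * of 2) : P 5 →ₗ[ℚ] P 4) (defect 3 (power 3 a z)) :=
          by
  rw [differential_three_of_isPrimitive_1 g0, differential_four_of_isPrimitive_1 h0]
  simp only [homotopy_three_one, homotopy_four_one, rotation_one, slide_2_1_of_4, slide_3_1_of_4,
      slide_3_2_of_4, slide_2_1_of_5, slide_3_1_of_5, slide_3_2_of_5, slide_4_1_of_5,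
      slide_4_2_of_5, slide_4_3_of_5, power_1_of_4, power_2_of_4, power_3_of_4, defect_2_of_4,
      defect_3_of_4, map_add, map_sub, map_neg,
    op4_op3, op4_op5, op5_op4, FreeMonoid.lift_eval_of, map_one, map_mul, map_pow,
    Matrix.cons_val, one_pow, one_mul, mul_one, pow_succ]
  simp only [op4_of]
  abel

theorem homotopy_identity_two (a : ℕ) (z : P 4) (h0 : IsPrimitive 0 z) (h1 : IsPrimitive 1 z) (g0 :
    IsPrimitive 0 (homotopy 3 2 a z)) (g1 : IsPrimitive 1 (homotopy 3 2 a z)) :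
    differential 3 (homotopy 3 2 a z) + homotopy 4 2 a (differential 4 z)
      = (power 2 (a + 1) z - z) + (power 3 (a + 1) z - z) - rotation 2 a z
      + (op4 (of 0) (of 1) (of 3 * of 2) (of 4 * of 2) : P 5 →ₗ[ℚ] P 4) (defect 3 (power 3 a z)) :=
          by
  rw [differential_three_of_isPrimitive_2 g0 g1, differential_four_of_isPrimitive_2 h0 h1]
  simp only [homotopy_three_two, homotopy_four_two, rotation_two, slide_3_2_of_4, slide_3_2_of_5,
      slide_4_2_of_5, slide_4_3_of_5, power_2_of_4, power_3_of_4, defect_3_of_4, map_add, map_sub,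
      map_neg,
    op4_op3, op4_op5, op5_op4, FreeMonoid.lift_eval_of, map_one, map_mul, map_pow,
    Matrix.cons_val, one_pow, one_mul, mul_one, pow_succ]
  simp only [op4_of]
  abel

/-- There is no homotopy on four strings here, since no `j` satisfies `3 ≤ j < i ≤ 3`. The first
three strings being primitive, a cocycle is fixed up to scalars by `rotation 3`. -/
theorem homotopy_identity_three (a : ℕ) (z : P 4) (h0 : IsPrimitive 0 z) (h1 : IsPrimitive 1 z) (h2
    : IsPrimitive 2 z) :
    homotopy 4 3 a (differential 4 z)
      = (power 3 (a + 1) z - z) - rotation 3 a z := by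
  rw [differential_four_of_isPrimitive_3 h0 h1 h2]
  simp only [homotopy_four_three, rotation_three, slide_4_3_of_5, power_3_of_4, map_add, map_sub,
      map_neg,
    op4_op5, FreeMonoid.lift_eval_of, map_mul, map_pow,
    Matrix.cons_val, one_pow, one_mul, mul_one, pow_succ]
  simp only [op4_of]
  abel

/-! ### Averaging the identities over the exponent -/

/-- The linear combination of the maps `F 0, …, F M` with the given coefficients. -/
def average (c : ℕ → ℚ) (M : ℕ) (F : ℕ → P n →ₗ[ℚ] P k) : P n →ₗ[ℚ] P k :=
  ∑ a ∈ Finset.range (M + 1), c a • F a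

theorem average_apply (c : ℕ → ℚ) (M : ℕ) (F : ℕ → P n →ₗ[ℚ] P k) (z : P n) :
    average c M F z = ∑ a ∈ Finset.range (M + 1), c a • F a z := by
  simp [average, LinearMap.sum_apply]

/-- The average of a polynomial of degree at most `M` is its linear coefficient. -/
def ExtractsLinear (c : ℕ → ℚ) (M : ℕ) : Prop :=
  ∀ s ≤ M, ∑ a ∈ Finset.range (M + 1), c a * (a : ℚ) ^ s = if s = 1 then 1 else 0

/-- The linear coefficient of `(a + 1)^s - 1` is `s`; this is how a weight emerges from `ψ^(a+1) -
1`. -/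
theorem ExtractsLinear.sum_add_one_pow {c : ℕ → ℚ} {M : ℕ} (hc : ExtractsLinear c M) {s : ℕ}
    (hs : s ≤ M) :
    ∑ a ∈ Finset.range (M + 1), c a * (((a + 1 : ℕ) : ℚ) ^ s - 1) = s := by
  have h0 : ∑ a ∈ Finset.range (M + 1), c a = 0 := by simpa using hc 0 (Nat.zero_le _)
  simp only [mul_sub, mul_one, Finset.sum_sub_distrib, h0, sub_zero, Nat.cast_add, Nat.cast_one,
    add_pow, one_pow, Finset.mul_sum]
  rw [Finset.sum_comm]
  have h1 : ∀ t ∈ Finset.range (s + 1), ∑ a ∈ Finset.range (M + 1),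
      c a * ((a : ℚ) ^ t * (s.choose t : ℚ)) = if t = 1 then (s : ℚ) else 0 := by
    intro t ht
    simp only [← mul_assoc, ← Finset.sum_mul]
    rw [hc t (by rw [Finset.mem_range] at ht; omega)]
    split_ifs with h
    · rw [h, one_mul, Nat.choose_one_right]
    · rw [zero_mul]
  rw [Finset.sum_congr rfl h1, Finset.sum_ite_eq']
  split_ifs with h
  · rfl
  · rw [Finset.mem_range] at h
    have : s = 0 := by omega
    simp [this]

/-- The elements on four strings which are sums of homogeneous elements of total weight `j`, with
weights between `1` and `M`, and equal to `1` on the first `r` strings. -/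
def weightSpace (M r j : ℕ) : Submodule ℚ (P 4) :=
  Submodule.span ℚ {u | ∃ s : Fin 4 → ℕ, IsWeight s u ∧ (∀ i, 1 ≤ s i ∧ s i ≤ M) ∧
    (∀ i : Fin 4, i.val < r → s i = 1) ∧ ∑ i, s i = j}

theorem weightSpace_ext {M r j : ℕ} {F G : P 4 →ₗ[ℚ] P k}
    (h : ∀ (s : Fin 4 → ℕ) (u : P 4), IsWeight s u → (∀ i, 1 ≤ s i ∧ s i ≤ M) →
      (∀ i : Fin 4, i.val < r → s i = 1) → ∑ i, s i = j → F u = G u)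
    {w : P 4} (hw : w ∈ weightSpace M r j) : F w = G w := by
  have : weightSpace M r j ≤ LinearMap.eqLocus F G := by
    refine Submodule.span_le.2 ?_
    rintro u ⟨s, h1, h2, h3, h4⟩
    exact h s u h1 h2 h3 h4
  exact this hw

/-- Four weights, each at least one, have sum at least four. -/
theorem weightSpace_eq_zero {M r j : ℕ} (hj : j < 4) {w : P 4} (hw : w ∈ weightSpace M r j) :
    w = 0 := by
  refine weightSpace_ext (F := LinearMap.id) (G := 0) (fun s u _ h2 _ h4 => ?_) hw
  have : ∑ i : Fin 4, 1 ≤ ∑ i, s i := Finset.sum_le_sum fun i _ => (h2 i).1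
  simp at this
  omega

theorem isPrimitive_of_mem_weightSpace {M r j : ℕ} {w : P 4} (hw : w ∈ weightSpace M r j)
    {i : Fin 4} (hi : i.val < r) : IsPrimitive i w := fun a =>
  weightSpace_ext (F := power i a) (G := (a : ℚ) • LinearMap.id) (fun s u h1 _ h3 _ => by
    rw [h1 i a, h3 i hi, pow_one]; rfl) hw

/-- The average is the projection to weight one on the `i`-th string; `M` bounds all weights that
occur. -/
theorem isPrimitive_powerAverage {c : ℕ → ℚ} {M r j : ℕ} (hc : ExtractsLinear c M) {w : P 4}
    (hw : w ∈ weightSpace M r j) (i : Fin 4) : IsPrimitive i (powerAverage c M i w) := by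
  intro b
  rw [power_powerAverage]
  refine weightSpace_ext (F := powerAverage c M i ∘ₗ power i b)
    (G := (b : ℚ) • powerAverage c M i) (fun s u h1 h2 _ _ => ?_) hw
  have e : powerAverage c M i u = (if s i = 1 then (1 : ℚ) else 0) • u := by
    simp only [powerAverage_apply, h1 i, smul_smul]
    rw [← Finset.sum_smul, hc _ (h2 i).2]
  rw [LinearMap.comp_apply, LinearMap.smul_apply, h1 i, map_smul, e]
  split_ifs with h
  · rw [h, pow_one]
  · simp

/-- By linearity this is the defect of an averaged power, which is primitive. -/
theorem sum_defect {c : ℕ → ℚ} {M r j : ℕ} (hc : ExtractsLinear c M) {w : P 4}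
    (hw : w ∈ weightSpace M r j) (i : Fin 4) (F : P 5 →ₗ[ℚ] P 4) :
    ∑ a ∈ Finset.range (M + 1), c a • F (defect i (power i a w)) = 0 := by
  have := (isPrimitive_powerAverage hc hw i).defect_eq_zero
  have h2 := congrArg F this
  rw [powerAverage_apply, map_sum, map_sum, map_zero] at h2
  simpa only [map_smul] using h2

/-- Each string in `F` contributes its weight. The first `r` strings have weight one and are left
out, whence `j - r`. -/
theorem sum_power {c : ℕ → ℚ} {M r j : ℕ} (hc : ExtractsLinear c M) {w : P 4}
    (hw : w ∈ weightSpace M r j) (F : Finset (Fin 4)) (hF : ∀ i, i ∉ F ↔ i.val < r)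
    (hr : r ≤ 4) : ∑ a ∈ Finset.range (M + 1), c a • ∑ i ∈ F, (power i (a + 1) w - w)
      = ((j : ℚ) - r) • w := by
  have := weightSpace_ext (F := ∑ a ∈ Finset.range (M + 1), c a •
    ∑ i ∈ F, (power i (a + 1) - LinearMap.id)) (G := ((j : ℚ) - r) • LinearMap.id)
    (fun s u h1 h2 h3 h4 => ?_) hw
  · simpa [LinearMap.sum_apply] using this
  · have e : ∀ (a : ℕ) (i : Fin 4), (power i (a + 1) - LinearMap.id : P 4 →ₗ[ℚ] P 4) u
        = (((a + 1 : ℕ) : ℚ) ^ s i - 1) • u := fun a i => by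
      rw [LinearMap.sub_apply, h1 i, sub_smul, one_smul]; rfl
    simp only [LinearMap.sum_apply, LinearMap.smul_apply, e, Finset.smul_sum, smul_smul,
      LinearMap.id_apply]
    rw [Finset.sum_comm]
    have e2 : ∀ i ∈ F, ∑ a ∈ Finset.range (M + 1), (c a * (((a + 1 : ℕ) : ℚ) ^ s i - 1)) • u
        = (s i : ℚ) • u := fun i _ => by
      rw [← Finset.sum_smul, hc.sum_add_one_pow (h2 i).2]
    rw [Finset.sum_congr rfl e2, ← Finset.sum_smul]
    congr 1
    have e3 : ∑ i ∈ Fᶜ, s i = r := by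
      rw [Finset.sum_congr rfl fun i hi => h3 i ((hF i).1 (Finset.mem_compl.1 hi))]
      have : Fᶜ = Finset.univ.filter fun i : Fin 4 => i.val < r := by ext i; simp [hF]
      rw [this, Finset.sum_const, smul_eq_mul, mul_one]
      interval_cases r <;> rfl
    rw [eq_sub_iff_add_eq]
    have e4 := Finset.sum_add_sum_compl F s
    rw [h4, e3] at e4
    exact_mod_cast e4

theorem op_perm_isWeight (π : Equiv.Perm (Fin n)) {s : Fin n → ℕ} {u : P n} (hu : IsWeight s u) :
    IsWeight (s ∘ π) (op (fun q => of (π q)) u) := by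
  intro i a
  rw [Function.comp_apply, ← map_smul, ← hu (π i) a, power_op, power, op_op]
  refine LinearMap.congr_fun (op_congr fun q => ?_) u
  by_cases h : q = i
  · subst h; simp
  · rw [Function.update_of_ne h, FreeMonoid.lift_eval_of,
      Function.update_of_ne fun h' => h (π.injective h')]

theorem moved_injective {r i : Fin 4} (h : r ≤ i) : Function.Injective (moved r i) := by
  revert r i; decide

theorem moved_of_lt {r i q : Fin 4} (h : r ≤ i) (hq : q < r) : moved r i q = q := by
  revert r i q; decide

theorem moved_self (r i : Fin 4) : moved r i r = i := if_pos rfl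

/-- Averaging keeps only the moves of strings of weight one, and these are moved to the place `r`
without disturbing the first `r` strings. -/
theorem average_rotation_mem {c : ℕ → ℚ} {M j : ℕ} (hc : ExtractsLinear c M) (r : Fin 4) {w : P 4}
    (hw : w ∈ weightSpace M r j) : average c M (rotation r) w ∈ weightSpace M (r + 1) j := by
  have : weightSpace M r j ≤ (weightSpace M (r + 1) j).comap (average c M (rotation r)) := by
    refine Submodule.span_le.2 ?_
    rintro u ⟨s, h1, h2, h3, h4⟩
    have e : average c M (rotation r) u = ∑ i : Fin 4, if r ≤ i ∧ s i = 1 then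
        (-1 : ℚ) ^ (r.val + i.val) • op (fun q => of (moved r i q)) u else 0 := by
      simp only [average_apply, rotation, LinearMap.sum_apply, Finset.smul_sum]
      rw [Finset.sum_comm]
      refine Finset.sum_congr rfl fun i _ => ?_
      by_cases h : r ≤ i
      · simp only [if_pos h, LinearMap.smul_apply, LinearMap.comp_apply, h1 i, map_smul,
          smul_comm (c _) ((-1 : ℚ) ^ _), smul_smul (c _)]
        rw [← Finset.smul_sum, ← Finset.sum_smul, hc _ (h2 i).2]
        by_cases h' : s i = 1
        · rw [if_pos h', if_pos ⟨h, h'⟩, one_smul]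
        · rw [if_neg h', if_neg fun hh => h' hh.2, zero_smul, smul_zero]
      · rw [if_neg fun hh => h hh.1]
        simp [h]
    change average c M (rotation r) u ∈ weightSpace M (r + 1) j
    rw [e]
    refine Submodule.sum_mem _ fun i _ => ?_
    split_ifs with h
    · refine Submodule.smul_mem _ _ (Submodule.subset_span ?_)
      let π : Equiv.Perm (Fin 4) := Equiv.ofBijective _
        (Finite.injective_iff_bijective.1 (moved_injective h.1))
      refine ⟨s ∘ π, op_perm_isWeight π h1, fun q => h2 _, fun q hq => ?_, ?_⟩
      · rcases Nat.lt_succ_iff_lt_or_eq.1 hq with hq | hq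
        · change s (moved r i q) = 1
          rw [moved_of_lt h.1 hq]
          exact h3 q hq
        · change s (moved r i q) = 1
          rw [Fin.ext hq, moved_self, h.2]
      · rw [← h4]
        exact Equiv.sum_comp π s
    · exact zero_mem _
  exact this hw

/-- The slides from the place `1` on do not touch the first string. This carries its primitivity
over to the homotopy. -/
theorem power_zero_homotopy_one (a b : ℕ) (z : P 4) :
    power 0 b (homotopy 3 1 a z) = homotopy 3 1 a (power (0 : Fin 4) b z) := by
  simp only [homotopy_three_one, slide_2_1_of_4, slide_3_1_of_4, slide_3_2_of_4, power_0_of_4,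
    power_0_of_3, map_sub, op3_op4, op3_op3, map_mul, map_pow, FreeMonoid.lift_eval_of,
    Matrix.cons_val]

theorem power_zero_homotopy_two (a b : ℕ) (z : P 4) :
    power 0 b (homotopy 3 2 a z) = homotopy 3 2 a (power (0 : Fin 4) b z) := by
  simp only [homotopy_three_two, slide_3_2_of_4, power_0_of_4,
    power_0_of_3, map_neg, op3_op4, op3_op3, map_mul, map_pow, FreeMonoid.lift_eval_of,
    Matrix.cons_val]

theorem power_one_homotopy_two (a b : ℕ) (z : P 4) :
    power 1 b (homotopy 3 2 a z) = homotopy 3 2 a (power (1 : Fin 4) b z) := by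
  simp only [homotopy_three_two, slide_3_2_of_4, power_1_of_4,
    power_1_of_3, map_neg, op3_op4, op3_op3, map_mul, map_pow, FreeMonoid.lift_eval_of,
    Matrix.cons_val]

theorem isPrimitive_homotopy {r a : ℕ} {i : Fin 3} {w : P 4}
    (h : ∀ b, power i b (homotopy 3 r a w) = homotopy 3 r a (power i.castSucc b w))
    (hw : IsPrimitive i.castSucc w) : IsPrimitive i (homotopy 3 r a w) := fun b => by
  rw [h, hw, map_smul]

/-- The average of `homotopy_identity_zero` on a cocycle: the powers give the total weight, and the
defects vanish. -/
theorem differential_average_homotopy_zero {c : ℕ → ℚ} {M j : ℕ}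
    (hc : ExtractsLinear c M) {w : P 4} (hw : w ∈ weightSpace M 0 j)
    (hd : differential 4 w = 0) : differential 3 (average c M (homotopy 3 0) w)
      = (j : ℚ) • w - average c M (rotation 0) w := by
  have key := fun a => homotopy_identity_zero a w
  simp only [hd, map_zero, add_zero] at key
  have hs := sum_power hc hw Finset.univ (by simp) (by norm_num)
  simp only [Fin.sum_univ_four, Nat.cast_zero, sub_zero] at hs
  rw [← hs]
  simp only [average_apply, map_sum, map_smul, key, smul_add, smul_sub, Finset.sum_add_distrib,
    Finset.sum_sub_distrib, sum_defect hc hw, add_zero, sub_zero]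

theorem differential_average_homotopy_one {c : ℕ → ℚ} {M j : ℕ}
    (hc : ExtractsLinear c M) {w : P 4} (hw : w ∈ weightSpace M 1 j)
    (hd : differential 4 w = 0) : differential 3 (average c M (homotopy 3 1) w)
      = ((j : ℚ) - 1) • w - average c M (rotation 1) w := by
  have h0 : IsPrimitive 0 w := isPrimitive_of_mem_weightSpace hw (by norm_num)
  have key := fun a => homotopy_identity_one a w h0
    (isPrimitive_homotopy (i := 0) (fun b => power_zero_homotopy_one a b w) h0)
  simp only [hd, map_zero, add_zero] at key
  have hs := sum_power hc hw {1, 2, 3} (by decide) (by norm_num)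
  rw [Finset.sum_congr rfl fun a _ => by
    rw [Finset.sum_insert (by decide), Finset.sum_insert (by decide), Finset.sum_singleton,
      ← add_assoc], Nat.cast_one] at hs
  rw [← hs]
  simp only [average_apply, map_sum, map_smul, key, smul_add, smul_sub, Finset.sum_add_distrib,
    Finset.sum_sub_distrib, sum_defect hc hw, add_zero, sub_zero]

theorem differential_average_homotopy_two {c : ℕ → ℚ} {M j : ℕ}
    (hc : ExtractsLinear c M) {w : P 4} (hw : w ∈ weightSpace M 2 j)
    (hd : differential 4 w = 0) : differential 3 (average c M (homotopy 3 2) w)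
      = ((j : ℚ) - 2) • w - average c M (rotation 2) w := by
  have h0 : IsPrimitive 0 w := isPrimitive_of_mem_weightSpace hw (by norm_num)
  have h1 : IsPrimitive 1 w := isPrimitive_of_mem_weightSpace hw (by norm_num)
  have key := fun a => homotopy_identity_two a w h0 h1
    (isPrimitive_homotopy (i := 0) (fun b => power_zero_homotopy_two a b w) h0)
    (isPrimitive_homotopy (i := 1) (fun b => power_one_homotopy_two a b w) h1)
  simp only [hd, map_zero, add_zero] at key
  have hs := sum_power hc hw {2, 3} (by decide) (by norm_num)
  rw [Finset.sum_congr rfl fun a _ => by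
    rw [Finset.sum_insert (by decide), Finset.sum_singleton], Nat.cast_ofNat] at hs
  rw [← hs]
  simp only [average_apply, map_sum, map_smul, key, smul_add, smul_sub, Finset.sum_add_distrib,
    Finset.sum_sub_distrib, sum_defect hc hw, add_zero]

theorem average_rotation_three {c : ℕ → ℚ} {M j : ℕ}
    (hc : ExtractsLinear c M) {w : P 4} (hw : w ∈ weightSpace M 3 j)
    (hd : differential 4 w = 0) : average c M (rotation 3) w = ((j : ℚ) - 3) • w := by
  have key := fun a => homotopy_identity_three a w
    (isPrimitive_of_mem_weightSpace hw (by norm_num))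
    (isPrimitive_of_mem_weightSpace hw (by norm_num))
    (isPrimitive_of_mem_weightSpace hw (by norm_num))
  simp only [hd, map_zero] at key
  have hs := sum_power hc hw {3} (by decide) (by norm_num)
  simp only [Finset.sum_singleton, Nat.cast_ofNat] at hs
  rw [← hs, average_apply]
  exact Finset.sum_congr rfl fun a _ => congrArg _ (sub_eq_zero.1 (key a).symm).symm

/-- The composite is the signed sum over all orders of four strings, with the exponents attached to
places and not to strings. Reversal is a product of two transpositions, hence even, and leaves the
sum unchanged. -/
theorem rotation_permute (a₀ a₁ a₂ a₃ : ℕ) (z : P 4) :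
    rotation 3 a₃ (rotation 2 a₂ (rotation 1 a₁ (rotation 0 a₀ (permute Fin.revPerm z))))
      = rotation 3 a₃ (rotation 2 a₂ (rotation 1 a₁ (rotation 0 a₀ z))) := by
  have e : permute Fin.revPerm z = op4 (of 3) (of 2) (of 1) (of 0) z := by
    rw [permute_eq_op, op_eq_op4]; rfl
  rw [e]
  simp only [rotation_zero, rotation_one, rotation_two, rotation_three, map_add, map_sub, map_pow,
    op4_op4, FreeMonoid.lift_eval_of, Matrix.cons_val]
  abel

/-- The only use of the symmetry condition in making a cocycle exact: the composite is invariant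
under reversal, so its value here equals its own negative. -/
theorem average_rotation_eq_zero (c : ℕ → ℚ) (M : ℕ) {z : P 4}
    (hz : permute Fin.revPerm z = -z) :
    average c M (rotation 3) (average c M (rotation 2) (average c M (rotation 1)
      (average c M (rotation 0) z))) = 0 := by
  have h : average c M (rotation 3) (average c M (rotation 2) (average c M (rotation 1)
      (average c M (rotation 0) (permute Fin.revPerm z))))
      = average c M (rotation 3) (average c M (rotation 2) (average c M (rotation 1)
        (average c M (rotation 0) z))) := by
    simp only [average_apply, map_sum, map_smul, rotation_permute]
  rw [hz] at h
  simp only [map_neg] at h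
  have h2 := add_eq_zero_iff_neg_eq.2 h
  rw [← two_smul ℚ] at h2
  exact (smul_eq_zero.1 h2).resolve_left two_ne_zero

/-! ### Counting the legs of a connected graph -/

/-- The set of vertices, univalent and trivalent. -/
abbrev Graph.Vertex (G : Graph) : Type := Quotient (Equiv.Perm.SameCycle.setoid G.vert)

/-- The simple graph in which two different vertices are adjacent if an edge joins them. -/
def Graph.toSimpleGraph (G : Graph) : SimpleGraph G.Vertex where
  Adj v w := v ≠ w ∧ ∃ h, Quotient.mk _ h = v ∧ Quotient.mk _ (G.edge h) = w
  symm := ⟨fun _ _ ⟨h1, h, h2, h3⟩ => ⟨h1.symm, G.edge h, h3, by rw [G.edge_edge, h2]⟩⟩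
  loopless := ⟨fun _ h => h.1 rfl⟩

theorem Graph.Connected.toSimpleGraph {G : Graph} (hG : G.Connected) :
    G.toSimpleGraph.Connected := by
  have key : ∀ h k, G.Linked h k → G.toSimpleGraph.Reachable
      (Quotient.mk (Equiv.Perm.SameCycle.setoid G.vert) h) (Quotient.mk _ k) := by
    intro h k hl
    induction hl with
    | refl => exact SimpleGraph.Reachable.refl _
    | symm _ _ _ ih => exact ih.symm
    | trans _ _ _ _ _ ih1 ih2 => exact ih1.trans ih2
    | rel h k hk =>
      rcases hk with rfl | rfl
      · by_cases e : (Quotient.mk (Equiv.Perm.SameCycle.setoid G.vert) h)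
            = Quotient.mk _ (G.edge h)
        · rw [← e]
        · exact SimpleGraph.Adj.reachable ⟨e, h, rfl, rfl⟩
      · have : (Quotient.mk (Equiv.Perm.SameCycle.setoid G.vert) h)
            = Quotient.mk _ (G.vert h) := Quotient.sound ⟨1, rfl⟩
        rw [← this]
  obtain ⟨⟨h⟩, hl⟩ := hG
  have : Nonempty G.Vertex := ⟨Quotient.mk _ h⟩
  refine SimpleGraph.Connected.mk fun v w => ?_
  induction v using Quotient.inductionOn with | h h =>
  induction w using Quotient.inductionOn with | h k =>
  exact key h k (hl h k)

/-- Both flags of an edge have the same pair of end vertices. Loops and multiple edges only make the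
inequality strict. -/
theorem Graph.two_mul_card_edgeSet_le (G : Graph) :
    2 * Nat.card G.toSimpleGraph.edgeSet ≤ Nat.card G.Flag := by
  classical
  have := G.finite
  have := Fintype.ofFinite G.Flag
  let f : G.Flag → Sym2 G.Vertex := fun h => s(Quotient.mk _ h, Quotient.mk _ (G.edge h))
  have hf : ∀ h, f (G.edge h) = f h := fun h => by
    simp only [f, G.edge_edge]
    exact Sym2.eq_swap
  have h1 : 2 * (Finset.univ.image f).card ≤ Fintype.card G.Flag := by
    refine Finset.mul_card_image_le_card _ 2 fun b hb => ?_
    obtain ⟨h, -, rfl⟩ := Finset.mem_image.1 hb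
    rw [← Finset.card_pair (G.edge_ne h).symm]
    refine Finset.card_le_card fun x hx => ?_
    rcases Finset.mem_insert.1 hx with rfl | hx
    · simp
    · rw [Finset.mem_singleton.1 hx]; simp [hf]
  have h2 : Nat.card G.toSimpleGraph.edgeSet ≤ (Finset.univ.image f).card := by
    rw [← Set.ncard_coe_finset]
    refine Set.ncard_le_ncard (fun e he => ?_) (Finset.finite_toSet _)
    induction e using Sym2.inductionOn with | _ v w =>
    obtain ⟨-, h, h1, h2⟩ := he
    simp only [Finset.coe_image, Finset.coe_univ, Set.image_univ, Set.mem_range, f]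
    exact ⟨h, by rw [h1, h2]⟩
  rw [Nat.card_eq_fintype_card (α := G.Flag)]
  omega

theorem Graph.eq_of_sameCycle (G : Graph) {h k : G.Flag} (hk : G.vert.SameCycle h k) :
    k = h ∨ k = G.vert h ∨ k = G.vert (G.vert h) := by
  have := G.finite
  obtain ⟨i, rfl⟩ := hk.exists_nat_pow_eq
  induction i with
  | zero => exact Or.inl rfl
  | succ i ih =>
    rw [pow_succ', Equiv.Perm.mul_apply]
    rcases ih ⟨i, rfl⟩ with h | h | h <;> rw [h]
    · exact Or.inr (Or.inl rfl)
    · exact Or.inr (Or.inr rfl)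
    · exact Or.inl (G.vert_vert_vert _)

/-- Counted vertex by vertex: a univalent vertex contributes `1 + 2`, a trivalent one at most `3 +
0`. -/
theorem Graph.card_flag_add_le (G : Graph) :
    Nat.card G.Flag + 2 * Nat.card {h // G.vert h = h} ≤ 3 * G.numVertices := by
  classical
  have := G.finite
  have := Fintype.ofFinite G.Flag
  have := Fintype.ofFinite G.Vertex
  let p : G.Flag → G.Vertex := Quotient.mk _
  have h1 := Finset.card_eq_sum_card_fiberwise (f := p) (s := Finset.univ) (t := Finset.univ)
    fun _ _ => Finset.mem_coe.2 (Finset.mem_univ _)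
  have h2 := Finset.card_eq_sum_card_fiberwise (f := p)
    (s := Finset.univ.filter fun h => G.vert h = h) (t := Finset.univ)
    fun _ _ => Finset.mem_coe.2 (Finset.mem_univ _)
  have h3 : ∀ v ∈ (Finset.univ : Finset G.Vertex),
      (Finset.univ.filter fun h => p h = v).card
        + 2 * ((Finset.univ.filter fun h => G.vert h = h).filter fun h => p h = v).card ≤ 3 := by
    intro v _
    induction v using Quotient.inductionOn with | h h =>
    have hp : ∀ k, p k = Quotient.mk _ h → k = h ∨ k = G.vert h ∨ k = G.vert (G.vert h) :=
      fun k hk => G.eq_of_sameCycle (Quotient.exact hk.symm)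
    by_cases hv : G.vert h = h
    · have a1 : (Finset.univ.filter fun k => p k = Quotient.mk _ h).card ≤ 1 := by
        rw [← Finset.card_singleton h]
        refine Finset.card_le_card fun k hk => ?_
        have := hp k (Finset.mem_filter.1 hk).2
        rw [hv, hv] at this
        simpa using this
      have a2 : ((Finset.univ.filter fun k => G.vert k = k).filter
          fun k => p k = Quotient.mk _ h).card ≤ 1 :=
        le_trans (Finset.card_le_card (Finset.filter_subset_filter _ (Finset.filter_subset _ _))) a1
      omega
    · have a1 : (Finset.univ.filter fun k => p k = Quotient.mk _ h).card ≤ 3 := by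
        refine le_trans (Finset.card_le_card (t := {h, G.vert h, G.vert (G.vert h)})
          fun k hk => ?_) Finset.card_le_three
        simpa using hp k (Finset.mem_filter.1 hk).2
      have a2 : ((Finset.univ.filter fun k => G.vert k = k).filter
          fun k => p k = Quotient.mk _ h) = ∅ := by
        refine Finset.filter_eq_empty_iff.2 fun k hk hk' => hv ?_
        have hk := (Finset.mem_filter.1 hk).2
        rcases hp k hk' with rfl | rfl | rfl
        · exact hk
        · exact G.vert.injective hk
        · exact G.vert.injective (G.vert.injective hk)
      rw [a2, Finset.card_empty]
      omega
  have h4 := Finset.sum_le_sum h3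
  rw [Finset.sum_add_distrib, ← Finset.mul_sum, ← h1, ← h2, Finset.sum_const, smul_eq_mul,
    Finset.card_univ, Finset.card_univ] at h4
  rw [Graph.numVertices, Nat.card_eq_fintype_card, Nat.card_eq_fintype_card,
    Nat.card_eq_fintype_card, Fintype.card_subtype]
  exact h4.trans (mul_comm _ _).le

/-- With `V` vertices, `E` edges of the simple graph, `F` flags and `ℓ` legs: `V ≤ E + 1`, `2E ≤ F`
and `F + 2ℓ ≤ 3V` give `2ℓ ≤ V + 2`. -/
theorem Graph.Connected.two_mul_card_le {G : Graph} (hG : G.Connected) :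
    2 * Nat.card {h // G.vert h = h} ≤ G.numVertices + 2 := by
  have h1 := hG.toSimpleGraph.card_vert_le_card_edgeSet_add_one
  have h2 := G.two_mul_card_edgeSet_le
  have h3 := G.card_flag_add_le
  change G.numVertices ≤ _ at h1
  omega

theorem Diagram.sum_length_legs (D : Diagram n) :
    ∑ i, (D.legs i).length = Nat.card {h // D.graph.vert h = h} := by
  classical
  have := D.graph.finite
  have := Fintype.ofFinite D.graph.Flag
  have h1 : (∑ i, (D.legs i : Multiset D.graph.Flag)).card = ∑ i, (D.legs i).length := by
    simp
  have h2 : (∑ i, (D.legs i : Multiset D.graph.Flag)).toFinset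
      = Finset.univ.filter fun h => D.graph.vert h = h := by
    ext h
    rw [Multiset.mem_toFinset, D.mem_legs]
    simp
  rw [← h1, ← Multiset.toFinset_card_of_nodup D.nodup_legs, h2, Nat.card_eq_fintype_card,
    Fintype.card_subtype]

/-- A connected diagram of degree `m` has at most `m + 1` univalent vertices. -/
theorem Diagram.sum_length_legs_le (D : Diagram n) (hc : D.graph.Connected)
    (hm : D.graph.numVertices = 2 * m) : ∑ i, (D.legs i).length ≤ m + 1 := by
  have := hc.two_mul_card_le
  rw [← D.sum_length_legs] at this
  omega

theorem mem_span_weights_of_mem_integralLattice {z : P 4} (hz : z ∈ integralLattice 4 m) :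
    z ∈ Submodule.span ℚ {u : P 4 | ∃ s : Fin 4 → ℕ, IsWeight s u ∧
      (∀ i, 1 ≤ s i ∧ s i ≤ m - 1) ∧ ∑ i, s i ≤ m + 1} := by
  refine integralLattice_induction (p := fun z => z ∈ Submodule.span ℚ {u : P 4 |
    ∃ s : Fin 4 → ℕ, IsWeight s u ∧ (∀ i, 1 ≤ s i ∧ s i ≤ m - 1) ∧ ∑ i, s i ≤ m + 1}) hz
    (fun D h1 h2 h3 => ?_) (zero_mem _) (fun _ _ => add_mem) (fun _ => neg_mem)
  refine Submodule.span_mono ?_ D.cls_mem_span_weights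
  rintro u ⟨s, hs, hl⟩
  have b1 := D.sum_length_legs_le h1 h2
  have b2 : ∀ i, 1 ≤ s i := fun i => Nat.one_le_iff_ne_zero.2 ((hl i).2 (h3 i))
  have b3 := (Finset.sum_le_sum fun i (_ : i ∈ Finset.univ) => (hl i).1).trans b1
  refine ⟨s, hs, fun i => ⟨b2 i, ?_⟩, b3⟩
  rw [Fin.sum_univ_four] at b3
  have c0 := b2 0
  have c1 := b2 1
  have c2 := b2 2
  have c3 := b2 3
  -- The three other weights are at least one, so even `m - 2` would do; `m - 1` is the bound used
  -- for the averages.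
  fin_cases i <;> simp only [Fin.zero_eta, Fin.mk_one, Fin.reduceFinMk] <;> omega

/-! ### Simultaneous powers of all strings -/

section scaling

/-- Replace every string by its `b`-th power. -/
def scale (b : ℕ) : P n →ₗ[ℚ] P n := op fun i => of i ^ b

/-- Words with at most one letter commute with powers, as longer products in general do not. The
terms of the differential are all of this kind. -/
theorem op_scale {w : Fin k → FreeMonoid (Fin n)} (hw : ∀ a, w a = 1 ∨ ∃ i, w a = of i) (b : ℕ)
    (z : P n) : op w (scale b z) = scale b (op w z) := by
  rw [scale, scale, op_op, op_op]
  refine LinearMap.congr_fun (op_congr fun a => ?_) z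
  rcases hw a with h | ⟨i, h⟩ <;> simp [h]

theorem insertNth_of (p : Fin (n + 1)) {x : FreeMonoid (Fin n)} (hx : x = 1 ∨ ∃ i, x = of i)
    (a : Fin (n + 1)) :
    Fin.insertNth (α := fun _ => FreeMonoid (Fin n)) p x of a = 1 ∨
      ∃ i, Fin.insertNth (α := fun _ => FreeMonoid (Fin n)) p x of a = of i := by
  refine Fin.succAboveCases p ?_ (fun q => ?_) a
  · rwa [Fin.insertNth_apply_same]
  · exact Or.inr ⟨q, Fin.insertNth_apply_succAbove _ _ _ _⟩

/-- Hence the components of a cocycle of given total weight, being combinations of its scalings, are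
cocycles. -/
theorem differential_scale (b : ℕ) (z : P n) :
    differential n (scale b z) = scale b (differential n z) := by
  have h1 : ∀ p, addString p (scale b z) = scale b (addString p z) := fun p => by
    rw [addString_eq_op, addString_eq_op, op_scale (insertNth_of p (Or.inl rfl))]
  have h2 : ∀ i : Fin n, coproduct i (scale b z) = scale b (coproduct i z) := fun i => by
    rw [coproduct_eq_op, coproduct_eq_op, op_scale (insertNth_of _ (Or.inr ⟨i, rfl⟩))]
  simp only [differential, LinearMap.add_apply, LinearMap.sum_apply, LinearMap.smul_apply, h1, h2,
    map_add, map_sum, map_smul]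

theorem permute_scale (π : Equiv.Perm (Fin n)) (b : ℕ) (z : P n) :
    permute π (scale b z) = scale b (permute π z) := by
  rw [permute_eq_op, permute_eq_op, op_scale fun a => Or.inr ⟨_, rfl⟩]

theorem scale_four (b : ℕ) (z : P 4) :
    scale b z = power 0 b (power 1 b (power 2 b (power 3 b z))) := by
  simp only [scale, op_eq_op4, power_0_of_4, power_1_of_4, power_2_of_4, power_3_of_4, op4_op4,
    FreeMonoid.lift_eval_of, map_pow, Matrix.cons_val]

theorem IsWeight.scale {s : Fin 4 → ℕ} {u : P 4} (hu : IsWeight s u) (b : ℕ) :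
    scale b u = (b : ℚ) ^ (∑ i, s i) • u := by
  simp only [scale_four, hu 3, hu 2, hu 1, hu 0, map_smul, smul_smul, ← pow_add,
    Fin.sum_univ_four]
  congr 2
  ring

theorem scale_of_mem_weightSpace {M j : ℕ} {w : P 4} (hw : w ∈ weightSpace M 0 j) (b : ℕ) :
    scale b w = (b : ℚ) ^ j • w :=
  weightSpace_ext (F := scale b) (G := (b : ℚ) ^ j • LinearMap.id) (fun s u h1 _ _ h4 => by
    rw [h1.scale, h4]; rfl) hw

/-- The first string is known to have weight one, so its power is left out; this lowers the degree
of the later interpolation by one. -/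
theorem power_of_mem_weightSpace_one {M j : ℕ} {w : P 4} (hw : w ∈ weightSpace M 1 (j + 1))
    (b : ℕ) : power 1 b (power 2 b (power 3 b w)) = (b : ℚ) ^ j • w := by
  refine weightSpace_ext (F := power 1 b ∘ₗ power 2 b ∘ₗ power 3 b)
    (G := (b : ℚ) ^ j • LinearMap.id) (fun s u h1 _ h3 h4 => ?_) hw
  rw [Fin.sum_univ_four, h3 0 (by norm_num)] at h4
  simp only [LinearMap.comp_apply, LinearMap.smul_apply, LinearMap.id_apply, h1 3, h1 2, h1 1,
    map_smul, smul_smul, ← pow_add]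
  congr 2
  omega

theorem power_of_mem_weightSpace_two {M j : ℕ} {w : P 4} (hw : w ∈ weightSpace M 2 (j + 2))
    (b : ℕ) : power 2 b (power 3 b w) = (b : ℚ) ^ j • w := by
  refine weightSpace_ext (F := power 2 b ∘ₗ power 3 b)
    (G := (b : ℚ) ^ j • LinearMap.id) (fun s u h1 _ h3 h4 => ?_) hw
  rw [Fin.sum_univ_four, h3 0 (by norm_num), h3 1 (by norm_num)] at h4
  simp only [LinearMap.comp_apply, LinearMap.smul_apply, LinearMap.id_apply, h1 3, h1 2,
    map_smul, smul_smul, ← pow_add]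
  congr 2
  omega

end scaling

/-! ### Integrality of the operations -/

section integrality

theorem power_mem_integralLattice (i : Fin n) (a : ℕ) {z : P n} (hz : z ∈ integralLattice n m) :
    power i a z ∈ integralLattice n m := by
  refine op_mem_integralLattice _ id (fun p q h => ?_) hz
  by_cases hq : q = i
  · subst hq
    rw [Function.update_self] at h
    exact (FreeMonoid.mem_of.1 (mem_of_mem_pow h)).symm
  · rw [Function.update_of_ne hq, FreeMonoid.mem_of] at h
    exact h.symm

theorem permute_mem_integralLattice (π : Equiv.Perm (Fin n)) {z : P n}
    (hz : z ∈ integralLattice n m) : permute π z ∈ integralLattice n m := by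
  rw [permute_eq_op]
  refine op_mem_integralLattice _ (fun a => π.symm a) (fun p q h => ?_) hz
  rw [FreeMonoid.mem_of] at h
  exact (π.symm.injective h).symm

/-- Every string other than the slid one is named in exactly one word, so each new string inherits a
leg. -/
theorem slide_mem_integralLattice (i j : Fin (k + 1)) (a : ℕ) {z : P (k + 1)}
    (hz : z ∈ integralLattice (k + 1) m) : slide i j a z ∈ integralLattice k m := by
  refine op_mem_integralLattice _ (fun q => i.succAbove q) (fun p q h => ?_) hz
  split_ifs at h with hq
  · rw [FreeMonoid.mem_mul] at h
    rcases h with h | h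
    · exact absurd (FreeMonoid.mem_of.1 (mem_of_mem_pow h)) (Fin.succAbove_ne _ _)
    · rw [FreeMonoid.mem_of, ← hq] at h
      exact (Fin.succAbove_right_injective h).symm
  · rw [FreeMonoid.mem_of] at h
    exact (Fin.succAbove_right_injective h).symm

theorem homotopy_mem_integralLattice (r a : ℕ) {z : P (k + 1)}
    (hz : z ∈ integralLattice (k + 1) m) : homotopy k r a z ∈ integralLattice k m := by
  simp only [homotopy, LinearMap.sum_apply, LinearMap.smul_apply]
  refine AddSubgroup.sum_mem _ fun i _ => neg_one_pow_smul_mem (AddSubgroup.sum_mem _ fun j _ =>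
      ?_) _
  split_ifs
  · exact slide_mem_integralLattice i j a hz
  · exact zero_mem _

theorem rotation_mem_integralLattice (r : Fin 4) (a : ℕ) {z : P 4}
    (hz : z ∈ integralLattice 4 m) : rotation r a z ∈ integralLattice 4 m := by
  simp only [rotation, LinearMap.sum_apply]
  refine AddSubgroup.sum_mem _ fun i _ => ?_
  split_ifs with h
  · refine neg_one_pow_smul_mem ?_ _
    refine op_mem_integralLattice _ (moved r i) (fun p q hpq => ?_)
      (power_mem_integralLattice i a hz)
    rw [FreeMonoid.mem_of] at hpq
    exact (moved_injective h hpq).symm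
  · exact zero_mem _

theorem smul_mem_of_eq_int {H : AddSubgroup (P n)} {x : P n} (hx : x ∈ H) {q : ℚ}
    (hq : ∃ z : ℤ, q = z) : q • x ∈ H := by
  obtain ⟨z, rfl⟩ := hq
  rw [Int.cast_smul_eq_zsmul]
  exact H.zsmul_mem hx z

theorem factorial_smul_average_mem {c : ℕ → ℚ} {M : ℕ} (hc : ∀ b ≤ M, ∃ z : ℤ, (M ! : ℚ) * c b = z)
    {H : AddSubgroup (P k)} {F : ℕ → P n →ₗ[ℚ] P k} {z : P n} (h : ∀ a, F a z ∈ H) :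
    (M ! : ℚ) • average c M F z ∈ H := by
  rw [average_apply, Finset.smul_sum]
  refine AddSubgroup.sum_mem _ fun a ha => ?_
  rw [smul_smul]
  exact smul_mem_of_eq_int (h a) (hc a (Nat.lt_succ_iff.1 (Finset.mem_range.1 ha)))

/-- The coefficients of a polynomial with integral values are integral up to a factorial. -/
theorem factorial_smul_coeff_mem {H : AddSubgroup (P n)} {K : ℕ} {y : ℕ → P n}
    (h : ∀ b ≤ K, ∑ t ∈ Finset.range (K + 1), (b : ℚ) ^ t • y t ∈ H) {t : ℕ} (ht : t ≤ K) :
    (K ! : ℚ) • y t ∈ H := by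
  obtain ⟨c, hc, hi⟩ := exists_weights K t
  have e : y t = ∑ b ∈ Finset.range (K + 1), c b • ∑ s ∈ Finset.range (K + 1), (b : ℚ) ^ s • y s :=
      by
    simp only [Finset.smul_sum, smul_smul]
    rw [Finset.sum_comm, Finset.sum_eq_single t]
    · rw [← Finset.sum_smul, hc t ht, if_pos rfl, one_smul]
    · intro s hs hst
      rw [← Finset.sum_smul, hc s (Nat.lt_succ_iff.1 (Finset.mem_range.1 hs)), if_neg hst,
          zero_smul]
    · exact fun h => absurd (Finset.mem_range.2 (Nat.lt_succ_of_le ht)) h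
  rw [e, Finset.smul_sum]
  refine AddSubgroup.sum_mem _ fun b hb => ?_
  have hb' := Nat.lt_succ_iff.1 (Finset.mem_range.1 hb)
  rw [smul_smul]
  exact smul_mem_of_eq_int (h b hb') (hi b hb')

end integrality

/-! ### Components of given total weight -/

section components

/-- Scaling by `b` multiplies total weight `j` by `b ^ j`, so interpolation weights in `b` project
to one total weight. -/
theorem average_scale_mem_weightSpace {M K t : ℕ} {e : ℕ → ℚ}
    (he : ∀ s ≤ K, ∑ b ∈ Finset.range (K + 1), e b * (b : ℚ) ^ s = if s = t then 1 else 0) {z : P 4}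
    (hz : z ∈ Submodule.span ℚ {u : P 4 | ∃ s : Fin 4 → ℕ, IsWeight s u ∧
      (∀ i, 1 ≤ s i ∧ s i ≤ M) ∧ ∑ i, s i ≤ K}) :
    average e K scale z ∈ weightSpace M 0 t := by
  have : Submodule.span ℚ {u : P 4 | ∃ s : Fin 4 → ℕ, IsWeight s u ∧
      (∀ i, 1 ≤ s i ∧ s i ≤ M) ∧ ∑ i, s i ≤ K} ≤ (weightSpace M 0 t).comap (average e K scale) := by
    refine Submodule.span_le.2 ?_
    rintro u ⟨s, h1, h2, h3⟩
    change average e K scale u ∈ weightSpace M 0 t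
    simp only [average_apply, h1.scale, smul_smul]
    rw [← Finset.sum_smul, he _ h3]
    split_ifs with h
    · rw [one_smul]
      exact Submodule.subset_span ⟨s, h1, h2, fun i hi => absurd hi (Nat.not_lt_zero _), h⟩
    · rw [zero_smul]; exact zero_mem _
  exact this hz

theorem sum_average_scale {M K : ℕ} {e : ℕ → ℕ → ℚ}
    (he : ∀ t, ∀ s ≤ K, ∑ b ∈ Finset.range (K + 1), e t b * (b : ℚ) ^ s = if s = t then 1 else 0)
    {z : P 4} (hz : z ∈ Submodule.span ℚ {u : P 4 | ∃ s : Fin 4 → ℕ, IsWeight s u ∧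
      (∀ i, 1 ≤ s i ∧ s i ≤ M) ∧ ∑ i, s i ≤ K}) :
    ∑ t ∈ Finset.range (K + 1), average (e t) K scale z = z := by
  have : Submodule.span ℚ {u : P 4 | ∃ s : Fin 4 → ℕ, IsWeight s u ∧
      (∀ i, 1 ≤ s i ∧ s i ≤ M) ∧ ∑ i, s i ≤ K} ≤ LinearMap.eqLocus
        (∑ t ∈ Finset.range (K + 1), average (e t) K scale) LinearMap.id := by
    refine Submodule.span_le.2 ?_
    rintro u ⟨s, h1, h2, h3⟩
    change (∑ t ∈ Finset.range (K + 1), average (e t) K scale) u = u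
    simp only [LinearMap.sum_apply, average_apply, h1.scale, smul_smul, ← Finset.sum_smul]
    rw [Finset.sum_congr rfl fun t _ => he t _ h3, Finset.sum_ite_eq,
      if_pos (Finset.mem_range.2 (Nat.lt_succ_of_le h3)), one_smul]
  have := this hz
  rw [LinearMap.mem_eqLocus] at this
  simpa [LinearMap.sum_apply] using this

end components

/-! ### The integral primitive of a cocycle -/

theorem mem_of_sum_pow_mem {H : AddSubgroup (P n)} {K : ℕ} {y : ℕ → P n}
    (h : ∀ b ≤ K, ∑ t ∈ Finset.range (K + 1), (b : ℚ) ^ t • y t ∈ H) {t : ℕ} (ht : t ≤ K) :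
    K ! • y t ∈ H := by
  have := factorial_smul_coeff_mem h ht
  rwa [Nat.cast_smul_eq_nsmul] at this

/-- With `j = i + 4`, eliminating `w₁` and `w₂` from the three averaged identities exhibits `j (j -
1) (j - 2) z` as a coboundary, once `w₃ = 0` is known. `A`, `B`, `C` are the denominators of the
three homotopies and `N` is a common multiple. -/
theorem exists_preimage_of_component {M q i : ℕ} {c : ℕ → ℚ} (hc : ExtractsLinear c M)
    {H : AddSubgroup (P 3)} {z : P 4} (hz : z ∈ weightSpace M 0 (i + 4))
    (hd : differential 4 z = 0) (hrev : permute Fin.revPerm z = -z) {A B C : ℕ}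
    (h0 : A • average c M (homotopy 3 0) z ∈ H)
    (h1 : B • average c M (homotopy 3 1) (average c M (rotation 0) z) ∈ H)
    (h2 : C • average c M (homotopy 3 2) (average c M (rotation 1) (average c M (rotation 0) z)) ∈
        H)
    {N : ℕ} (hA : A ∣ N) (hB : B ∣ N) (hC : C ∣ N) :
    ∃ y ∈ H, differential 3 y = (q * ((i + 4) * (i + 3) * (i + 2)) * N) • z := by
  set w₁ := average c M (rotation 0) z with hw₁
  set w₂ := average c M (rotation 1) w₁ with hw₂
  set w₃ := average c M (rotation 2) w₂ with hw₃
  have m1 : w₁ ∈ weightSpace M 1 (i + 4) := average_rotation_mem hc 0 hz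
  have m2 : w₂ ∈ weightSpace M 2 (i + 4) := average_rotation_mem hc 1 m1
  have m3 : w₃ ∈ weightSpace M 3 (i + 4) := average_rotation_mem hc 2 m2
  have e0 := differential_average_homotopy_zero hc hz hd
  -- Applying `d` to `e0`: as `d d = 0` and `z` is a cocycle, so is `w₁`. The same argument
  -- propagates to `w₂` and `w₃`.
  have d1 : differential 4 w₁ = 0 := by
    have := congrArg (differential 4) e0
    rw [differential_differential_three, map_sub, map_smul, hd, smul_zero, zero_sub] at this
    exact neg_eq_zero.1 this.symm
  have e1 := differential_average_homotopy_one hc m1 d1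
  have d2 : differential 4 w₂ = 0 := by
    have := congrArg (differential 4) e1
    rw [differential_differential_three, map_sub, map_smul, d1, smul_zero, zero_sub] at this
    exact neg_eq_zero.1 this.symm
  have e2 := differential_average_homotopy_two hc m2 d2
  have d3 : differential 4 w₃ = 0 := by
    have := congrArg (differential 4) e2
    rw [differential_differential_three, map_sub, map_smul, d2, smul_zero, zero_sub] at this
    exact neg_eq_zero.1 this.symm
  have e3 := average_rotation_three hc m3 d3
  rw [hw₃, hw₂, hw₁, average_rotation_eq_zero c M hrev, ← hw₁, ← hw₂, ← hw₃] at e3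
  -- The factor is `j - 3 = i + 1`, which is positive.
  have z3 : w₃ = 0 := by
    refine (smul_eq_zero.1 e3.symm).resolve_left ?_
    push_cast
    have : (0 : ℚ) ≤ i := Nat.cast_nonneg i
    linarith
  rw [← hw₃, z3, sub_zero] at e2
  rw [← hw₂] at e1
  rw [← hw₁] at e0
  obtain ⟨A', rfl⟩ := hA
  obtain ⟨B', hB'⟩ := hB
  obtain ⟨C', hC'⟩ := hC
  -- The coefficients `(j - 1)(j - 2)`, `j - 2` and `1` make `w₁` and `w₂` cancel; `A'`, `B'`, `C'`
  -- bring the three terms to the common factor `N`.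
  refine ⟨(q * (i + 3) * (i + 2) * A') • A • average c M (homotopy 3 0) z
    + (q * (i + 2) * B') • B • average c M (homotopy 3 1) w₁
    + (q * C') • C • average c M (homotopy 3 2) w₂,
    add_mem (add_mem (H.nsmul_mem h0 _) (H.nsmul_mem h1 _)) (H.nsmul_mem h2 _), ?_⟩
  simp only [map_add, map_nsmul, e0, e1, e2]
  have hB'' : (A : ℚ) * A' = B * B' := by exact_mod_cast hB'
  have hC'' : (A : ℚ) * A' = C * C' := by exact_mod_cast hC'
  simp only [← Nat.cast_smul_eq_nsmul ℚ, smul_smul, smul_sub]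
  push_cast
  have b1 (x : ℚ) : (q : ℚ) * (i + 2) * B' * (B * x) = q * (i + 2) * (A * A') * x := by
    rw [hB'']; ring
  have b2 : (q : ℚ) * (i + 2) * B' * B = q * (i + 2) * (A * A') := by rw [hB'']; ring
  have c1 (x : ℚ) : (q : ℚ) * C' * (C * x) = q * (A * A') * x := by rw [hC'']; ring
  rw [b1, b2, c1]
  module

/-- Here `m = M + 1`. The cocycle is split by total weight, each component is handled by
`exists_preimage_of_component`, and the results are added. The components may be fractional;
integrality is only needed, and only proved, for their images under the homotopies. -/
theorem exists_preimage_of_cocycle {M : ℕ} {z : P 4} (hz : z ∈ integralLattice 4 (M + 1))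
    (hd : differential 4 z = 0) (hrev : permute Fin.revPerm z = -z) :
    ∃ y ∈ integralLattice 3 (M + 1), differential 3 y
      = ((M + 2)! * (((M + 1)!) ^ 2 * (M !) ^ 2)) • z := by
  set L := integralLattice 3 (M + 1) with hL
  have hspan := mem_span_weights_of_mem_integralLattice hz
  rw [Nat.add_sub_cancel] at hspan
  obtain ⟨c, hc, hci⟩ := exists_weights M 1
  -- The bound for the total weight is `m + 1 = M + 2`, that for a single string is `M`. The
  -- denominators of `e` play no role.
  choose e he _ using exists_weights (M + 2)
  set x : ℕ → P 4 := fun j => average (e j) (M + 2) scale z with hx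
  have hxm : ∀ j, x j ∈ weightSpace M 0 j := fun j => average_scale_mem_weightSpace (he j) hspan
  have hxs : ∑ j ∈ Finset.range (M + 3), x j = z := sum_average_scale he hspan
  have hxd : ∀ j, differential 4 (x j) = 0 := fun j => by
    simp only [hx, average_apply, map_sum, map_smul, differential_scale, hd, map_zero, smul_zero,
      Finset.sum_const_zero]
  have hxr : ∀ j, permute Fin.revPerm (x j) = -x j := fun j => by
    simp only [hx, average_apply, map_sum, map_smul, permute_scale, hrev, map_neg, smul_neg,
      Finset.sum_neg_distrib]
  set w₁ : ℕ → P 4 := fun j => average c M (rotation 0) (x j) with hw₁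
  set w₂ : ℕ → P 4 := fun j => average c M (rotation 1) (w₁ j) with hw₂
  have m1 : ∀ j, w₁ j ∈ weightSpace M 1 j := fun j => average_rotation_mem hc 0 (hxm j)
  have m2 : ∀ j, w₂ j ∈ weightSpace M 2 j := fun j => average_rotation_mem hc 1 (m1 j)
  have s1 : ∑ t ∈ Finset.range (M + 2), w₁ (t + 1) = average c M (rotation 0) z := by
    rw [← hxs, map_sum, Finset.sum_range_succ' _ (M + 2)]
    rw [weightSpace_eq_zero (by norm_num) (hxm 0), map_zero, add_zero]
  have s2 : ∑ t ∈ Finset.range (M + 1), w₂ (t + 2)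
      = average c M (rotation 1) (average c M (rotation 0) z) := by
    rw [← s1, map_sum, Finset.sum_range_succ' _ (M + 1)]
    rw [weightSpace_eq_zero (by norm_num) (m1 1), map_zero, add_zero]
  -- There is no component of weight zero, so the weights are shifted by one and the interpolation
  -- has degree `M + 1` instead of `M + 2`. This requires dividing the value at `b` by `b`, for
  -- which the second `(M + 1)!` pays; `M !` is for the average.
  have i0 : ∀ t ≤ M + 1, ((M + 1)! * (M + 1)! * M !) • average c M (homotopy 3 0) (x (t + 1)) ∈ L
      := by
    intro t ht
    rw [mul_assoc, mul_smul, mul_smul]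
    refine mem_of_sum_pow_mem (K := M + 1)
      (y := fun t => (M + 1)! • M ! • average c M (homotopy 3 0) (x (t + 1))) (fun b hb => ?_) ht
    rcases Nat.eq_zero_or_pos b with rfl | hb0
    · rw [Finset.sum_range_succ', Finset.sum_eq_zero fun t _ => by simp,
        weightSpace_eq_zero (by norm_num) (hxm (0 + 1))]
      simp
    · obtain ⟨q, hq⟩ := Nat.dvd_factorial hb0 hb
      have f : (M ! : ℚ) • average c M (homotopy 3 0) (scale b z) ∈ L :=
        factorial_smul_average_mem hci fun a =>
          homotopy_mem_integralLattice 0 a (by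
            rw [scale_four]
            exact power_mem_integralLattice _ _ (power_mem_integralLattice _ _
              (power_mem_integralLattice _ _ (power_mem_integralLattice _ _ hz))))
      have g : scale b z = ∑ t ∈ Finset.range (M + 2), (b : ℚ) ^ (t + 1) • x (t + 1) := by
        conv_lhs => rw [← hxs, map_sum, Finset.sum_range_succ' _ (M + 2)]
        rw [weightSpace_eq_zero (by norm_num) (hxm 0), map_zero, add_zero]
        exact Finset.sum_congr rfl fun t _ => scale_of_mem_weightSpace (hxm _) b
      have := L.nsmul_mem f q
      convert this using 1
      rw [g]
      simp only [map_sum, map_smul, Finset.smul_sum, hq, ← Nat.cast_smul_eq_nsmul ℚ, smul_smul]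
      refine Finset.sum_congr rfl fun t _ => ?_
      congr 1
      push_cast
      ring
  have l1 : (M ! : ℚ) • average c M (rotation 0) z ∈ integralLattice 4 (M + 1) :=
    factorial_smul_average_mem hci fun a => rotation_mem_integralLattice 0 a hz
  have l2 : (M ! : ℚ) • average c M (rotation 1) ((M ! : ℚ) • average c M (rotation 0) z)
      ∈ integralLattice 4 (M + 1) :=
    factorial_smul_average_mem hci fun a => rotation_mem_integralLattice 1 a l1
  -- Only the last three strings are scaled, so the weight is already shifted and no division
  -- occurs. One `M !` is for the rotation and one for the homotopy.
  have i1 : ∀ t ≤ M + 1, ((M + 1)! * (M ! * M !)) • average c M (homotopy 3 1) (w₁ (t + 1)) ∈ L :=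
      by
    intro t ht
    rw [mul_smul]
    refine mem_of_sum_pow_mem (K := M + 1)
      (y := fun t => (M ! * M !) • average c M (homotopy 3 1) (w₁ (t + 1))) (fun b _ => ?_) ht
    have f : (M ! : ℚ) • average c M (homotopy 3 1) (power 1 b (power 2 b (power 3 b
        ((M ! : ℚ) • average c M (rotation 0) z)))) ∈ L :=
      factorial_smul_average_mem hci fun a => homotopy_mem_integralLattice 1 a
        (power_mem_integralLattice _ _ (power_mem_integralLattice _ _
          (power_mem_integralLattice _ _ l1)))
    convert f using 1
    rw [← s1]
    simp only [map_sum, map_smul, Finset.smul_sum, power_of_mem_weightSpace_one (m1 _),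
      ← Nat.cast_smul_eq_nsmul ℚ, smul_smul]
    refine Finset.sum_congr rfl fun t _ => ?_
    congr 1
    push_cast
    ring
  -- Scaling the last two strings shifts by two, so interpolation costs only `M !`; two rotations
  -- and one homotopy account for the rest.
  have i2 : ∀ t ≤ M, (M ! * (M ! * M ! * M !)) • average c M (homotopy 3 2) (w₂ (t + 2)) ∈ L := by
    intro t ht
    rw [mul_smul]
    refine mem_of_sum_pow_mem (K := M)
      (y := fun t => (M ! * M ! * M !) • average c M (homotopy 3 2) (w₂ (t + 2))) (fun b _ => ?_) ht
    have f : (M ! : ℚ) • average c M (homotopy 3 2) (power 2 b (power 3 b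
        ((M ! : ℚ) • average c M (rotation 1) ((M ! : ℚ) • average c M (rotation 0) z)))) ∈ L :=
      factorial_smul_average_mem hci fun a => homotopy_mem_integralLattice 2 a
        (power_mem_integralLattice _ _ (power_mem_integralLattice _ _ l2))
    convert f using 1
    rw [map_smul (average c M (rotation 1)), ← s2]
    simp only [map_sum, map_smul, Finset.smul_sum, power_of_mem_weightSpace_two (m2 _),
      ← Nat.cast_smul_eq_nsmul ℚ, smul_smul]
    refine Finset.sum_congr rfl fun t _ => ?_
    congr 1
    push_cast
    ring
  have key : ∀ j ∈ Finset.range (M + 3), ∃ y ∈ L, differential 3 y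
      = ((M + 2)! * (((M + 1)!) ^ 2 * (M !) ^ 2)) • x j := by
    intro j hj
    rw [Finset.mem_range] at hj
    rcases lt_or_ge j 4 with h4 | h4
    · exact ⟨0, zero_mem _, by rw [weightSpace_eq_zero h4 (hxm j), smul_zero, map_zero]⟩
    · obtain ⟨i, rfl⟩ := Nat.exists_eq_add_of_le' h4
      obtain ⟨r, hr⟩ := Nat.factorial_dvd_factorial (show i + 4 ≤ M + 2 by omega)
      -- The factor `j (j - 1) (j - 2)` splits off `j !`, which divides `(M + 2)!` because `j ≤ M +
      -- 2`.
      have hr' : (M + 2)! = ((i + 1)! * r) * ((i + 4) * (i + 3) * (i + 2)) := by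
        rw [hr, Nat.factorial_succ, Nat.factorial_succ, Nat.factorial_succ]
        ring
      rw [hr']
      refine exists_preimage_of_component hc (hxm _) (hxd _) (hxr _) (i0 (i + 3) (by omega))
        (i1 (i + 3) (by omega)) (i2 (i + 2) (by omega)) ?_ ?_ ?_
      · exact ⟨M !, by ring⟩
      · exact ⟨(M + 1)!, by ring⟩
      · exact ⟨(M + 1) ^ 2, by rw [Nat.factorial_succ]; ring⟩
  choose! y hy hdy using key
  refine ⟨∑ j ∈ Finset.range (M + 3), y j, AddSubgroup.sum_mem _ hy, ?_⟩
  rw [map_sum, Finset.sum_congr rfl hdy, ← Finset.smul_sum, hxs]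

theorem permute_rev_rev (z : P n) : permute Fin.revPerm (permute Fin.revPerm z) = z := by
  rw [permute_eq_op, permute_eq_op, op_op]
  refine Eq.trans (LinearMap.congr_fun (op_congr fun a => ?_) z) (op_of z)
  simp

/-- For `n = 4` the sign in the symmetry condition is `+`, so `σ x = -x`. Reversal commutes with `d`
from three to four strings, so the primitive `y` may be replaced by `y - σ y`, whose differential is
that of `y` doubled. -/
theorem factorials_smul_symCohomology_four (m : ℕ) (hm : 1 ≤ m) (z : SymCohomology 4 m) :
    (2 * (m + 1)! * (m !) ^ 2 * ((m - 1)!) ^ 2) • z = 0 := by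
  obtain ⟨⟨⟨x, hxL, hxs⟩, hx⟩, rfl⟩ := QuotientAddGroup.mk_surjective z
  obtain ⟨M, rfl⟩ := Nat.exists_eq_add_of_le' hm
  have hd : differential 4 x = 0 := congrArg Subtype.val hx
  have hrev : permute Fin.revPerm x = -x := by
    have hxs := mem_symmetricPart.1 hxs
    norm_num at hxs
    exact (neg_eq_of_add_eq_zero_right hxs).symm
  obtain ⟨y, hyL, hy⟩ := exists_preimage_of_cocycle hxL hd hrev
  have hry := permute_differential y
  norm_num at hry
  refine (QuotientAddGroup.eq_zero_iff _).2 (AddSubgroup.mem_addSubgroupOf.2 ?_)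
  -- For `n = 3` the sign is also `+`, so symmetric cochains are again the anti-invariants of the
  -- reversal.
  refine ⟨⟨y - permute Fin.revPerm y,
    AddSubgroup.sub_mem _ hyL (permute_mem_integralLattice _ hyL), mem_symmetricPart.2 ?_⟩, ?_⟩
  · rw [map_sub, permute_rev_rev]
    norm_num
  · refine Subtype.ext ?_
    change differential 3 (y - permute Fin.revPerm y) = _ • x
    rw [map_sub, ← hry, hy, map_nsmul, hrev, smul_neg, sub_neg_eq_add, ← two_smul ℕ, smul_smul]
    congr 1
    rw [Nat.add_sub_cancel]
    ring

end

end CobarComplex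

theorem mainTheorem4 (m : ℕ) (hm : 1 ≤ m) (z : CobarComplex.SymCohomology 4 m) :
    (2 * (m + 1)! * (m !) ^ 2 * ((m - 1)!) ^ 2) • z = 0 :=
  CobarComplex.factorials_smul_symCohomology_four m hm z
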